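/- All graphs are finite, simple and connected. A \emph{cellular embedding} of a graph $G$ on a closed surface is described, as usual, by a rotation system (a cyclic ordering of the edges at each vertex) together with a signature $E(G)\to\{1,-1\}$; its facial walks are those produced by the face traversal algorithm, and the surface is the sphere, the torus or the Klein bottle according to orientability and Euler characteristic (orientable with $\chi=2$, orientable with $\chi=0$, non-orientable with $\chi=0$). The embedding is \emph{strong} if every facial walk is a cycle. Two strong embeddings of $G$ are \emph{isomorphic} if some automorphism of $G$ maps the set of facial cycles of the first onto the set of facial cycles of the second. For $n>3$ let $T_n$ be the graph on the $2n+5$ vertices $v_1,\dots,v_{2n+2},w_1,w_2,w_3$ whose edges are those of the cycle $(v_1,\dots,v_{2n})$, all edges joining $v_{2n+1}$ and $v_{2n+2}$ to $v_1,\dots,v_{2n}$, the edges joining $w_1$ to $v_1,v_2,v_{2n+1}$, those joining $w_2$ to $v_1,v_2,w_1$, and those joining $w_3$ to $v_2,v_3,v_{2n+1}$. \textbf{Theorem.} Let $n>3$ be a natural number and $i:=n \bmod 2$. Then there exists a $3$-connected cubic planar graph $G$ that has at least $\binom{2n}{n-i}$ pairwise non-isomorphic strong embeddings on the torus and at least $\binom{2n}{n-1+i}$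 pairwise non-isomorphic strong embeddings on the Klein bottle. Moreover, $G$ can be chosen as the dual graph of $T_n$, where $T_n$ is a planar triangulation with trivial automorphism group which, for each $j\in\{0,1\}$, has at least $\binom{2n}{n-j}$ subgraphs isomorphic to $K_{2,n-j}$ having a partition set of size two whose two vertices are not adjacent in $T_n$. -/

import Mathlib

namespace StrongEmb

open SimpleGraph

variable {V W : Type*}

/-- `G` is `k`-connected: it has more than `k` vertices and stays connected after deletion of
any set of fewer than `k` vertices. -/
def IsKConnected (k : ℕ) (G : SimpleGraph V) : Prop :=
  k < Nat.card V ∧ ∀ S : Finset V, S.card < k → (G.induce {v | v ∉ S}).Connected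

/-- Every vertex has exactly three neighbours. -/
def IsCubic (G : SimpleGraph V) : Prop :=
  ∀ v, (G.neighborSet v).ncard = 3

/-- A cellular embedding of a connected graph `G` (with at least one edge) on a closed surface,
given by a rotation system and a signature. A dart with first vertex `v` is an edge incident
to `v`; `rot` sends it to the next edge in the cyclic ordering at `v`. The edges with sign `-1`
are the twisted edges. -/
structure CellularEmbedding (G : SimpleGraph V) where
  /-- the rotation system -/
  rot : Equiv.Perm G.Dart
  rot_fst : ∀ d, (rot d).fst = d.fst
  /-- at each vertex the rotation is one single cycle through all incident edges -/
  rot_cyclic : ∀ d e : G.Dart, d.fst = e.fst → rot.SameCycle d e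
  /-- the signature -/
  sign : G.edgeSet → ℤˣ

namespace CellularEmbedding

variable {G : SimpleGraph V} (E : CellularEmbedding G)

/-- The sign of the edge underlying a dart. -/
def dartSign (d : G.Dart) : ℤˣ := E.sign ⟨d.edge, d.edge_mem⟩

theorem dartSign_symm (d : G.Dart) : E.dartSign d.symm = E.dartSign d := by
  unfold dartSign
  congr 1
  exact Subtype.ext d.edge_symm

/-- One step of the face traversal. A state `(d, s)` says that the edge `d` is about to be
traversed from `d.fst` to `d.snd`, the local sense of rotation being `s`. The sense flips if the
edge is twisted, and then the walk leaves `d.snd` along the successor (sense `1`) or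
the predecessor (sense `-1`) of the edge just used. -/
def next : Equiv.Perm (G.Dart × ℤˣ) where
  toFun x := ((E.rot ^ ((x.2 * E.dartSign x.1 : ℤˣ) : ℤ)) x.1.symm, x.2 * E.dartSign x.1)
  invFun y :=
    let d := ((E.rot ^ (-(y.2 : ℤ))) y.1).symm
    (d, y.2 * E.dartSign d)
  left_inv := by
    rintro ⟨d, s⟩
    simp [mul_assoc, Int.units_mul_self]
  right_inv := by
    rintro ⟨d, s⟩
    simp [mul_assoc, Int.units_mul_self]

/-- Reversal of the direction of traversal of a face. -/
def rev : Equiv.Perm (G.Dart × ℤˣ) :=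
  Function.Involutive.toPerm (fun x => (x.1.symm, -(x.2 * E.dartSign x.1))) (by
    rintro ⟨d, s⟩
    simp [dartSign_symm, mul_assoc, Int.units_mul_self])

/-- The faces (cells): the orbits of states under face traversal and reversal. -/
abbrev Face : Type _ :=
  MulAction.orbitRel.Quotient (Subgroup.closure {E.next, E.rev}) (G.Dart × ℤˣ)

/-- The face traced out from a state. -/
def faceOf (x : G.Dart × ℤˣ) : E.Face := Quotient.mk _ x

/-- The edges on the boundary of a face. -/
def faceEdges (f : E.Face) : Set (Sym2 V) :=
  {e | ∃ x : G.Dart × ℤˣ, E.faceOf x = f ∧ x.1.edge = e}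

/-- The closed walk `w` is a facial walk: it lists the edges met by the face traversal,
from some initial state until that state recurs for the first time. -/
def IsFacialWalk {v : V} (w : G.Walk v v) : Prop :=
  ∃ x : G.Dart × ℤˣ, w.darts =
    (List.range (Function.minimalPeriod E.next x)).map fun i => (E.next^[i] x).1

/-- The embedding is strong: all facial walks are cycles. -/
def IsStrong : Prop := ∀ (v : V) (w : G.Walk v v), E.IsFacialWalk w → w.IsCycle

/-- The set of facial cycles of a strong embedding, each cycle being a subgraph of `G`. -/
def facialCycles : Set G.Subgraph :=
  {C | ∃ (v : V) (w : G.Walk v v), E.IsFacialWalk w ∧ w.toSubgraph = C}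

/-- Two (strong) embeddings are isomorphic if some automorphism of `G` carries the
set of facial cycles of the first to that of the second. -/
def Isomorphic (E E' : CellularEmbedding G) : Prop :=
  ∃ φ : G ≃g G, Subgraph.map φ.toHom '' E.facialCycles = E'.facialCycles

/-- The surface is orientable: after reversing the local orientation (that is, the rotation)
at suitable vertices there are no twisted edges. -/
def IsOrientable : Prop :=
  ∃ o : V → ℤˣ, ∀ d : G.Dart, E.dartSign d = o d.fst * o d.snd

/-- The Euler characteristic of the surface. -/
noncomputable def eulerChar : ℤ :=
  (Nat.card V : ℤ) - Nat.card G.edgeSet + Nat.card E.Face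

/-- The surface is the sphere. -/
def OnSphere : Prop := E.IsOrientable ∧ E.eulerChar = 2

/-- The surface is the torus. -/
def OnTorus : Prop := E.IsOrientable ∧ E.eulerChar = 0

/-- The surface is the Klein bottle. -/
def OnKleinBottle : Prop := ¬ E.IsOrientable ∧ E.eulerChar = 0

end CellularEmbedding

/-- Planarity of a connected graph with at least one edge. -/
def IsPlanar (G : SimpleGraph V) : Prop :=
  G.Connected ∧ ∃ E : CellularEmbedding G, E.OnSphere

/-- A planar triangulation: a planar graph all of whose faces are triangles. -/
def IsPlanarTriangulation (G : SimpleGraph V) : Prop :=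
  G.Connected ∧ ∃ E : CellularEmbedding G, E.OnSphere ∧
    ∀ (v : V) (w : G.Walk v v), E.IsFacialWalk w → w.IsCycle ∧ w.length = 3

/-- `G` is a dual graph of the planar graph `T`: for some embedding of `T` on the sphere
the vertices of `G` correspond to the faces of `T` and the edges of `G` to the edges of `T`, such
that a vertex of `G` is an end of an edge iff the corresponding face is incident to the
corresponding edge. -/
def IsDualOf (G : SimpleGraph W) (T : SimpleGraph V) : Prop :=
  T.Connected ∧ ∃ E : CellularEmbedding T, E.OnSphere ∧
    ∃ (f : W ≃ E.Face) (g : G.edgeSet ≃ T.edgeSet),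
      ∀ (v : W) (e : G.edgeSet), v ∈ (e : Sym2 W) ↔ (g e : Sym2 V) ∈ E.faceEdges (f v)

/-- `G` has at least `k` pairwise non-isomorphic strong embeddings with the property `P`. -/
def HasNonIsomorphicStrongEmbeddings (G : SimpleGraph V) (P : CellularEmbedding G → Prop)
    (k : ℕ) : Prop :=
  ∃ F : Fin k → CellularEmbedding G,
    (∀ a, (F a).IsStrong ∧ P (F a)) ∧ ∀ a b, a ≠ b → ¬ (F a).Isomorphic (F b)

/-- The graph `T_n` (`n ≥ 2`) on `2n + 5` vertices. The vertex `v_j`, `1 ≤ j ≤ 2n + 2`, has number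
`j - 1`, and `w_1, w_2, w_3` have numbers `2n + 2, 2n + 3, 2n + 4`. -/
def T (n : ℕ) : SimpleGraph (Fin (2 * n + 5)) :=
  SimpleGraph.fromRel fun a b =>
    -- the cycle `v_1, ..., v_{2n}`
    (a.val + 1 = b.val ∧ b.val < 2 * n) ∨ (a.val + 1 = 2 * n ∧ b.val = 0) ∨
    -- `v_{2n+1}` and `v_{2n+2}` are joined to the whole cycle
    (a.val < 2 * n ∧ (b.val = 2 * n ∨ b.val = 2 * n + 1)) ∨
    -- `w_1` subdivides the triangle `v_1, v_2, v_{2n+1}`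
    ((a.val = 0 ∨ a.val = 1 ∨ a.val = 2 * n) ∧ b.val = 2 * n + 2) ∨
    -- `w_2` subdivides the triangle `v_1, v_2, w_1`
    ((a.val = 0 ∨ a.val = 1 ∨ a.val = 2 * n + 2) ∧ b.val = 2 * n + 3) ∨
    -- `w_3` subdivides the triangle `v_2, v_3, v_{2n+1}`
    ((a.val = 1 ∨ a.val = 2 ∨ a.val = 2 * n) ∧ b.val = 2 * n + 4)

/-- The subgraphs of `G` isomorphic to `K_{2,m}` with a partition set of size two whose two
vertices are not adjacent in `G`. -/
def nonadjacentK2 (G : SimpleGraph V) (m : ℕ) : Set G.Subgraph :=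
  {H | ∃ φ : completeBipartiteGraph (Fin 2) (Fin m) ≃g H.coe,
    ¬ G.Adj (φ (Sum.inl 0)).val (φ (Sum.inl 1)).val}

end StrongEmb

/-! ### Face traversal in an arbitrary embedding. -/

namespace StrongEmb

open SimpleGraph

namespace CellularEmbedding

variable {V : Type*} {G : SimpleGraph V} (E : CellularEmbedding G)

/-! The vertices of the dual graph are the triangles of `T n`, and its spherical embedding has one
face for each vertex of `T n`. Choose a set `C` of `m` vertices of the cycle and twist exactly those
dual edges that cross the `2 * m` edges between `C` and the two hubs, that is, the edges of a
`K_{2,m}`. Every strong embedding that is needed arises in this way (`Triangulation.twist`,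
`spokes`).

Faces are best seen as classes of corners of triangles. An untwisted edge glues the two corners at
the same end of the crossed edge, a twisted one glues corners diagonally across it. Hence a vertex
outside the `K_{2,m}` keeps its face, while the `m + 2` faces at the vertices of the `K_{2,m}` are
recombined. Cutting the cycle at `C` leaves `m` sectors. The new face of a sector contains all
corners of both hubs in that sector and, at each of the two elements of `C` bounding it, the corners
on the far side. So there are `m` new faces, and the Euler characteristic drops from 2 to 0
(`cornerLabel_isCornerLabel` for invariance of the labels, `cornerFace_eq_of_cornerLabel_eq` for
their completeness, `twist_eulerChar`).

In a triangle in sector `k`, the hub has the label `k` and an element of `C` has `k - 1` or `k + 1`,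
according to its side. For `m ≥ 3` these are distinct, so no face visits a triangle twice and the
embedding is strong (`cornerLabel_turn_ne`, `CornerLabel.isStrong`). A circuit of triangles around a
hub crosses `m` twisted edges. Odd `m` therefore gives a Klein bottle, and for even `m` the
triangles of every other sector can be reversed, which gives a torus (`twist_isOrientable`,
`twist_not_isOrientable`).

Different sets give different facial cycles: the cycle around a vertex not in `C` ceases to be
facial as soon as an edge on it is twisted (`facialCycles_ne`). The three extra vertices of `T n`
destroy all symmetry, also in the dual graph (`dual_automorphism_trivial`), so isomorphic embeddings
have equal sets of facial cycles. Counting the sets `C` of size `m` gives the binomial coefficients,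
with `m` the one of `n`, `n - 1` that has the right parity. -/

theorem next_apply (d : G.Dart) (s : ℤˣ) :
    E.next (d, s) = ((E.rot ^ ((s * E.dartSign d : ℤˣ) : ℤ)) d.symm, s * E.dartSign d) := rfl

theorem rev_apply (d : G.Dart) (s : ℤˣ) : E.rev (d, s) = (d.symm, -(s * E.dartSign d)) := rfl

theorem rot_symm_fst (d : G.Dart) : (E.rot.symm d).fst = d.fst := by
  conv_rhs => rw [← E.rot.apply_symm_apply d, E.rot_fst]

theorem rot_unit_fst (u : ℤˣ) (d : G.Dart) : ((E.rot ^ (u : ℤ)) d).fst = d.fst := by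
  rcases Int.units_eq_one_or u with rfl | rfl
  · simpa using E.rot_fst d
  · simpa using E.rot_symm_fst d

theorem next_fst (x : G.Dart × ℤˣ) : (E.next x).1.fst = x.1.snd := by
  obtain ⟨d, s⟩ := x
  rw [next_apply, rot_unit_fst]
  rfl

/-- Reversing and then stepping turns back around the start vertex: the result passes the corner
preceding `(d, s)` in the opposite direction. Thus `next ∘ rev` is the reversal of corners, as `rev`
is the reversal of edges. -/
theorem next_rev (d : G.Dart) (s : ℤˣ) :
    E.next (E.rev (d, s)) = ((E.rot ^ ((-s : ℤˣ) : ℤ)) d, -s) := by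
  rw [rev_apply, next_apply, dartSign_symm, Dart.symm_symm]
  congr 2 <;> simp [mul_assoc, Int.units_mul_self]

theorem rev_rev (x : G.Dart × ℤˣ) : E.rev (E.rev x) = x := by
  obtain ⟨d, s⟩ := x
  simp [rev_apply, dartSign_symm, mul_assoc, Int.units_mul_self]

theorem next_rev_next (x : G.Dart × ℤˣ) : E.next (E.rev (E.next x)) = E.rev x := by
  obtain ⟨⟨d, s⟩, rfl⟩ := E.rev.surjective x
  rw [rev_rev, next_rev, next_rev, neg_neg]
  simp

theorem rev_ne (x : G.Dart × ℤˣ) : E.rev x ≠ x := by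
  obtain ⟨d, s⟩ := x
  intro h
  exact d.symm_ne (congrArg Prod.fst h)

theorem next_rev_ne (x : G.Dart × ℤˣ) : E.next (E.rev x) ≠ x := by
  obtain ⟨d, s⟩ := x
  intro h
  rw [next_rev] at h
  have := congrArg Prod.snd h
  rcases Int.units_eq_one_or s with rfl | rfl
  · exact absurd this (show (-1 : ℤˣ) ≠ 1 by decide)
  · exact absurd this (show (- -1 : ℤˣ) ≠ -1 by decide)

theorem next_iterate_rev_next_iterate (k : ℕ) (x : G.Dart × ℤˣ) :
    E.next^[k] (E.rev (E.next^[k] x)) = E.rev x := by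
  induction k with
  | zero => rfl
  | succ k ih =>
    rw [Function.iterate_succ_apply, Function.iterate_succ_apply' E.next k x, next_rev_next, ih]

/-- A face traversal never runs through a corner in both directions. -/
theorem next_iterate_ne_next_rev (k : ℕ) (x : G.Dart × ℤˣ) :
    E.next^[k] x ≠ E.next (E.rev x) := by
  intro h
  -- A walk leading from a corner to its own reversal would be its own reversal. Its midpoint would
  -- then be a corner (even case) or an edge (odd case) fixed by reversal, and there is none.
  rcases Nat.even_or_odd' k with ⟨j, rfl | rfl⟩
  · rw [two_mul, Function.iterate_add_apply] at h
    refine E.next_rev_ne (E.next^[j] x) ((E.next.injective.iterate j) ?_)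
    rw [h, ← Function.iterate_succ_apply, Function.iterate_succ_apply',
      next_iterate_rev_next_iterate]
  · rw [Function.iterate_succ_apply', two_mul, Function.iterate_add_apply] at h
    refine E.rev_ne (E.next^[j] x) ((E.next.injective.iterate j) ?_)
    rw [next_iterate_rev_next_iterate, E.next.injective h]

/-- The walk that follows the face traversal for `k` steps. -/
theorem exists_walk_darts_eq (x : G.Dart × ℤˣ) (k : ℕ) :
    ∃ w : G.Walk x.1.fst (E.next^[k] x).1.fst,
      w.darts = (List.range k).map fun i => (E.next^[i] x).1 := by
  induction k with
  | zero => exact ⟨Walk.nil, rfl⟩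
  | succ k ih =>
    obtain ⟨w, hw⟩ := ih
    have h : (E.next^[k + 1] x).1.fst = (E.next^[k] x).1.snd := by
      rw [Function.iterate_succ_apply', next_fst]
    rw [h]
    refine ⟨w.concat (E.next^[k] x).1.adj, ?_⟩
    rw [Walk.darts_concat, hw, List.range_succ]
    simp

theorem exists_isFacialWalk (x : G.Dart × ℤˣ) :
    ∃ w : G.Walk x.1.fst x.1.fst, E.IsFacialWalk w ∧ w.darts =
      (List.range (Function.minimalPeriod E.next x)).map fun i => (E.next^[i] x).1 := by
  obtain ⟨w, hw⟩ := E.exists_walk_darts_eq x (Function.minimalPeriod E.next x)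
  have h : (E.next^[Function.minimalPeriod E.next x] x).1.fst = x.1.fst := by
    rw [Function.iterate_minimalPeriod]
  exact ⟨w.copy rfl h, ⟨x, by simpa using hw⟩, by simpa using hw⟩

theorem next_ne (x : G.Dart × ℤˣ) : E.next x ≠ x := by
  intro h
  have := E.next_fst x
  rw [h] at this
  exact x.1.fst_ne_snd this

/-- In a simple graph a return after two steps means going back along the same edge, so the rotation
would fix a dart. -/
theorem next_next_ne (hrot : ∀ d, E.rot d ≠ d) (x : G.Dart × ℤˣ) : E.next (E.next x) ≠ x := by
  intro h
  have h1 := E.next_fst x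
  have h2 := E.next_fst (E.next x)
  rw [h] at h2
  have h3 : (E.next x).1 = x.1.symm := by
    apply Dart.ext
    exact Prod.ext h1 h2.symm
  obtain ⟨d, s⟩ := x
  rw [next_apply] at h3
  simp only at h3
  rcases Int.units_eq_one_or (s * E.dartSign d) with h | h <;> rw [h] at h3
  · exact hrot _ (by simpa using h3)
  · apply hrot d.symm
    conv_lhs => rw [← h3]
    simp

theorem minimalPeriod_next_pos [Finite V] (x : G.Dart × ℤˣ) : 0 < Function.minimalPeriod E.next x := by
  classical
  have : Finite G.Dart := Finite.of_injective _ Dart.toProd_injective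
  exact Function.minimalPeriod_pos_of_mem_periodicPts
    (E.next.injective.mem_periodicPts x)

theorem two_lt_minimalPeriod_next [Finite V] (hrot : ∀ d, E.rot d ≠ d) (x : G.Dart × ℤˣ) :
    2 < Function.minimalPeriod E.next x := by
  have h0 := E.minimalPeriod_next_pos x
  have h := Function.iterate_minimalPeriod (f := E.next) (x := x)
  by_contra! hle
  generalize Function.minimalPeriod E.next x = p at *
  interval_cases p
  · exact E.next_ne x h
  · exact E.next_next_ne hrot x h

/-- If no face traversal visits a vertex twice, the embedding is strong. -/
theorem isStrong_of_injective [Finite V] (hrot : ∀ d, E.rot d ≠ d)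
    (hinj : ∀ x k, (E.next^[k] x).1.fst = x.1.fst → E.next^[k] x = x) : E.IsStrong := by
  rintro v w ⟨x, hw⟩
  set p := Function.minimalPeriod E.next x with hp
  have hp2 : 2 < p := E.two_lt_minimalPeriod_next hrot x
  have hinj' : ∀ i j, i ≤ j → (E.next^[i] x).1.fst = (E.next^[j] x).1.fst →
      E.next^[i] x = E.next^[j] x := by
    intro i j hij h
    obtain ⟨k, rfl⟩ := Nat.exists_eq_add_of_le' hij
    rw [Function.iterate_add_apply] at h ⊢
    exact (hinj _ _ h.symm).symm
  have hinj'' : ∀ i j, (E.next^[i] x).1.fst = (E.next^[j] x).1.fst →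
      E.next^[i] x = E.next^[j] x := by
    intro i j h
    rcases le_total i j with hij | hij
    · exact hinj' i j hij h
    · exact (hinj' j i hij h.symm).symm
  have hmod : ∀ i j, E.next^[i] x = E.next^[j] x → i % p = j % p := by
    intro i j h
    exact (Function.iterate_eq_iterate_iff_of_lt_minimalPeriod (f := E.next) (x := x)
      (Nat.mod_lt _ (by omega)) (Nat.mod_lt _ (by omega))).1
      (by rw [Function.iterate_mod_minimalPeriod_eq, Function.iterate_mod_minimalPeriod_eq, h])
  have hsnd : ∀ i, (E.next^[i] x).1.snd = (E.next^[i + 1] x).1.fst := by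
    intro i
    rw [Function.iterate_succ_apply', next_fst]
  rw [Walk.isCycle_def, Walk.isTrail_def]
  refine ⟨?_, ?_, ?_⟩
  · unfold Walk.edges
    rw [hw, List.map_map]
    refine List.Nodup.map_on ?_ List.nodup_range
    intro i hi j hj h
    rw [List.mem_range] at hi hj
    simp only [Function.comp, dart_edge_eq_iff] at h
    rw [← Nat.mod_eq_of_lt hi, ← Nat.mod_eq_of_lt hj]
    rcases h with h | h
    · exact hmod _ _ (hinj'' _ _ (by rw [h]))
    -- The same edge in opposite directions: equality of start vertices already gives equality of
    -- states, so each of the two states is the successor of the other.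
    · exfalso
      have h1 : (E.next^[i] x).1.fst = (E.next^[j] x).1.snd := by rw [h]; rfl
      have h2 : (E.next^[i] x).1.snd = (E.next^[j] x).1.fst := by rw [h]; rfl
      rw [hsnd] at h1 h2
      have h3 := hinj'' _ _ h1
      have h4 := hinj'' _ _ h2
      rw [Function.iterate_succ_apply'] at h3 h4
      exact E.next_next_ne hrot _ (by rw [h4, ← h3])
  · rintro rfl
    have := congrArg List.length hw
    simp at this
    omega
  · rw [← Walk.map_snd_darts, hw, List.map_map]
    refine List.Nodup.map_on ?_ List.nodup_range
    intro i hi j hj h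
    rw [List.mem_range] at hi hj
    simp only [Function.comp, hsnd] at h
    have h := hinj'' _ _ h
    rw [Function.iterate_succ_apply', Function.iterate_succ_apply'] at h
    have h := hmod _ _ (E.next.injective h)
    rwa [Nat.mod_eq_of_lt hi, Nat.mod_eq_of_lt hj] at h

theorem mem_edgeSet_toSubgraph_iff [Finite V] {x : G.Dart × ℤˣ} {v : V} {w : G.Walk v v}
    (hw : w.darts = (List.range (Function.minimalPeriod E.next x)).map fun i => (E.next^[i] x).1)
    (e : Sym2 V) : e ∈ w.toSubgraph.edgeSet ↔ ∃ i, (E.next^[i] x).1.edge = e := by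
  rw [Walk.mem_edges_toSubgraph, Walk.edges, hw]
  simp only [List.map_map, List.mem_map, List.mem_range, Function.comp]
  constructor
  · rintro ⟨i, -, h⟩
    exact ⟨i, h⟩
  · rintro ⟨i, h⟩
    refine ⟨i % Function.minimalPeriod E.next x,
      Nat.mod_lt _ (E.minimalPeriod_next_pos x), ?_⟩
    rwa [Function.iterate_mod_minimalPeriod_eq]

theorem faceOf_next (x : G.Dart × ℤˣ) : E.faceOf (E.next x) = E.faceOf x :=
  Quotient.sound ⟨⟨E.next, Subgroup.subset_closure (by simp)⟩, rfl⟩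

theorem faceOf_rev (x : G.Dart × ℤˣ) : E.faceOf (E.rev x) = E.faceOf x :=
  Quotient.sound ⟨⟨E.rev, Subgroup.subset_closure (by simp)⟩, rfl⟩

theorem label_eq_of_faceOf_eq {X : Type*} (L : G.Dart × ℤˣ → X)
    (hn : ∀ x, L (E.next x) = L x) (hr : ∀ x, L (E.rev x) = L x) {x y : G.Dart × ℤˣ}
    (h : E.faceOf x = E.faceOf y) : L x = L y := by
  obtain ⟨⟨g, hg⟩, rfl⟩ := Quotient.exact h
  change L (g y) = L y
  induction hg using Subgroup.closure_induction generalizing y with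
  | mem g hg =>
    rcases hg with rfl | rfl
    · exact hn y
    · exact hr y
  | one => rfl
  | mul g k _ _ ihg ihk =>
    rw [Equiv.Perm.mul_apply, ihg (Quotient.sound ⟨⟨g, by assumption⟩, rfl⟩),
      ihk (Quotient.sound ⟨⟨k, by assumption⟩, rfl⟩)]
  | inv g _ ih =>
    have := ih (y := g⁻¹ y) (Quotient.sound ⟨⟨g, by assumption⟩, rfl⟩)
    rw [← this]
    simp

/-- A complete invariant of states under face traversal and reversal identifies the faces. -/
noncomputable def faceEquiv {X : Type*} (L : G.Dart × ℤˣ → X)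
    (hn : ∀ x, L (E.next x) = L x) (hr : ∀ x, L (E.rev x) = L x)
    (hs : Function.Surjective L) (hc : ∀ x y, L x = L y → E.faceOf x = E.faceOf y) :
    E.Face ≃ X :=
  Equiv.ofBijective
    (Quotient.lift L fun x y h =>
      E.label_eq_of_faceOf_eq L hn hr (x := x) (y := y) (Quotient.sound h))
    ⟨by
      rintro ⟨x⟩ ⟨y⟩ h
      exact hc x y h, fun a => by
      obtain ⟨x, rfl⟩ := hs a
      exact ⟨E.faceOf x, rfl⟩⟩

end CellularEmbedding
end StrongEmb

/-! ### Oriented triangulations and their dual graphs. -/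

namespace StrongEmb

open SimpleGraph

/-- An oriented triangulation with underlying graph `T`: for every dart `(u, v)` the vertex
`third u v` completes it to the oriented triangle on its left. The two triangles at an edge have
different third vertices, and the triangles at a vertex form a single cycle. -/
structure Triangulation {V : Type*} (T : SimpleGraph V) where
  /-- the third vertex of the triangle to the left of a dart -/
  third : V → V → V
  adj_third : ∀ {u v}, T.Adj u v → T.Adj v (third u v)
  third_third : ∀ {u v}, T.Adj u v → third v (third u v) = u
  third_ne : ∀ {u v}, T.Adj u v → third u v ≠ third v u
  reach : ∀ u, ∃ b, T.Adj u b ∧ ∀ w, T.Adj u w → ∃ k, (third u)^[k] b = w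

namespace Triangulation

variable {V : Type*} {T : SimpleGraph V} (M : Triangulation T)

/-- The next dart of the triangle to the left. -/
def turn : Equiv.Perm T.Dart where
  toFun d := ⟨(d.snd, M.third d.fst d.snd), M.adj_third d.adj⟩
  invFun d := ⟨(M.third d.fst d.snd, d.fst), by
    have := M.adj_third (M.adj_third d.adj)
    rwa [M.third_third d.adj] at this⟩
  left_inv d := by
    ext
    · exact M.third_third d.adj
    · rfl
  right_inv d := by
    ext
    · rfl
    · have := M.third_third (M.adj_third d.adj)
      rwa [M.third_third d.adj] at this

theorem turn_turn (d : T.Dart) : M.turn (M.turn d) = M.turn.symm d := by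
  ext
  · rfl
  · exact M.third_third d.adj

theorem turn_turn_turn (d : T.Dart) : M.turn (M.turn (M.turn d)) = d := by
  rw [M.turn_turn d, Equiv.apply_symm_apply]

theorem turn_ne (d : T.Dart) : M.turn d ≠ d := fun h =>
  d.snd_ne_fst (congrArg (fun e : T.Dart => e.fst) h)

theorem third_ne_left {u v : V} (h : T.Adj u v) : M.third u v ≠ u := by
  have := M.adj_third (M.adj_third h)
  rw [M.third_third h] at this
  exact this.ne

theorem third_ne_right {u v : V} (h : T.Adj u v) : M.third u v ≠ v := (M.adj_third h).ne'

/-- The rotation around the first vertex of a dart. -/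
def rot : Equiv.Perm T.Dart := (Function.Involutive.toPerm _ Dart.symm_involutive).trans M.turn

theorem rot_apply (d : T.Dart) : M.rot d = M.turn d.symm := rfl

theorem rot_symm_apply (d : T.Dart) : M.rot.symm d = (M.turn.symm d).symm := rfl

theorem rot_fst (d : T.Dart) : (M.rot d).fst = d.fst := rfl

theorem rot_ne (d : T.Dart) : M.rot d ≠ d := by
  intro h
  have : M.third d.snd d.fst = d.snd := congrArg (fun e : T.Dart => e.snd) h
  exact M.third_ne_left d.adj.symm this

theorem rot_sameCycle (d e : T.Dart) (h : d.fst = e.fst) : M.rot.SameCycle d e := by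
  obtain ⟨b, hb, hr⟩ := M.reach d.fst
  -- Iterating `third u` runs through the neighbours of `u` in the sense of the inverse rotation,
  -- hence `rot⁻¹`.
  have key : ∀ (f : T.Dart), f.fst = d.fst → ∀ k, (M.third d.fst)^[k] b = f.snd →
      M.rot⁻¹.SameCycle ⟨(d.fst, b), hb⟩ f := by
    have h0 : ∀ k, ∃ f : T.Dart, f.fst = d.fst ∧ f.snd = (M.third d.fst)^[k] b ∧
        M.rot⁻¹.SameCycle ⟨(d.fst, b), hb⟩ f := by
      intro k
      induction k with
      | zero => exact ⟨⟨(d.fst, b), hb⟩, rfl, rfl, .refl _ _⟩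
      | succ k ih =>
        obtain ⟨f, h1, h2, h3⟩ := ih
        refine ⟨M.rot⁻¹ f, h1, ?_, h3.apply_right⟩
        rw [Function.iterate_succ_apply', ← h2, ← h1]
        rfl
    intro f hf k hk
    obtain ⟨f', h1, h2, h3⟩ := h0 k
    rwa [show f' = f from Dart.ext _ _ (Prod.ext (h1.trans hf.symm) (h2.trans hk))] at h3
  obtain ⟨k, hk⟩ := hr d.snd d.adj
  obtain ⟨l, hl⟩ := hr e.snd (h ▸ e.adj)
  have := (key d rfl k hk).symm.trans (key e h.symm l hl)
  rwa [Equiv.Perm.sameCycle_inv] at this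

/-! ### Triangles -/

/-- The triangles. -/
def Tri : Type _ := Quotient (Equiv.Perm.SameCycle.setoid M.turn)

/-- The triangle to the left of a dart. -/
def tri (d : T.Dart) : M.Tri := Quotient.mk _ d

theorem tri_surjective : Function.Surjective M.tri := Quotient.mk_surjective

theorem tri_eq_iff {d e : T.Dart} :
    M.tri d = M.tri e ↔ e = d ∨ e = M.turn d ∨ e = M.turn (M.turn d) := by
  have h0 : M.tri d = M.tri e ↔ M.turn.SameCycle d e := Quotient.eq
  rw [h0]
  constructor
  · rintro ⟨k, rfl⟩
    have h3 : M.turn ^ 3 = 1 := Equiv.ext fun d => M.turn_turn_turn d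
    have : M.turn ^ k = M.turn ^ (k % 3).toNat := by
      rw [← zpow_natCast, Int.toNat_of_nonneg (Int.emod_nonneg _ (by norm_num))]
      conv_lhs => rw [← Int.mul_ediv_add_emod k 3, zpow_add, zpow_mul]
      rw [show M.turn ^ (3 : ℤ) = 1 by exact_mod_cast h3]
      simp
    rw [this]
    have hk : (k % 3).toNat < 3 := by omega
    generalize (k % 3).toNat = j at hk
    interval_cases j
    · exact Or.inl rfl
    · exact Or.inr (Or.inl rfl)
    · exact Or.inr (Or.inr rfl)
  · rintro (rfl | rfl | rfl)
    · exact .refl _ _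
    · exact (Equiv.Perm.SameCycle.refl _ _).apply_right
    · exact (Equiv.Perm.SameCycle.refl _ _).apply_right.apply_right

theorem tri_turn (d : T.Dart) : M.tri (M.turn d) = M.tri d :=
  (M.tri_eq_iff.2 (Or.inr (Or.inl rfl))).symm

theorem tri_turn_symm (d : T.Dart) : M.tri (M.turn.symm d) = M.tri d := by
  rw [← M.turn_turn, tri_turn, tri_turn]

theorem tri_symm_ne (d : T.Dart) : M.tri d.symm ≠ M.tri d := by
  intro h
  rcases M.tri_eq_iff.1 h with h | h | h
  · exact d.symm_ne h.symm
  · exact M.third_ne_left d.adj.symm (congrArg (fun e : T.Dart => e.snd) h).symm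
  · rw [turn_turn] at h
    exact M.third_ne_right d.adj.symm (congrArg (fun e : T.Dart => e.fst) h).symm

/-- If two triangles shared two edges they would have the same three vertices, which `third_ne`
excludes. This makes the dual simple: its darts are exactly the darts of `T`. -/
theorem eq_of_tri_eq {d e : T.Dart} (h : M.tri d = M.tri e) (h' : M.tri d.symm = M.tri e.symm) :
    d = e := by
  have key : ∀ d : T.Dart, M.tri d.symm ≠ M.tri (M.turn d).symm := by
    intro d h
    rcases M.tri_eq_iff.1 h with h | h | h
    · have := congrArg (fun e : T.Dart => e.fst) h
      exact M.third_ne_right d.adj this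
    · have := congrArg (fun e : T.Dart => e.fst) h
      exact M.third_ne_left d.adj this
    · rw [turn_turn] at h
      have := congrArg (fun e : T.Dart => e.fst) h
      exact M.third_ne d.adj this
  rcases M.tri_eq_iff.1 h with rfl | rfl | rfl
  · rfl
  · exact absurd h' (key d)
  · have := key (M.turn (M.turn d))
    rw [turn_turn_turn] at this
    exact absurd h'.symm this

/-! ### The dual graph -/

/-- The dual graph: triangles are adjacent when they share an edge. -/
def dual : SimpleGraph M.Tri where
  Adj t t' := ∃ d : T.Dart, M.tri d = t ∧ M.tri d.symm = t'
  symm := ⟨by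
    rintro _ _ ⟨d, rfl, rfl⟩
    exact ⟨d.symm, rfl, by rw [Dart.symm_symm]⟩⟩
  loopless := ⟨by
    rintro _ ⟨d, rfl, h⟩
    exact M.tri_symm_ne d h⟩

theorem dual_adj_tri (d : T.Dart) : M.dual.Adj (M.tri d) (M.tri d.symm) := ⟨d, rfl, rfl⟩

/-- The darts of the dual graph correspond to those of `T`. -/
noncomputable def dualDart : T.Dart ≃ M.dual.Dart :=
  Equiv.ofBijective (fun d => ⟨(M.tri d, M.tri d.symm), M.dual_adj_tri d⟩)
    ⟨fun d e h => M.eq_of_tri_eq (congrArg (fun f : M.dual.Dart => f.fst) h)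
      (congrArg (fun f : M.dual.Dart => f.snd) h), by
      rintro ⟨⟨t, t'⟩, h⟩
      obtain ⟨d, h1, h2⟩ := h
      exact ⟨d, Dart.ext _ _ (Prod.ext h1 h2)⟩⟩

theorem dualDart_fst (d : T.Dart) : (M.dualDart d).fst = M.tri d := rfl

theorem dualDart_symm (d : T.Dart) : (M.dualDart d).symm = M.dualDart d.symm := by
  ext
  · rfl
  · change M.tri d = M.tri d.symm.symm
    rw [Dart.symm_symm]

theorem dual_adj_iff {d : T.Dart} {t : M.Tri} : M.dual.Adj (M.tri d) t ↔
    t = M.tri d.symm ∨ t = M.tri (M.turn d).symm ∨ t = M.tri (M.turn.symm d).symm := by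
  constructor
  · rintro ⟨e, h, rfl⟩
    rcases M.tri_eq_iff.1 h.symm with rfl | rfl | rfl
    · exact Or.inl rfl
    · exact Or.inr (Or.inl rfl)
    · rw [turn_turn]
      exact Or.inr (Or.inr rfl)
  · rintro (rfl | rfl | rfl)
    · exact M.dual_adj_tri d
    · rw [← M.tri_turn d]
      exact M.dual_adj_tri _
    · rw [← M.tri_turn_symm d]
      exact M.dual_adj_tri _

theorem dual_isCubic : IsCubic M.dual := by
  intro t
  obtain ⟨d, rfl⟩ := M.tri_surjective t
  have h : M.dual.neighborSet (M.tri d) =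
      {M.tri d.symm, M.tri (M.turn d).symm, M.tri (M.turn.symm d).symm} := by
    ext t
    simp [dual_adj_iff]
  have h1 : M.turn d ≠ d := M.turn_ne d
  have h2 : M.turn.symm d ≠ d := fun h => M.turn_ne d (by conv_lhs => rw [← h]; simp)
  have h3 : M.turn.symm d ≠ M.turn d := by
    rw [← turn_turn]
    exact M.turn_ne _
  rw [h, Set.ncard_eq_three]
  refine ⟨_, _, _, ?_, ?_, ?_, rfl⟩
  · intro h
    exact h1 (M.eq_of_tri_eq (M.tri_turn d) h.symm)
  · intro h
    exact h2 (M.eq_of_tri_eq (M.tri_turn_symm d) h.symm)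
  · intro h
    exact h3 (M.eq_of_tri_eq (by rw [tri_turn, tri_turn_symm]) h.symm)

theorem dualDart_edge_eq_iff {d e : T.Dart} :
    (M.dualDart d).edge = (M.dualDart e).edge ↔ d.edge = e.edge := by
  rw [dart_edge_eq_iff, dart_edge_eq_iff, dualDart_symm, M.dualDart.injective.eq_iff,
    M.dualDart.injective.eq_iff]

theorem _root_.SimpleGraph.exists_dart_edge_eq {V : Type*} {G : SimpleGraph V} (e : G.edgeSet) :
    ∃ d : G.Dart, d.edge = e := by
  obtain ⟨e, he⟩ := e
  induction e using Sym2.ind with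
  | _ u v => exact ⟨⟨(u, v), he⟩, rfl⟩

/-- The edge of `T` crossed by an edge of the dual graph. -/
noncomputable def dualEdge : M.dual.edgeSet ≃ T.edgeSet :=
  Equiv.symm <| Equiv.ofBijective
    (fun e => ⟨(M.dualDart (exists_dart_edge_eq e).choose).edge, Dart.edge_mem _⟩)
    ⟨fun e e' h => by
      have := M.dualDart_edge_eq_iff.1 (congrArg Subtype.val h)
      rw [(exists_dart_edge_eq e).choose_spec, (exists_dart_edge_eq e').choose_spec] at this
      exact Subtype.ext this, fun e => by
      obtain ⟨d, hd⟩ := exists_dart_edge_eq e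
      obtain ⟨d, rfl⟩ := M.dualDart.surjective d
      refine ⟨⟨d.edge, d.edge_mem⟩, Subtype.ext ?_⟩
      rw [← hd]
      exact M.dualDart_edge_eq_iff.2 (exists_dart_edge_eq ⟨d.edge, d.edge_mem⟩).choose_spec⟩

theorem dualEdge_edge (d : T.Dart) :
    M.dualEdge ⟨(M.dualDart d).edge, (M.dualDart d).edge_mem⟩ = ⟨d.edge, d.edge_mem⟩ := by
  rw [dualEdge, Equiv.symm_apply_eq]
  refine Subtype.ext ?_
  exact (M.dualDart_edge_eq_iff.2 (exists_dart_edge_eq ⟨d.edge, d.edge_mem⟩).choose_spec).symm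

theorem finite_dart [Finite V] : Finite T.Dart := Finite.of_injective _ Dart.toProd_injective

instance [Finite V] : Finite M.Tri := by
  have := finite_dart (T := T)
  exact Finite.of_surjective _ M.tri_surjective

/-- The handshake lemma for the cubic dual graph. -/
theorem three_mul_card_tri [Finite V] : 3 * Nat.card M.Tri = 2 * Nat.card T.edgeSet := by
  classical
  rw [← Nat.card_congr M.dualEdge]
  have := Fintype.ofFinite M.Tri
  have h := M.dual.sum_degrees_eq_twice_card_edges
  have hd : ∀ t, M.dual.degree t = 3 := by
    intro t
    rw [← M.dual_isCubic t, ← card_neighborSet_eq_degree, ← Nat.card_coe_set_eq,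
      Nat.card_eq_fintype_card]
  simp only [hd, Finset.sum_const, Finset.card_univ, smul_eq_mul] at h
  rw [Nat.card_eq_fintype_card, Nat.card_eq_fintype_card, mul_comm, h, edgeFinset_card]

/-! ### The embedding of `T` on the sphere -/

/-- The embedding of `T` all of whose faces are the triangles. -/
def embedding : CellularEmbedding T where
  rot := M.rot
  rot_fst := M.rot_fst
  rot_cyclic := M.rot_sameCycle
  sign _ := 1

theorem embedding_dartSign (d : T.Dart) : M.embedding.dartSign d = 1 := rfl

theorem embedding_next_one (d : T.Dart) : M.embedding.next (d, 1) = (M.turn d, 1) := by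
  rw [CellularEmbedding.next_apply, embedding_dartSign]
  simp [embedding, rot_apply]

theorem embedding_next_neg_one (d : T.Dart) :
    M.embedding.next (d, -1) = ((M.turn.symm d.symm).symm, -1) := by
  rw [CellularEmbedding.next_apply, embedding_dartSign]
  refine Prod.ext ?_ rfl
  simp [embedding, ← M.rot_symm_apply, Equiv.Perm.inv_def]

theorem embedding_rev (d : T.Dart) (s : ℤˣ) : M.embedding.rev (d, s) = (d.symm, -s) := by
  rw [CellularEmbedding.rev_apply, embedding_dartSign, mul_one]

/-- The triangle traced out from a state of the embedding of `T`. -/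
def sideTri (x : T.Dart × ℤˣ) : M.Tri := if x.2 = 1 then M.tri x.1 else M.tri x.1.symm

theorem sideTri_one (d : T.Dart) : M.sideTri (d, 1) = M.tri d := if_pos rfl

theorem sideTri_neg_one (d : T.Dart) : M.sideTri (d, -1) = M.tri d.symm :=
  if_neg (show (-1 : ℤˣ) ≠ 1 by decide)

theorem sideTri_next (x : T.Dart × ℤˣ) : M.sideTri (M.embedding.next x) = M.sideTri x := by
  obtain ⟨d, s⟩ := x
  rcases Int.units_eq_one_or s with rfl | rfl
  · rw [embedding_next_one, sideTri_one, sideTri_one, tri_turn]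
  · rw [embedding_next_neg_one, sideTri_neg_one, sideTri_neg_one, Dart.symm_symm, tri_turn_symm]

theorem sideTri_rev (x : T.Dart × ℤˣ) : M.sideTri (M.embedding.rev x) = M.sideTri x := by
  obtain ⟨d, s⟩ := x
  rw [embedding_rev]
  rcases Int.units_eq_one_or s with rfl | rfl
  · rw [sideTri_one, sideTri_neg_one, Dart.symm_symm]
  · rw [neg_neg, sideTri_one, sideTri_neg_one]

/-- The faces of the embedding of `T` are the triangles. -/
noncomputable def faceEquivTri : M.embedding.Face ≃ M.Tri :=
  M.embedding.faceEquiv M.sideTri M.sideTri_next M.sideTri_rev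
    (fun t => by
      obtain ⟨d, rfl⟩ := M.tri_surjective t
      exact ⟨(d, 1), M.sideTri_one d⟩)
    (by
      have key : ∀ x, ∃ d, M.sideTri x = M.tri d ∧
          M.embedding.faceOf x = M.embedding.faceOf (d, 1) := by
        rintro ⟨d, s⟩
        rcases Int.units_eq_one_or s with rfl | rfl
        · exact ⟨d, M.sideTri_one d, rfl⟩
        · refine ⟨d.symm, M.sideTri_neg_one d, ?_⟩
          rw [← M.embedding.faceOf_rev, embedding_rev, neg_neg]
      have hturn : ∀ d, M.embedding.faceOf (M.turn d, 1) = M.embedding.faceOf (d, 1) := by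
        intro d
        rw [← embedding_next_one, CellularEmbedding.faceOf_next]
      intro x y h
      obtain ⟨d, hd, hx⟩ := key x
      obtain ⟨e, he, hy⟩ := key y
      rw [hx, hy]
      rw [hd, he] at h
      rcases M.tri_eq_iff.1 h with rfl | rfl | rfl
      · rfl
      · rw [hturn]
      · rw [hturn, hturn])

theorem faceEquivTri_faceOf (x : T.Dart × ℤˣ) :
    M.faceEquivTri (M.embedding.faceOf x) = M.sideTri x := rfl

theorem embedding_isOrientable : M.embedding.IsOrientable :=
  ⟨fun _ => 1, fun d => by rw [embedding_dartSign, one_mul]⟩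

theorem embedding_onSphere [Finite V]
    (h : (Nat.card V : ℤ) - Nat.card T.edgeSet + Nat.card M.Tri = 2) : M.embedding.OnSphere := by
  refine ⟨M.embedding_isOrientable, ?_⟩
  rw [CellularEmbedding.eulerChar, Nat.card_congr M.faceEquivTri, h]

theorem embedding_next_next_next (x : T.Dart × ℤˣ) :
    M.embedding.next (M.embedding.next (M.embedding.next x)) = x := by
  obtain ⟨d, s⟩ := x
  rcases Int.units_eq_one_or s with rfl | rfl
  · simp only [embedding_next_one, turn_turn_turn]
  · simp only [embedding_next_neg_one, Dart.symm_symm]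
    refine Prod.ext ?_ rfl
    have : ∀ d, M.turn.symm (M.turn.symm (M.turn.symm d)) = d := by
      intro d
      rw [Equiv.symm_apply_eq, Equiv.symm_apply_eq, Equiv.symm_apply_eq, turn_turn_turn]
    simp only [this, Dart.symm_symm]

theorem embedding_facialWalk [Finite V] (v : V) (w : T.Walk v v)
    (hw : M.embedding.IsFacialWalk w) : w.IsCycle ∧ w.length = 3 := by
  have hp : ∀ x, Function.minimalPeriod M.embedding.next x = 3 := by
    intro x
    -- The period is at most three because `turn` has order three, and no facial walk is shorter.
    have h1 := M.embedding.two_lt_minimalPeriod_next M.rot_ne x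
    have h2 : Function.IsPeriodicPt M.embedding.next 3 x := M.embedding_next_next_next x
    have := h2.minimalPeriod_le (by norm_num)
    omega
  refine ⟨M.embedding.isStrong_of_injective M.rot_ne ?_ v w hw, ?_⟩
  · intro x k h
    rw [← Function.iterate_mod_minimalPeriod_eq, hp] at h ⊢
    have hk : k % 3 < 3 := Nat.mod_lt _ (by norm_num)
    generalize k % 3 = j at hk h ⊢
    interval_cases j
    · rfl
    · exact absurd h (by
        rw [Function.iterate_one, CellularEmbedding.next_fst]
        exact x.1.snd_ne_fst)
    · exfalso
      have h3 := M.embedding.next_fst (M.embedding.next^[2] x)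
      change (M.embedding.next (M.embedding.next (M.embedding.next x))).1.fst = _ at h3
      rw [embedding_next_next_next] at h3
      exact Dart.fst_ne_snd _ (h.trans h3)
  · obtain ⟨x, hx⟩ := hw
    rw [← Walk.length_darts, hx, List.length_map, List.length_range, hp]

theorem isPlanarTriangulation [Finite V] (hT : T.Connected)
    (h : (Nat.card V : ℤ) - Nat.card T.edgeSet + Nat.card M.Tri = 2) :
    IsPlanarTriangulation T :=
  ⟨hT, M.embedding, M.embedding_onSphere h, M.embedding_facialWalk⟩

theorem dual_isDualOf [Finite V] (hT : T.Connected)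
    (h : (Nat.card V : ℤ) - Nat.card T.edgeSet + Nat.card M.Tri = 2) :
    IsDualOf M.dual T := by
  refine ⟨hT, M.embedding, M.embedding_onSphere h, M.faceEquivTri.symm, M.dualEdge, ?_⟩
  intro t e
  obtain ⟨D, hD⟩ := exists_dart_edge_eq e
  obtain ⟨d, rfl⟩ := M.dualDart.surjective D
  obtain rfl : (⟨_, (M.dualDart d).edge_mem⟩ : M.dual.edgeSet) = e := Subtype.ext hD
  rw [dualEdge_edge]
  have h1 : t ∈ (M.dualDart d).edge ↔ t = M.tri d ∨ t = M.tri d.symm := Sym2.mem_iff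
  have h2 : d.edge ∈ M.embedding.faceEdges (M.faceEquivTri.symm t) ↔
      ∃ x, M.sideTri x = t ∧ x.1.edge = d.edge := by
    simp only [CellularEmbedding.faceEdges, Set.mem_ofPred_eq, Equiv.eq_symm_apply,
      faceEquivTri_faceOf]
  rw [h1, h2]
  constructor
  · rintro (rfl | rfl)
    · exact ⟨(d, 1), M.sideTri_one d, rfl⟩
    · exact ⟨(d, -1), M.sideTri_neg_one d, rfl⟩
  · rintro ⟨⟨e, s⟩, rfl, he⟩
    rcases Int.units_eq_one_or s with rfl | rfl <;>
      rcases (dart_edge_eq_iff _ _).1 he with h | h <;> simp only at h <;> subst h <;>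
      simp [sideTri_one, sideTri_neg_one]

end Triangulation
end StrongEmb

namespace StrongEmb

open SimpleGraph

namespace Triangulation

variable {V : Type*} {T : SimpleGraph V} (M : Triangulation T)

/-! ### Embeddings of the dual graph -/

open Classical in
/-- The sign of a dart when the edges in `H` are twisted. -/
noncomputable def twistSign (H : Set (Sym2 V)) (d : T.Dart) : ℤˣ := if d.edge ∈ H then -1 else 1

theorem twistSign_of_mem {H : Set (Sym2 V)} {d : T.Dart} (h : d.edge ∈ H) :
    twistSign H d = -1 := if_pos h

theorem twistSign_of_notMem {H : Set (Sym2 V)} {d : T.Dart} (h : d.edge ∉ H) :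
    twistSign H d = 1 := if_neg h

open Classical in
/-- The embedding of the dual graph obtained from the spherical one by twisting the edges that
cross the edges in `H`. -/
noncomputable def twist (H : Set (Sym2 V)) : CellularEmbedding M.dual where
  rot := (M.dualDart.symm.trans M.turn).trans M.dualDart
  rot_fst D := by
    obtain ⟨d, rfl⟩ := M.dualDart.surjective D
    simp only [Equiv.trans_apply, Equiv.symm_apply_apply, dualDart_fst, tri_turn]
  rot_cyclic D D' h := by
    obtain ⟨d, rfl⟩ := M.dualDart.surjective D
    obtain ⟨e, rfl⟩ := M.dualDart.surjective D'
    rw [dualDart_fst, dualDart_fst] at h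
    rcases M.tri_eq_iff.1 h with rfl | rfl | rfl
    · exact .refl _ _
    · exact ⟨1, by simp⟩
    · exact ⟨1 + 1, by rw [zpow_add, zpow_one]; simp⟩
  sign e := if (M.dualEdge e : Sym2 V) ∈ H then -1 else 1

variable (H : Set (Sym2 V))

theorem twist_rot (d : T.Dart) : (M.twist H).rot (M.dualDart d) = M.dualDart (M.turn d) := by
  simp [twist]

theorem twist_rot_symm (d : T.Dart) :
    (M.twist H).rot.symm (M.dualDart d) = M.dualDart (M.turn.symm d) := by
  rw [Equiv.symm_apply_eq, twist_rot, Equiv.apply_symm_apply]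

theorem twist_rot_ne (D : M.dual.Dart) : (M.twist H).rot D ≠ D := by
  obtain ⟨d, rfl⟩ := M.dualDart.surjective D
  rw [twist_rot]
  exact fun h => M.turn_ne d (M.dualDart.injective h)

theorem twist_dartSign (d : T.Dart) :
    (M.twist H).dartSign (M.dualDart d) = twistSign H d := by
  rw [CellularEmbedding.dartSign, twistSign]
  simp only [twist]
  rw [dualEdge_edge]

theorem twist_rev (d : T.Dart) (s : ℤˣ) :
    (M.twist H).rev (M.dualDart d, s) = (M.dualDart d.symm, -(s * twistSign H d)) := by
  rw [CellularEmbedding.rev_apply, twist_dartSign, dualDart_symm]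

theorem twist_next_rev_one (d : T.Dart) :
    (M.twist H).next ((M.twist H).rev (M.dualDart d, 1)) = (M.dualDart (M.turn.symm d), -1) := by
  rw [CellularEmbedding.next_rev, ← twist_rot_symm M H]
  simp [Equiv.Perm.inv_def]

theorem twist_next_rev_neg_one (d : T.Dart) :
    (M.twist H).next ((M.twist H).rev (M.dualDart d, -1)) = (M.dualDart (M.turn d), 1) := by
  rw [CellularEmbedding.next_rev, ← twist_rot M H]
  simp

theorem twist_next_of_eq_one {d : T.Dart} {s : ℤˣ} (h : s * twistSign H d = 1) :
    (M.twist H).next (M.dualDart d, s) = (M.dualDart (M.turn d.symm), 1) := by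
  rw [CellularEmbedding.next_apply, twist_dartSign, h, dualDart_symm, ← twist_rot M H]
  simp

theorem twist_next_of_eq_neg_one {d : T.Dart} {s : ℤˣ} (h : s * twistSign H d = -1) :
    (M.twist H).next (M.dualDart d, s) = (M.dualDart (M.turn.symm d.symm), -1) := by
  rw [CellularEmbedding.next_apply, twist_dartSign, h, dualDart_symm, ← twist_rot_symm M H]
  simp [Equiv.Perm.inv_def]

/-- The corner of a triangle run through just before a state; a dart stands for the corner at
its first vertex. -/
def corner (x : T.Dart × ℤˣ) : T.Dart := if x.2 = 1 then x.1 else M.turn x.1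

theorem corner_one (d : T.Dart) : M.corner (d, 1) = d := if_pos rfl

theorem corner_neg_one (d : T.Dart) : M.corner (d, -1) = M.turn d :=
  if_neg (show (-1 : ℤˣ) ≠ 1 by decide)

/-- The face of a twisted embedding that contains a corner. -/
noncomputable def cornerFace (d : T.Dart) : (M.twist H).Face := (M.twist H).faceOf (M.dualDart d, 1)

theorem faceOf_eq_cornerFace (d : T.Dart) (s : ℤˣ) :
    (M.twist H).faceOf (M.dualDart d, s) = M.cornerFace H (M.corner (d, s)) := by
  rcases Int.units_eq_one_or s with rfl | rfl
  · rw [corner_one, cornerFace]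
  · rw [corner_neg_one, cornerFace, ← twist_next_rev_neg_one, CellularEmbedding.faceOf_next,
      CellularEmbedding.faceOf_rev]

variable {H}

/-- Crossing an untwisted edge, a face stays at the same end of `d`. Across a twisted edge it
changes ends, so that corners are identified diagonally; the two diagonals are `cornerFace_symm` and
`cornerFace_turn_symm`. -/
theorem cornerFace_rot {d : T.Dart} (h : d.edge ∉ H) :
    M.cornerFace H (M.rot d) = M.cornerFace H d := by
  rw [rot_apply, ← corner_neg_one, ← faceOf_eq_cornerFace, cornerFace,
    ← (M.twist H).faceOf_rev (M.dualDart d, 1), twist_rev, twistSign_of_notMem h, mul_one]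

theorem cornerFace_symm {d : T.Dart} (h : d.edge ∈ H) :
    M.cornerFace H d.symm = M.cornerFace H d := by
  rw [cornerFace, cornerFace, ← (M.twist H).faceOf_rev (M.dualDart d, 1), twist_rev,
    twistSign_of_mem h, one_mul, neg_neg]

theorem cornerFace_turn_symm {d : T.Dart} (h : d.edge ∈ H) :
    M.cornerFace H (M.turn d.symm) = M.cornerFace H (M.turn d) := by
  rw [← corner_neg_one, ← corner_neg_one, ← faceOf_eq_cornerFace, ← faceOf_eq_cornerFace,
    ← (M.twist H).faceOf_rev (M.dualDart d, -1), twist_rev, twistSign_of_mem h]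
  simp

variable (H)

/-- A labelling of corners by the faces of the embedding twisted along `H`. -/
structure CornerLabel {X : Type*} (l : T.Dart → X) : Prop where
  rot : ∀ d : T.Dart, d.edge ∉ H → l (M.rot d) = l d
  symm : ∀ d : T.Dart, d.edge ∈ H → l d.symm = l d
  turn_symm : ∀ d : T.Dart, d.edge ∈ H → l (M.turn d.symm) = l (M.turn d)

variable {H} {X : Type*} {l : T.Dart → X}

/-- The label of the corner run through just before a state. -/
noncomputable def stateLabel (l : T.Dart → X) (x : M.dual.Dart × ℤˣ) : X :=
  l (M.corner (M.dualDart.symm x.1, x.2))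

theorem stateLabel_one (d : T.Dart) : M.stateLabel l (M.dualDart d, 1) = l d := by
  rw [stateLabel, Equiv.symm_apply_apply, corner_one]

theorem stateLabel_neg_one (d : T.Dart) : M.stateLabel l (M.dualDart d, -1) = l (M.turn d) := by
  rw [stateLabel, Equiv.symm_apply_apply, corner_neg_one]

variable {M}

theorem CornerLabel.stateLabel_rev (hl : M.CornerLabel H l) (x : M.dual.Dart × ℤˣ) :
    M.stateLabel l ((M.twist H).rev x) = M.stateLabel l x := by
  obtain ⟨D, s⟩ := x
  obtain ⟨d, rfl⟩ := M.dualDart.surjective D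
  rw [twist_rev]
  by_cases h : d.edge ∈ H
  · rw [twistSign_of_mem h]
    rcases Int.units_eq_one_or s with rfl | rfl
    · rw [one_mul, neg_neg, stateLabel_one, stateLabel_one, hl.symm d h]
    · rw [← neg_mul, neg_neg, one_mul, stateLabel_neg_one, stateLabel_neg_one, hl.turn_symm d h]
  · rw [twistSign_of_notMem h, mul_one]
    rcases Int.units_eq_one_or s with rfl | rfl
    · rw [stateLabel_neg_one, stateLabel_one, ← rot_apply, hl.rot d h]
    · rw [neg_neg, stateLabel_neg_one, stateLabel_one]
      have := hl.rot d.symm (by rwa [Dart.edge_symm])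
      rw [rot_apply, Dart.symm_symm] at this
      exact this.symm

/-- A step is `rev` followed by the reversal of a corner. The latter keeps the corner, so invariance
under `rev` suffices. -/
theorem CornerLabel.stateLabel_next (hl : M.CornerLabel H l) (x : M.dual.Dart × ℤˣ) :
    M.stateLabel l ((M.twist H).next x) = M.stateLabel l x := by
  obtain ⟨x, rfl⟩ := (M.twist H).rev.surjective x
  rw [hl.stateLabel_rev]
  obtain ⟨D, s⟩ := x
  obtain ⟨d, rfl⟩ := M.dualDart.surjective D
  rcases Int.units_eq_one_or s with rfl | rfl
  · rw [twist_next_rev_one, stateLabel_neg_one, stateLabel_one, Equiv.apply_symm_apply]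
  · rw [twist_next_rev_neg_one, stateLabel_neg_one, stateLabel_one]

theorem CornerLabel.stateLabel_iterate (hl : M.CornerLabel H l) (x : M.dual.Dart × ℤˣ) (k : ℕ) :
    M.stateLabel l ((M.twist H).next^[k] x) = M.stateLabel l x := by
  induction k with
  | zero => rfl
  | succ k ih => rw [Function.iterate_succ_apply', hl.stateLabel_next, ih]

/-- Corners with a complete set of labels describe the faces. -/
noncomputable def CornerLabel.faceEquiv (hl : M.CornerLabel H l) (hs : Function.Surjective l)
    (hc : ∀ d e, l d = l e → M.cornerFace H d = M.cornerFace H e) : (M.twist H).Face ≃ X :=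
  (M.twist H).faceEquiv (M.stateLabel l) hl.stateLabel_next hl.stateLabel_rev
    (fun a => by
      obtain ⟨d, rfl⟩ := hs a
      exact ⟨_, M.stateLabel_one d⟩)
    (by
      rintro ⟨D, s⟩ ⟨D', s'⟩ h
      obtain ⟨d, rfl⟩ := M.dualDart.surjective D
      obtain ⟨d', rfl⟩ := M.dualDart.surjective D'
      rw [faceOf_eq_cornerFace, faceOf_eq_cornerFace]
      simp only [stateLabel, Equiv.symm_apply_apply] at h
      exact hc _ _ h)

/-- When the three corners of a triangle have different labels, a traversal returning to that
triangle passes the same corner again. By `next_iterate_ne_next_rev` it does so in the same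
direction, hence in the same state. -/
theorem CornerLabel.isStrong [Finite V] (hl : M.CornerLabel H l)
    (hne : ∀ d, l (M.turn d) ≠ l d) : (M.twist H).IsStrong := by
  have hinj : ∀ d e, M.tri d = M.tri e → l d = l e → e = d := by
    intro d e h h'
    rcases M.tri_eq_iff.1 h with rfl | rfl | rfl
    · rfl
    · exact absurd h'.symm (hne d)
    · have := hne (M.turn (M.turn d))
      rw [turn_turn_turn] at this
      exact absurd h' this
  refine (M.twist H).isStrong_of_injective (M.twist_rot_ne H) ?_
  intro x k h
  have h1 := hl.stateLabel_iterate x k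
  have h2 := (M.twist H).next_iterate_ne_next_rev k x
  revert h h1 h2
  generalize (M.twist H).next^[k] x = y
  obtain ⟨D, s⟩ := x
  obtain ⟨E, t⟩ := y
  obtain ⟨d, rfl⟩ := M.dualDart.surjective D
  obtain ⟨e, rfl⟩ := M.dualDart.surjective E
  intro h h1 h2
  change M.tri e = M.tri d at h
  rcases Int.units_eq_one_or s with rfl | rfl <;> rcases Int.units_eq_one_or t with rfl | rfl
  · rw [stateLabel_one, stateLabel_one] at h1
    rw [hinj _ _ h h1]
  · rw [stateLabel_neg_one, stateLabel_one] at h1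
    rw [hinj (M.turn e) d (by rw [tri_turn, h]) h1, twist_next_rev_one,
      Equiv.symm_apply_apply] at h2
    exact absurd rfl h2
  · rw [stateLabel_neg_one, stateLabel_one] at h1
    rw [twist_next_rev_neg_one, ← hinj (M.turn d) e (by rw [tri_turn, h]) h1.symm] at h2
    exact absurd rfl h2
  · rw [stateLabel_neg_one, stateLabel_neg_one] at h1
    rw [M.turn.injective (hinj _ _ (by rw [tri_turn, tri_turn, h]) h1)]

theorem CornerLabel.eulerChar (hl : M.CornerLabel H l) (hs : Function.Surjective l)
    (hc : ∀ d e, l d = l e → M.cornerFace H d = M.cornerFace H e) :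
    (M.twist H).eulerChar = Nat.card M.Tri - Nat.card T.edgeSet + Nat.card X := by
  rw [CellularEmbedding.eulerChar, Nat.card_congr (hl.faceEquiv hs hc),
    Nat.card_congr M.dualEdge]

theorem twist_isOrientable_iff : (M.twist H).IsOrientable ↔
    ∃ o : M.Tri → ℤˣ, ∀ d : T.Dart, twistSign H d = o (M.tri d) * o (M.tri d.symm) := by
  refine exists_congr fun o => ⟨fun h d => ?_, fun h D => ?_⟩
  · rw [← twist_dartSign M, h]
    rfl
  · obtain ⟨d, rfl⟩ := M.dualDart.surjective D
    rw [twist_dartSign, h]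
    rfl

theorem exists_dart_fst_eq (M : Triangulation T) (v : V) : ∃ d : T.Dart, d.fst = v := by
  obtain ⟨b, hb, -⟩ := M.reach v
  exact ⟨⟨(v, b), hb⟩, rfl⟩

/-- A vertex of `T` on no twisted edge keeps its face: `cornerFace_rot` applies all the way around
it. -/
theorem cornerFace_eq_of_fst_eq {d e : T.Dart} (h : d.fst = e.fst)
    (hH : ∀ f : T.Dart, f.fst = d.fst → f.edge ∉ H) : M.cornerFace H d = M.cornerFace H e := by
  have h0 : ∀ k : ℕ, ((M.rot ^ k) d).fst = d.fst ∧
      M.cornerFace H ((M.rot ^ k) d) = M.cornerFace H d := by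
    intro k
    induction k with
    | zero => simp
    | succ k ih =>
      rw [pow_succ', Equiv.Perm.mul_apply, rot_fst, cornerFace_rot _ (hH _ ih.1)]
      exact ih
  have hk : ∀ k : ℤ, ((M.rot ^ k) d).fst = d.fst ∧
      M.cornerFace H ((M.rot ^ k) d) = M.cornerFace H d := by
    have hinv : ∀ k : ℕ, ((M.rot⁻¹ ^ k) d).fst = d.fst ∧
        M.cornerFace H ((M.rot⁻¹ ^ k) d) = M.cornerFace H d := by
      intro k
      induction k with
      | zero => simp
      | succ k ih =>
        rw [pow_succ', Equiv.Perm.mul_apply]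
        obtain ⟨f, hf⟩ := M.rot.surjective ((M.rot⁻¹ ^ k) d)
        rw [← hf] at ih ⊢
        rw [rot_fst] at ih
        rw [cornerFace_rot _ (hH _ ih.1)] at ih
        simpa using ih
    intro k
    obtain ⟨k, rfl | rfl⟩ := k.eq_nat_or_neg
    · exact_mod_cast h0 k
    · simpa [← inv_pow] using hinv k
  obtain ⟨k, rfl⟩ := M.rot_sameCycle d e h
  exact (hk k).2.symm

theorem dual_isPlanar [Finite V] (M : Triangulation T) (hG : M.dual.Connected)
    (h : (Nat.card V : ℤ) - Nat.card T.edgeSet + Nat.card M.Tri = 2) : IsPlanar M.dual := by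
  -- Without twists the faces of the dual are the vertices of `T`, so both graphs have the same
  -- Euler characteristic.
  have hl : M.CornerLabel ∅ (fun d : T.Dart => d.fst) :=
    ⟨fun d _ => rfl, fun d h => h.elim, fun d h => h.elim⟩
  refine ⟨hG, M.twist ∅, ?_, ?_⟩
  · rw [twist_isOrientable_iff]
    exact ⟨fun _ => 1, fun d => by rw [twistSign_of_notMem (Set.notMem_empty _), one_mul]⟩
  · rw [hl.eulerChar M.exists_dart_fst_eq
      (fun d e h => cornerFace_eq_of_fst_eq h fun _ _ => Set.notMem_empty _)]
    linarith

/-! ### Connectivity of the dual graph -/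

/-- Some dart of the triangle `t` starts at `v`. -/
def Tri.Mem (t : M.Tri) (v : V) : Prop := ∃ d : T.Dart, M.tri d = t ∧ d.fst = v

theorem mem_tri_iff {d : T.Dart} {v : V} :
    (M.tri d).Mem v ↔ v = d.fst ∨ v = d.snd ∨ v = M.third d.fst d.snd := by
  constructor
  · rintro ⟨e, h, rfl⟩
    rcases M.tri_eq_iff.1 h.symm with rfl | rfl | rfl
    · exact Or.inl rfl
    · exact Or.inr (Or.inl rfl)
    · exact Or.inr (Or.inr rfl)
  · rintro (rfl | rfl | rfl)
    · exact ⟨d, rfl, rfl⟩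
    · exact ⟨M.turn d, M.tri_turn d, rfl⟩
    · exact ⟨M.turn (M.turn d), by rw [tri_turn, tri_turn], rfl⟩

theorem Tri.Mem.exists_dart {t : M.Tri} {u v : V} (hu : t.Mem u) (hv : t.Mem v) (h : u ≠ v) :
    ∃ d : T.Dart, M.tri d = t ∧ (d.fst = u ∧ d.snd = v ∨ d.fst = v ∧ d.snd = u) := by
  obtain ⟨d, rfl, rfl⟩ := hu
  rcases mem_tri_iff.1 hv with rfl | rfl | rfl
  · exact absurd rfl h
  · exact ⟨d, rfl, Or.inl ⟨rfl, rfl⟩⟩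
  · exact ⟨M.turn (M.turn d), by rw [tri_turn, tri_turn], Or.inr ⟨rfl, M.third_third d.adj⟩⟩

theorem Tri.Mem.adj {t : M.Tri} {u v : V} (hu : t.Mem u) (hv : t.Mem v) (h : u ≠ v) :
    T.Adj u v := by
  obtain ⟨d, -, ⟨rfl, rfl⟩ | ⟨rfl, rfl⟩⟩ := hu.exists_dart hv h
  · exact d.adj
  · exact d.adj.symm

/-- A triangle is determined by its vertices. -/
theorem tri_eq_of_mem {t : M.Tri} {d : T.Dart} (h1 : t.Mem d.fst) (h2 : t.Mem d.snd)
    (h3 : t.Mem (M.third d.fst d.snd)) : t = M.tri d := by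
  obtain ⟨e, rfl, he⟩ := h1.exists_dart h2 d.fst_ne_snd
  rcases he with ⟨h, h'⟩ | ⟨h, h'⟩
  · rw [show e = d from Dart.ext _ _ (Prod.ext h h')]
  · exfalso
    rcases mem_tri_iff.1 h3 with h4 | h4 | h4
    · exact M.third_ne_right d.adj (h4.trans h)
    · exact M.third_ne_left d.adj (h4.trans h')
    · rw [h, h'] at h4
      exact M.third_ne d.adj h4

section Deletion

variable (M) (S : Finset M.Tri)

/-- The triangles `t` and `t'` are joined by a walk in the dual graph avoiding `S`. -/
def Linked (t t' : M.Tri) : Prop :=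
  ∃ (h : t ∉ S) (h' : t' ∉ S),
    (M.dual.induce {t | t ∉ S}).Reachable ⟨t, h⟩ ⟨t', h'⟩

variable {M S}

theorem Linked.refl {t : M.Tri} (h : t ∉ S) : M.Linked S t t := ⟨h, h, .refl _⟩

theorem Linked.symm {t t' : M.Tri} (h : M.Linked S t t') : M.Linked S t' t :=
  ⟨h.2.1, h.1, h.2.2.symm⟩

theorem Linked.trans {t t' t'' : M.Tri} (h : M.Linked S t t') (h' : M.Linked S t' t'') :
    M.Linked S t t'' := ⟨h.1, h'.2.1, h.2.2.trans h'.2.2⟩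

theorem Linked.rot {d : T.Dart} (h : M.tri d ∉ S) (h' : M.tri (M.rot d) ∉ S) :
    M.Linked S (M.tri d) (M.tri (M.rot d)) := by
  refine ⟨h, h', Adj.reachable ?_⟩
  change M.dual.Adj (M.tri d) (M.tri (M.turn d.symm))
  rw [tri_turn]
  exact M.dual_adj_tri d

/-- The vertex `v` lies on two triangles of `S`. -/
def Bad (S : Finset M.Tri) (v : V) : Prop :=
  ∃ d e : T.Dart, d.fst = v ∧ e.fst = v ∧ d ≠ e ∧ M.tri d ∈ S ∧ M.tri e ∈ S

/-- The triangles around `v` form a cycle in the dual, and a cycle with at most one vertex deleted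
is still connected. -/
theorem linked_of_not_bad [Finite V] {v : V} (hv : ¬ Bad S v) {d e : T.Dart} (hd : d.fst = v)
    (he : e.fst = v) (hdS : M.tri d ∉ S) (heS : M.tri e ∉ S) :
    M.Linked S (M.tri d) (M.tri e) := by
  have := finite_dart (T := T)
  have hpow : ∀ (f : T.Dart) (k : ℕ), ((M.rot ^ k) f).fst = f.fst := by
    intro f k
    induction k with
    | zero => rfl
    | succ k ih => rw [pow_succ', Equiv.Perm.mul_apply, rot_fst, ih]
  have key : ∀ f : T.Dart, f.fst = v → M.tri f ∉ S → ∀ k : ℕ,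
      (∀ j, j ≤ k → M.tri ((M.rot ^ j) f) ∉ S) →
      M.Linked S (M.tri f) (M.tri ((M.rot ^ k) f)) := by
    intro f hf hfS k
    induction k with
    | zero => exact fun _ => .refl hfS
    | succ k ih =>
      intro h
      refine (ih fun j hj => h j (hj.trans k.le_succ)).trans ?_
      rw [pow_succ', Equiv.Perm.mul_apply]
      refine Linked.rot (h k k.le_succ) ?_
      have := h (k + 1) le_rfl
      rwa [pow_succ', Equiv.Perm.mul_apply] at this
  by_cases hx : ∃ x : T.Dart, x.fst = v ∧ M.tri x ∈ S
  · obtain ⟨x, hxv, hxS⟩ := hx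
    have hother : ∀ f : T.Dart, f.fst = v → f ≠ x → M.tri f ∉ S := fun f hf hne hfS =>
      hv ⟨f, x, hf, hxv, hne, hfS, hxS⟩
    have main : ∀ f : T.Dart, f.fst = v → M.tri f ∉ S →
        M.Linked S (M.tri (M.rot x)) (M.tri f) := by
      intro f hf hfS
      obtain ⟨k, -, hk⟩ := (M.rot_sameCycle x f (hxv.trans hf.symm)).exists_pow_eq'
      have hex : ∃ k, (M.rot ^ k) (M.rot x) = f := by
        rcases k with - | k
        · exact absurd hxS (by rw [pow_zero] at hk; rw [show x = f from hk]; exact hfS)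
        · exact ⟨k, by rw [← hk, pow_succ, Equiv.Perm.mul_apply]⟩
      classical
      have hmin : ∀ j, j < Nat.find hex → (M.rot ^ j) (M.rot x) ≠ f := fun j => Nat.find_min hex
      have hspec := Nat.find_spec hex
      generalize Nat.find hex = m at hmin hspec
      have hne : ∀ j, j ≤ m → (M.rot ^ j) (M.rot x) ≠ x := by
        intro j hj hjx
        rcases hj.eq_or_lt with rfl | hjm
        · exact hfS (hspec.symm.trans hjx ▸ hxS)
        -- Meeting `x` after `j` steps means being back at `rot x` after `j + 1`, so `f` would be
        -- reached that much earlier.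
        · apply hmin (m - (j + 1)) (by omega)
          rw [← hspec]
          conv_rhs => rw [show m = (m - (j + 1)) + 1 + j by omega, pow_add,
            Equiv.Perm.mul_apply, hjx, pow_succ, Equiv.Perm.mul_apply]
      rw [← hspec]
      refine key _ (by rw [rot_fst, hxv]) (hother _ (by rw [rot_fst, hxv]) (M.rot_ne x)) m ?_
      intro j hj
      exact hother _ (by rw [hpow, rot_fst, hxv]) (hne j hj)
    exact (main d hd hdS).symm.trans (main e he heS)
  · push Not at hx
    obtain ⟨k, -, rfl⟩ := (M.rot_sameCycle d e (hd.trans he.symm)).exists_pow_eq'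
    exact key d hd hdS k fun j _ => hx _ (by rw [hpow, hd])

/-- The two triangles of `S` at a bad vertex are distinct, so they exhaust `S`. The bad vertices are
thus common to all deleted triangles. -/
theorem bad_mem (hS : S.card < 3) {v : V} (hv : Bad S v) {t : M.Tri} (ht : t ∈ S) : t.Mem v := by
  obtain ⟨d, e, rfl, he, hne, hdS, heS⟩ := hv
  have htri : M.tri d ≠ M.tri e := by
    intro h
    rcases M.tri_eq_iff.1 h with rfl | rfl | rfl
    · exact hne rfl
    · exact d.snd_ne_fst he
    · exact M.third_ne_left d.adj he
  by_contra hmem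
  have h1 : t ≠ M.tri d := by
    rintro rfl
    exact hmem ⟨d, rfl, rfl⟩
  have h2 : t ≠ M.tri e := by
    rintro rfl
    exact hmem ⟨e, rfl, he⟩
  have : 2 < S.card := Finset.two_lt_card.2 ⟨_, hdS, _, heS, t, ht, htri, h1.symm, h2.symm⟩
  omega

/-- The dual of a triangulation is `3`-connected, if the triangulation stays connected when
a set of at most two pairwise adjacent vertices is deleted. -/
theorem dual_isKConnected [Finite V] (hcard : 3 < Nat.card M.Tri)
    (hT : ∀ P : V → Prop, (∀ u v, P u → P v → u ≠ v → T.Adj u v) →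
      (∀ u v w, P u → P v → P w → u = v ∨ u = w ∨ v = w) →
      (T.induce {v | ¬ P v}).Preconnected) : IsKConnected 3 M.dual := by
  refine ⟨hcard, fun S hS => ?_⟩
  -- If all three vertices of a triangle were bad, every member of `S` would be this triangle,
  -- whereas a bad vertex needs two. It follows that there are at most two bad vertices and that
  -- every triangle has a good vertex.
  have hthree : ∀ d : T.Dart, Bad S d.fst → Bad S d.snd → Bad S (M.third d.fst d.snd) →
      False := by
    intro d h1 h2 h3
    have hall : ∀ t ∈ S, t = M.tri d := fun t ht =>
      tri_eq_of_mem (bad_mem hS h1 ht) (bad_mem hS h2 ht) (bad_mem hS h3 ht)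
    obtain ⟨f, g, hf, hg, hne, hfS, hgS⟩ := h1
    rcases M.tri_eq_iff.1 ((hall _ hfS).trans (hall _ hgS).symm) with rfl | rfl | rfl
    · exact hne rfl
    · exact f.snd_ne_fst (hg.trans hf.symm)
    · exact M.third_ne_left f.adj (hg.trans hf.symm)
  have hpre := hT (Bad S)
    (fun u v hu hv hne => by
      obtain ⟨f, -, -, -, -, hfS, -⟩ := id hu
      exact (bad_mem hS hu hfS).adj (bad_mem hS hv hfS) hne)
    (fun u v w hu hv hw => by
      by_contra! hne
      obtain ⟨f, -, -, -, -, hfS, -⟩ := id hu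
      obtain ⟨d, hd, h⟩ := (bad_mem hS hu hfS).exists_dart (bad_mem hS hv hfS) hne.1
      have hw' := bad_mem hS hw hfS
      rw [← hd] at hw'
      rcases h with ⟨rfl, rfl⟩ | ⟨rfl, rfl⟩ <;> rcases mem_tri_iff.1 hw' with rfl | rfl | rfl
      · exact hne.2.1 rfl
      · exact hne.2.2 rfl
      · exact hthree d hu hv hw
      · exact hne.2.2 rfl
      · exact hne.2.1 rfl
      · exact hthree d hv hu hw)
  -- A walk of good vertices in `T` is turned into a chain of triangles. From `a` to `b` one passes
  -- through a triangle on the edge `ab`; since `a` is good, at least one of the two sides is not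
  -- deleted.
  have hlink : ∀ u v : {v | ¬ Bad S v}, ∀ _ : (T.induce {v | ¬ Bad S v}).Walk u v,
      ∀ d e : T.Dart, d.fst = u → e.fst = v → M.tri d ∉ S → M.tri e ∉ S →
      M.Linked S (M.tri d) (M.tri e) := by
    intro u v p
    induction p with
    | @nil a => exact fun d e hd he => linked_of_not_bad a.2 hd he
    | @cons a b c h p ih =>
      intro d e hd he hdS heS
      have hab : T.Adj a b := h
      let f : T.Dart := ⟨(a.1, b.1), hab⟩
      by_cases hf : M.tri f ∈ S
      · have hf' : M.tri f.symm ∉ S := fun hf' =>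
          a.2 ⟨f, M.rot f, rfl, rfl, (M.rot_ne f).symm, hf, by rwa [rot_apply, tri_turn]⟩
        have h1 : M.Linked S (M.tri d) (M.tri (M.rot f)) :=
          linked_of_not_bad a.2 hd rfl hdS (by rwa [rot_apply, tri_turn])
        rw [rot_apply, tri_turn] at h1
        exact h1.trans (ih f.symm e rfl he hf' heS)
      · have h1 : M.Linked S (M.tri d) (M.tri f) := linked_of_not_bad a.2 hd rfl hdS hf
        have h2 := ih (M.turn f) e rfl he (by rwa [tri_turn]) heS
        rw [tri_turn] at h2
        exact h1.trans h2
  have hgood : ∀ t : M.Tri, ∃ d, M.tri d = t ∧ ¬ Bad S d.fst := by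
    intro t
    obtain ⟨d, rfl⟩ := M.tri_surjective t
    by_contra! h
    exact hthree d (h d rfl) (h (M.turn d) (M.tri_turn d))
      (h (M.turn (M.turn d)) (by rw [tri_turn, tri_turn]))
  have hne : ∃ t, t ∉ S := by
    by_contra! h
    have := Fintype.ofFinite M.Tri
    rw [Nat.card_eq_fintype_card, ← Finset.card_univ] at hcard
    have := Finset.card_le_card (fun t _ => h t : Finset.univ ⊆ S)
    omega
  obtain ⟨t₀, ht₀⟩ := hne
  have : Nonempty {t | t ∉ S} := ⟨⟨t₀, ht₀⟩⟩
  refine ⟨?_⟩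
  rintro ⟨t, ht⟩ ⟨t', ht'⟩
  obtain ⟨d, rfl, hd⟩ := hgood t
  obtain ⟨e, rfl, he⟩ := hgood t'
  obtain ⟨p⟩ := hpre ⟨d.fst, hd⟩ ⟨e.fst, he⟩
  exact (hlink _ _ p d e rfl rfl ht ht').2.2

theorem IsKConnected_connected {W : Type*} {G : SimpleGraph W} {k : ℕ} (hk : 0 < k)
    (h : IsKConnected k G) : G.Connected := by
  have h0 := h.2 ∅ (by simpa using hk)
  have e : G.induce {v | v ∉ (∅ : Finset W)} ≃g G :=
    ⟨(Equiv.subtypeUnivEquiv (by simp)), by simp⟩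
  exact e.connected_iff.1 h0

end Deletion

end Triangulation
end StrongEmb

namespace StrongEmb

open SimpleGraph

/-! ### The triangulation `T n` -/

/-- The relation defining `T n` in terms of the numbers of the vertices. -/
def RelNum (n a b : ℕ) : Prop :=
  (a + 1 = b ∧ b < 2 * n) ∨ (a + 1 = 2 * n ∧ b = 0) ∨
  (a < 2 * n ∧ (b = 2 * n ∨ b = 2 * n + 1)) ∨
  ((a = 0 ∨ a = 1 ∨ a = 2 * n) ∧ b = 2 * n + 2) ∨
  ((a = 0 ∨ a = 1 ∨ a = 2 * n + 2) ∧ b = 2 * n + 3) ∨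
  ((a = 1 ∨ a = 2 ∨ a = 2 * n) ∧ b = 2 * n + 4)

/-- The adjacency of `T n` in terms of the numbers of the vertices. -/
def AdjNum (n a b : ℕ) : Prop := RelNum n a b ∨ RelNum n b a

theorem RelNum.ne {n a b : ℕ} (hn : 3 < n) (h : RelNum n a b) : a ≠ b := by
  rcases h with h | h | h | h | h | h <;> omega

theorem T_adj_iff {n : ℕ} (hn : 3 < n) {a b : Fin (2 * n + 5)} :
    (T n).Adj a b ↔ AdjNum n a b := by
  rw [T, fromRel_adj, ne_eq, Fin.ext_iff]
  exact ⟨fun h => h.2, fun h => ⟨by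
    rcases h with h | h
    · exact h.ne hn
    · exact (h.ne hn).symm, h⟩⟩

theorem AdjNum.symm {n a b : ℕ} (h : AdjNum n a b) : AdjNum n b a := Or.symm h

/-- The next vertex on the cycle of length `2 * n`. -/
def cycSucc (n a : ℕ) : ℕ := if a + 1 = 2 * n then 0 else a + 1

/-- The previous vertex on the cycle of length `2 * n`. -/
def cycPred (n a : ℕ) : ℕ := if a = 0 then 2 * n - 1 else a - 1

/-- The third vertex of the oriented triangle on a dart of `T n`. -/
def thirdNum (n a b : ℕ) : ℕ :=
  if a = 2 * n then
    if b = 0 then 2 * n + 2 else if b = 1 then 2 * n + 4 else if b = 2 * n + 2 then 1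
    else if b = 2 * n + 4 then 2 else cycSucc n b
  else if a = 2 * n + 1 then cycPred n b
  else if b = 2 * n then
    if a = 1 then 2 * n + 2 else if a = 2 then 2 * n + 4 else if a = 2 * n + 2 then 0
    else if a = 2 * n + 4 then 1 else cycPred n a
  else if b = 2 * n + 1 then cycSucc n a
  else if a = 2 * n + 2 then if b = 0 then 2 * n + 3 else if b = 1 then 2 * n else 1
  else if a = 2 * n + 3 then if b = 0 then 1 else if b = 1 then 2 * n + 2 else 0
  else if a = 2 * n + 4 then if b = 1 then 2 else 2 * n
  else if b = 2 * n + 2 then if a = 0 then 2 * n else 2 * n + 3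
  else if b = 2 * n + 3 then if a = 0 then 2 * n + 2 else if a = 1 then 0 else 1
  else if b = 2 * n + 4 then if a = 1 then 2 * n else 1
  else if b = a + 1 ∨ a + 1 = 2 * n ∧ b = 0 then if a = 0 then 2 * n + 3 else if a = 1 then 2 * n + 4 else 2 * n
  else 2 * n + 1

/-- The position on the cycle of length `2 * n` of the triangle on a dart of `T n`: all triangles
are placed in the gaps between consecutive vertices of the cycle. -/
def gapNum (n a b : ℕ) : ℕ :=
  if a = 2 * n + 4 ∨ b = 2 * n + 4 then 1
  else if a = 2 * n + 2 ∨ b = 2 * n + 2 ∨ a = 2 * n + 3 ∨ b = 2 * n + 3 then 0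
  else if a = 2 * n then b
  else if a = 2 * n + 1 then cycPred n b
  else if b = 2 * n then cycPred n a
  else if b = 2 * n + 1 then a
  else if b = a + 1 ∨ a + 1 = 2 * n ∧ b = 0 then a else b

/-- `(a, b, c)` is an oriented triangle of `T n` in the gap `g`, up to rotation. -/
def BaseTri (n a b c g : ℕ) : Prop :=
  (a = 2 * n ∧ 2 ≤ b ∧ b + 1 < 2 * n ∧ c = b + 1 ∧ g = b) ∨
  (a = 2 * n ∧ b + 1 = 2 * n ∧ c = 0 ∧ g = b) ∨
  (a = 2 * n + 1 ∧ b < 2 * n ∧ b = c + 1 ∧ g = c) ∨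
  (a = 2 * n + 1 ∧ c + 1 = 2 * n ∧ b = 0 ∧ g = c) ∨
  (a = 0 ∧ b = 1 ∧ c = 2 * n + 3 ∧ g = 0) ∨
  (a = 1 ∧ b = 2 * n + 2 ∧ c = 2 * n + 3 ∧ g = 0) ∨
  (a = 2 * n + 2 ∧ b = 0 ∧ c = 2 * n + 3 ∧ g = 0) ∨
  (a = 1 ∧ b = 2 * n ∧ c = 2 * n + 2 ∧ g = 0) ∨
  (a = 2 * n ∧ b = 0 ∧ c = 2 * n + 2 ∧ g = 0) ∨
  (a = 1 ∧ b = 2 ∧ c = 2 * n + 4 ∧ g = 1) ∨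
  (a = 2 ∧ b = 2 * n ∧ c = 2 * n + 4 ∧ g = 1) ∨
  (a = 2 * n ∧ b = 1 ∧ c = 2 * n + 4 ∧ g = 1)

/-- `(a, b, c)` is an oriented triangle of `T n` in the gap `g`. -/
def NumTri (n a b c g : ℕ) : Prop :=
  BaseTri n a b c g ∨ BaseTri n b c a g ∨ BaseTri n c a b g

theorem NumTri.rotate {n a b c g : ℕ} (h : NumTri n a b c g) : NumTri n b c a g := by
  unfold NumTri at *
  tauto

theorem NumTri.adj {n a b c g : ℕ} (hn : 3 < n) (h : NumTri n a b c g) :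
    AdjNum n a b := by
  unfold NumTri BaseTri at h
  rcases h with h | h | h <;>
    rcases h with h | h | h | h | h | h | h | h | h | h | h | h <;>
    obtain ⟨h1, h2, h3, h4⟩ := h <;> unfold AdjNum RelNum <;> first
    | (left; left; omega)
    | (left; right; left; omega)
    | (left; right; right; left; omega)
    | (left; right; right; right; left; omega)
    | (left; right; right; right; right; left; omega)
    | (left; right; right; right; right; right; omega)
    | (right; left; omega)
    | (right; right; left; omega)
    | (right; right; right; left; omega)
    | (right; right; right; right; left; omega)
    | (right; right; right; right; right; left; omega)
    | (right; right; right; right; right; right; omega)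

theorem NumTri.third {n a b c g : ℕ} (hn : 3 < n) (h : NumTri n a b c g) :
    thirdNum n a b = c := by
  unfold NumTri BaseTri at h
  rcases h with h | h | h <;>
    rcases h with h | h | h | h | h | h | h | h | h | h | h | h <;>
    obtain ⟨h1, h2, h3, h4⟩ := h <;> unfold thirdNum cycSucc cycPred <;>
    repeat' first | rw [if_pos (by omega)] | rw [if_neg (by omega)] | omega

theorem NumTri.gap {n a b c g : ℕ} (hn : 3 < n) (h : NumTri n a b c g) :
    gapNum n a b = g := by
  unfold NumTri BaseTri at h
  rcases h with h | h | h <;>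
    rcases h with h | h | h | h | h | h | h | h | h | h | h | h <;>
    obtain ⟨h1, h2, h3, h4⟩ := h <;> unfold gapNum cycPred <;>
    repeat' first | rw [if_pos (by omega)] | rw [if_neg (by omega)] | omega

theorem NumTri.third_ne {n a b c g : ℕ} (hn : 3 < n) (h : NumTri n a b c g) :
    thirdNum n b a ≠ c := by
  unfold NumTri BaseTri at h
  rcases h with h | h | h <;>
    rcases h with h | h | h | h | h | h | h | h | h | h | h | h <;>
    obtain ⟨h1, h2, h3, h4⟩ := h <;> unfold thirdNum cycSucc cycPred <;>
  repeat' first | rw [if_pos (by omega)] | rw [if_neg (by omega)] | omega | split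

theorem BaseTri.one {n a b c g : ℕ} (h : BaseTri n a b c g) : NumTri n a b c g := Or.inl h

theorem BaseTri.two {n a b c g : ℕ} (h : BaseTri n a b c g) : NumTri n b c a g := h.one.rotate

theorem BaseTri.three {n a b c g : ℕ} (h : BaseTri n a b c g) : NumTri n c a b g :=
  h.two.rotate

theorem baseTri_hub {n : ℕ} {i : ℕ} (h : 2 ≤ i) (h' : i + 1 < 2 * n) : BaseTri n (2 * n) i (i + 1) i :=
  Or.inl (by omega)

theorem baseTri_hub_last {n : ℕ} {i : ℕ} (h : i + 1 = 2 * n) : BaseTri n (2 * n) i 0 i :=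
  Or.inr (Or.inl (by omega))

theorem baseTri_rim {n : ℕ} {i : ℕ} (h : i + 1 < 2 * n) : BaseTri n (2 * n + 1) (i + 1) i i :=
  Or.inr (Or.inr (Or.inl (by omega)))

theorem baseTri_rim_last {n : ℕ} {i : ℕ} (h : i + 1 = 2 * n) : BaseTri n (2 * n + 1) 0 i i :=
  Or.inr (Or.inr (Or.inr (Or.inl (by omega))))

theorem baseTri_zero_one {n : ℕ} : BaseTri n 0 1 (2 * n + 3) 0 :=
  Or.inr (Or.inr (Or.inr (Or.inr (Or.inl (by omega)))))

theorem baseTri_one_w {n : ℕ} : BaseTri n 1 (2 * n + 2) (2 * n + 3) 0 :=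
  Or.inr (Or.inr (Or.inr (Or.inr (Or.inr (Or.inl (by omega))))))

theorem baseTri_w_zero {n : ℕ} : BaseTri n (2 * n + 2) 0 (2 * n + 3) 0 :=
  Or.inr (Or.inr (Or.inr (Or.inr (Or.inr (Or.inr (Or.inl (by omega)))))))

theorem baseTri_one_hub {n : ℕ} : BaseTri n 1 (2 * n) (2 * n + 2) 0 :=
  Or.inr (Or.inr (Or.inr (Or.inr (Or.inr (Or.inr (Or.inr (Or.inl (by omega))))))))

theorem baseTri_hub_zero {n : ℕ} : BaseTri n (2 * n) 0 (2 * n + 2) 0 :=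
  Or.inr (Or.inr (Or.inr (Or.inr (Or.inr (Or.inr (Or.inr (Or.inr (Or.inl (by omega)))))))))

theorem baseTri_one_two {n : ℕ} : BaseTri n 1 2 (2 * n + 4) 1 :=
  Or.inr (Or.inr (Or.inr (Or.inr (Or.inr (Or.inr (Or.inr (Or.inr (Or.inr (Or.inl (by omega))))))))))

theorem baseTri_two_hub {n : ℕ} : BaseTri n 2 (2 * n) (2 * n + 4) 1 :=
  Or.inr (Or.inr (Or.inr (Or.inr (Or.inr (Or.inr (Or.inr (Or.inr (Or.inr (Or.inr (Or.inl (by omega)))))))))))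

theorem baseTri_hub_one {n : ℕ} : BaseTri n (2 * n) 1 (2 * n + 4) 1 :=
  Or.inr (Or.inr (Or.inr (Or.inr (Or.inr (Or.inr (Or.inr (Or.inr (Or.inr (Or.inr (Or.inr ((by omega))))))))))))

/-- The list in `BaseTri` is complete: it has a triangle on either side of each edge. With
`NumTri.third` and `NumTri.gap` this shows that the closed formulas `thirdNum` and `gapNum` agree
with the list on every dart. -/
theorem exists_numTri {n a b : ℕ} (hn : 3 < n) (h : RelNum n a b) :
    (∃ c g, NumTri n a b c g) ∧ ∃ c g, NumTri n b a c g := by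
  rcases h with ⟨rfl, h⟩ | ⟨h, rfl⟩ | ⟨h, rfl | rfl⟩ | ⟨rfl | rfl | rfl, rfl⟩ |
    ⟨rfl | rfl | rfl, rfl⟩ | ⟨rfl | rfl | rfl, rfl⟩
  · refine ⟨?_, _, _, (baseTri_rim h).two⟩
    rcases (by omega : a = 0 ∨ a = 1 ∨ 2 ≤ a) with rfl | rfl | h2
    · exact ⟨_, _, baseTri_zero_one.one⟩
    · exact ⟨_, _, baseTri_one_two.one⟩
    · exact ⟨_, _, (baseTri_hub h2 h).two⟩
  · exact ⟨⟨_, _, (baseTri_hub_last h).two⟩, _, _, (baseTri_rim_last h).two⟩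
  · constructor
    · rcases a with - | - | - | i
      · exact ⟨_, _, (baseTri_hub_last (by omega : 2 * n - 1 + 1 = 2 * n)).three⟩
      · exact ⟨_, _, baseTri_one_hub.one⟩
      · exact ⟨_, _, baseTri_two_hub.one⟩
      · exact ⟨_, _, (baseTri_hub (by omega : 2 ≤ i + 2) h).three⟩
    · rcases (by omega : a = 0 ∨ a = 1 ∨ (2 ≤ a ∧ a + 1 < 2 * n) ∨ a + 1 = 2 * n) with
        rfl | rfl | ⟨h2, h3⟩ | h2
      · exact ⟨_, _, baseTri_hub_zero.one⟩
      · exact ⟨_, _, baseTri_hub_one.one⟩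
      · exact ⟨_, _, (baseTri_hub h2 h3).one⟩
      · exact ⟨_, _, (baseTri_hub_last h2).one⟩
  · constructor
    · rcases (by omega : a + 1 < 2 * n ∨ a + 1 = 2 * n) with h2 | h2
      · exact ⟨_, _, (baseTri_rim h2).three⟩
      · exact ⟨_, _, (baseTri_rim_last h2).three⟩
    · rcases a with - | i
      · exact ⟨_, _, (baseTri_rim_last (by omega : 2 * n - 1 + 1 = 2 * n)).one⟩
      · exact ⟨_, _, (baseTri_rim h).one⟩
  · exact ⟨⟨_, _, baseTri_hub_zero.two⟩, _, _, baseTri_w_zero.one⟩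
  · exact ⟨⟨_, _, baseTri_one_w.one⟩, _, _, baseTri_one_hub.three⟩
  · exact ⟨⟨_, _, baseTri_one_hub.two⟩, _, _, baseTri_hub_zero.three⟩
  · exact ⟨⟨_, _, baseTri_w_zero.two⟩, _, _, baseTri_zero_one.three⟩
  · exact ⟨⟨_, _, baseTri_zero_one.two⟩, _, _, baseTri_one_w.three⟩
  · exact ⟨⟨_, _, baseTri_one_w.two⟩, _, _, baseTri_w_zero.three⟩
  · exact ⟨⟨_, _, baseTri_hub_one.two⟩, _, _, baseTri_one_two.three⟩
  · exact ⟨⟨_, _, baseTri_one_two.two⟩, _, _, baseTri_two_hub.three⟩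
  · exact ⟨⟨_, _, baseTri_two_hub.two⟩, _, _, baseTri_hub_one.three⟩

theorem AdjNum.numTri {n a b : ℕ} (hn : 3 < n) (h : AdjNum n a b) :
    NumTri n a b (thirdNum n a b) (gapNum n a b) := by
  obtain ⟨c, g, h⟩ : ∃ c g, NumTri n a b c g := by
    rcases h with h | h
    · exact (exists_numTri hn h).1
    · exact (exists_numTri hn h).2
  rwa [h.third hn, h.gap hn]

theorem AdjNum.lt {n a b : ℕ} (h : AdjNum n a b) : a < 2 * n + 5 := by
  rcases h with (h | h | h | h | h | h) | (h | h | h | h | h | h) <;> omega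

/-- The number of the third vertex as a vertex of `T n`. -/
def thirdVertex (n : ℕ) (u v : Fin (2 * n + 5)) : Fin (2 * n + 5) :=
  -- The reduction only makes the map total; on adjacent pairs it has no effect, by
  -- `thirdVertex_val`.
  ⟨thirdNum n u v % (2 * n + 5), Nat.mod_lt _ (by omega)⟩

theorem NumTri.thirdVertex_eq {n : ℕ} (hn : 3 < n) {u v : Fin (2 * n + 5)} {w g : ℕ}
    (h : NumTri n u v w g) (hw : w < 2 * n + 5) : thirdVertex n u v = ⟨w, hw⟩ := by
  rw [thirdVertex, Fin.mk.injEq, h.third hn, Nat.mod_eq_of_lt hw]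

theorem NumTri.lt {n a b c g : ℕ} (hn : 3 < n) (h : NumTri n a b c g) :
    a < 2 * n + 5 := (h.adj hn).lt

theorem thirdVertex_val {n : ℕ} (hn : 3 < n) {u v : Fin (2 * n + 5)} (h : AdjNum n u v) :
    (thirdVertex n u v : ℕ) = thirdNum n u v := by
  have := (h.numTri hn).rotate.rotate.lt hn
  rw [thirdVertex, Fin.val_mk, Nat.mod_eq_of_lt this]

/-- The vertex number `x` occurs when one walks around the vertex `u` of `T n` from `b`. -/
def ReachNum (n : ℕ) (u b : Fin (2 * n + 5)) (x : ℕ) : Prop :=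
  ∃ k, ((thirdVertex n u)^[k] b : ℕ) = x

theorem ReachNum.refl {n : ℕ} (u b : Fin (2 * n + 5)) : ReachNum n u b b := ⟨0, rfl⟩

theorem ReachNum.step {n : ℕ} (hn : 3 < n) {u : ℕ} {hu : u < 2 * n + 5}
    {b : Fin (2 * n + 5)} {x y g : ℕ} (h : ReachNum n ⟨u, hu⟩ b x) (ht : NumTri n u x y g) :
    ReachNum n ⟨u, hu⟩ b y := by
  obtain ⟨k, rfl⟩ := h
  refine ⟨k + 1, ?_⟩
  rw [Function.iterate_succ_apply', thirdVertex_val hn (ht.adj hn), ht.third hn]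

/-- The links are traversed explicitly, one triangle at a time. Only the links of the two hubs have
unbounded length and need induction. -/
theorem exists_reachNum {n : ℕ} (hn : 3 < n) (u : Fin (2 * n + 5)) :
    ∃ b : Fin (2 * n + 5), AdjNum n u b ∧ ∀ x, AdjNum n u x → ReachNum n u b x := by
  obtain ⟨u, hu⟩ := u
  suffices ∃ (b : ℕ) (hb : b < 2 * n + 5), AdjNum n u b ∧
      ∀ x, AdjNum n u x → ReachNum n ⟨u, hu⟩ ⟨b, hb⟩ x by
    obtain ⟨b, hb, h⟩ := this
    exact ⟨⟨b, hb⟩, h⟩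
  have hr := fun b (hb : b < 2 * n + 5) =>
    (ReachNum.refl ⟨u, hu⟩ ⟨b, hb⟩ : ReachNum n ⟨u, hu⟩ ⟨b, hb⟩ b)
  rcases (by omega : u = 0 ∨ u = 1 ∨ u = 2 ∨ (3 ≤ u ∧ u < 2 * n) ∨ u = 2 * n ∨ u = 2 * n + 1 ∨
    u = 2 * n + 2 ∨ u = 2 * n + 3 ∨ u = 2 * n + 4) with
    rfl | rfl | rfl | ⟨h3, hlt⟩ | rfl | rfl | rfl | rfl | rfl
  · have h0 := hr (2 * n + 1) (by omega)
    have h1 := h0.step hn (baseTri_rim (by omega)).three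
    have h2 := h1.step hn baseTri_zero_one.one
    have h3 := h2.step hn baseTri_w_zero.two
    have h4 := h3.step hn baseTri_hub_zero.two
    have h5 := h4.step hn (baseTri_hub_last (by omega : 2 * n - 1 + 1 = 2 * n)).three
    refine ⟨2 * n + 1, by omega, (baseTri_rim (by omega)).three.adj hn, fun x hx => ?_⟩
    rcases (by unfold AdjNum RelNum at hx; omega : x = 2 * n + 1 ∨ x = 0 + 1 ∨ x = 2 * n + 3 ∨
      x = 2 * n + 2 ∨ x = 2 * n ∨ x = 2 * n - 1) with rfl | rfl | rfl | rfl | rfl | rfl <;>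
      assumption
  · have h0 := hr (2 * n + 1) (by omega)
    have h1 := h0.step hn (baseTri_rim (by omega)).three
    have h2 := h1.step hn baseTri_one_two.one
    have h3 := h2.step hn baseTri_hub_one.two
    have h4 := h3.step hn baseTri_one_hub.one
    have h5 := h4.step hn baseTri_one_w.one
    have h6 := h5.step hn baseTri_zero_one.two
    refine ⟨2 * n + 1, by omega, (baseTri_rim (by omega)).three.adj hn, fun x hx => ?_⟩
    rcases (by unfold AdjNum RelNum at hx; omega : x = 2 * n + 1 ∨ x = 1 + 1 ∨ x = 2 * n + 4 ∨
      x = 2 * n ∨ x = 2 * n + 2 ∨ x = 2 * n + 3 ∨ x = 0) with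
      rfl | rfl | rfl | rfl | rfl | rfl | rfl <;> assumption
  · have h0 := hr (2 * n + 1) (by omega)
    have h1 := h0.step hn (baseTri_rim (by omega)).three
    have h2 := h1.step hn (baseTri_hub (i := 2) le_rfl (by omega)).two
    have h3 := h2.step hn baseTri_two_hub.one
    have h4 := h3.step hn baseTri_one_two.two
    refine ⟨2 * n + 1, by omega, (baseTri_rim (by omega)).three.adj hn, fun x hx => ?_⟩
    rcases (by unfold AdjNum RelNum at hx; omega : x = 2 * n + 1 ∨ x = 2 + 1 ∨ x = 2 * n ∨
      x = 2 * n + 4 ∨ x = 1) with rfl | rfl | rfl | rfl | rfl <;> assumption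
  · have h0 := hr (2 * n + 1) (by omega)
    obtain ⟨i, rfl⟩ : ∃ i, u = i + 1 := ⟨u - 1, by omega⟩
    rcases (by omega : i + 1 + 1 < 2 * n ∨ i + 1 + 1 = 2 * n) with hi | hi
    · have h1 := h0.step hn (baseTri_rim hi).three
      have h2 := h1.step hn (baseTri_hub (by omega) hi).two
      have h4 := h2.step hn (baseTri_hub (by omega) hlt).three
      refine ⟨2 * n + 1, by omega, (baseTri_rim hi).three.adj hn, fun x hx => ?_⟩
      rcases (by unfold AdjNum RelNum at hx; omega : x = 2 * n + 1 ∨ x = i + 1 + 1 ∨ x = 2 * n ∨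
        x = i) with rfl | rfl | rfl | rfl <;> assumption
    · have h1 := h0.step hn (baseTri_rim_last hi).three
      have h2 := h1.step hn (baseTri_hub_last hi).two
      have h4 := h2.step hn (baseTri_hub (by omega) hlt).three
      refine ⟨2 * n + 1, by omega, (baseTri_rim_last hi).three.adj hn, fun x hx => ?_⟩
      rcases (by unfold AdjNum RelNum at hx; omega : x = 2 * n + 1 ∨ x = 0 ∨ x = 2 * n ∨
        x = i) with rfl | rfl | rfl | rfl <;> assumption
  · have h0 := hr 0 (by omega)
    have h1 := h0.step hn baseTri_hub_zero.one
    have h2 := h1.step hn baseTri_one_hub.two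
    have h3 := h2.step hn baseTri_hub_one.one
    have h4 := h3.step hn baseTri_two_hub.two
    have h5 : ∀ k, k + 2 < 2 * n → ReachNum n ⟨2 * n, hu⟩ ⟨0, by omega⟩ (k + 2) := by
      intro k
      induction k with
      | zero => exact fun _ => h4
      | succ k ih => exact fun hk => (ih (by omega)).step hn (baseTri_hub (by omega) (by omega)).one
    refine ⟨0, by omega, baseTri_hub_zero.one.adj hn, fun x hx => ?_⟩
    rcases x with - | - | x
    · exact h0
    · exact h2
    rcases (by unfold AdjNum RelNum at hx; omega : x + 2 < 2 * n ∨ x + 2 = 2 * n + 2 ∨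
      x + 2 = 2 * n + 4) with h | h | h
    · exact h5 x h
    · exact h ▸ h1
    · exact h ▸ h3
  · have h0 := hr (2 * n - 1) (by omega)
    have h5 : ∀ k i, i + k = 2 * n - 1 →
        ReachNum n ⟨2 * n + 1, hu⟩ ⟨2 * n - 1, by omega⟩ i := by
      intro k
      induction k with
      | zero =>
        rintro i rfl
        exact h0
      | succ k ih =>
        intro i hi
        exact (ih (i + 1) (by omega)).step hn (baseTri_rim (by omega)).one
    refine ⟨2 * n - 1, by omega, NumTri.adj hn (c := 2 * n - 1 - 1) (g := 2 * n - 1 - 1) ?_, fun x hx => ?_⟩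
    · have := (baseTri_rim (by omega : 2 * n - 1 - 1 + 1 < 2 * n)).one
      rwa [show 2 * n - 1 - 1 + 1 = 2 * n - 1 by omega] at this
    · exact h5 (2 * n - 1 - x) x (by unfold AdjNum RelNum at hx; omega)
  · have h0 := hr 0 (by omega)
    have h1 := h0.step hn baseTri_w_zero.one
    have h2 := h1.step hn baseTri_one_w.two
    have h3 := h2.step hn baseTri_one_hub.three
    refine ⟨0, by omega, baseTri_w_zero.one.adj hn, fun x hx => ?_⟩
    rcases (by unfold AdjNum RelNum at hx; omega : x = 0 ∨ x = 2 * n + 3 ∨ x = 1 ∨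
        x = 2 * n) with rfl | rfl | rfl | rfl <;> assumption
  · have h0 := hr 0 (by omega)
    have h1 := h0.step hn baseTri_zero_one.three
    have h2 := h1.step hn baseTri_one_w.three
    refine ⟨0, by omega, baseTri_zero_one.three.adj hn, fun x hx => ?_⟩
    rcases (by unfold AdjNum RelNum at hx; omega : x = 0 ∨ x = 1 ∨ x = 2 * n + 2)
      with rfl | rfl | rfl <;> assumption
  · have h0 := hr 1 (by omega)
    have h1 := h0.step hn baseTri_one_two.three
    have h2 := h1.step hn baseTri_two_hub.three
    refine ⟨1, by omega, baseTri_one_two.three.adj hn, fun x hx => ?_⟩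
    rcases (by unfold AdjNum RelNum at hx; omega : x = 1 ∨ x = 2 ∨ x = 2 * n)
      with rfl | rfl | rfl <;> assumption

/-- The oriented triangulation with underlying graph `T n`. -/
def triangulation {n : ℕ} (hn : 3 < n) : Triangulation (T n) where
  third := thirdVertex n
  adj_third {u v} h := by
    rw [T_adj_iff hn] at h ⊢
    rw [thirdVertex_val hn h]
    exact (h.numTri hn).rotate.adj hn
  third_third {u v} h := by
    rw [T_adj_iff hn] at h
    have h1 := (h.numTri hn).rotate
    rw [← thirdVertex_val hn h] at h1
    exact h1.thirdVertex_eq hn u.2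
  third_ne {u v} h := by
    rw [T_adj_iff hn] at h
    rw [ne_eq, Fin.ext_iff, thirdVertex_val hn h, thirdVertex_val hn h.symm]
    exact ((h.numTri hn).third_ne hn).symm
  reach u := by
    obtain ⟨b, hb, hr⟩ := exists_reachNum hn u
    refine ⟨b, (T_adj_iff hn).2 hb, fun w hw => ?_⟩
    obtain ⟨k, hk⟩ := hr w ((T_adj_iff hn).1 hw)
    exact ⟨k, Fin.ext hk⟩

end StrongEmb

/-! ### The number of edges of `T n` and its connectivity. -/

namespace StrongEmb

open SimpleGraph

theorem RelNum.asymm {n a b : ℕ} (hn : 3 < n) (h : RelNum n a b) : ¬ RelNum n b a := by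
  intro h'
  rcases h with h | h | h | h | h | h <;> rcases h' with h' | h' | h' | h' | h' | h' <;> omega

/-- The pairs of numbers of adjacent vertices of `T n`, oriented by `RelNum`. -/
def relPairs (n : ℕ) : Finset (ℕ × ℕ) :=
  ((Finset.range (2 * n)).image fun i => (i, cycSucc n i)) ∪
    Finset.range (2 * n) ×ˢ {2 * n, 2 * n + 1} ∪
    {0, 1, 2 * n} ×ˢ {2 * n + 2} ∪ {0, 1, 2 * n + 2} ×ˢ {2 * n + 3} ∪
    {1, 2, 2 * n} ×ˢ {2 * n + 4}

theorem mem_relPairs {n a b : ℕ} : (a, b) ∈ relPairs n ↔ RelNum n a b := by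
  have h1 : (∃ i < 2 * n, i = a ∧ cycSucc n i = b) ↔
      (a + 1 = b ∧ b < 2 * n) ∨ (a + 1 = 2 * n ∧ b = 0) := by
    unfold cycSucc
    constructor
    · rintro ⟨i, hi, rfl, rfl⟩
      split_ifs <;> omega
    · rintro (h | h)
      · exact ⟨a, by omega, rfl, by rw [if_neg (by omega)]; omega⟩
      · exact ⟨a, by omega, rfl, by rw [if_pos (by omega)]; omega⟩
  simp only [relPairs, Finset.mem_union, Finset.mem_image, Finset.mem_range, Prod.mk.injEq,
    Finset.mem_product, Finset.mem_insert, Finset.mem_singleton, h1, RelNum, or_assoc]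

/-- The cycle contributes `2 * n`, the spokes at the two hubs `4 * n`, and each of the three
inserted vertices 3. -/
theorem card_relPairs {n : ℕ} (hn : 3 < n) : (relPairs n).card = 6 * n + 9 := by
  have h3 : ∀ a b c : ℕ, a ≠ b → a ≠ c → b ≠ c → ({a, b, c} : Finset ℕ).card = 3 :=
    fun a b c h1 h2 h3 => Finset.card_eq_three.2 ⟨a, b, c, h1, h2, h3, rfl⟩
  rw [relPairs, Finset.card_union_of_disjoint, Finset.card_union_of_disjoint,
    Finset.card_union_of_disjoint, Finset.card_union_of_disjoint,
    Finset.card_image_of_injective _ fun i j h => congrArg Prod.fst h]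
  · simp only [Finset.card_product, Finset.card_range, Finset.card_singleton]
    rw [Finset.card_pair (show 2 * n ≠ 2 * n + 1 by omega), h3 0 1 (2 * n) (by omega) (by omega) (by omega),
      h3 0 1 (2 * n + 2) (by omega) (by omega) (by omega),
      h3 1 2 (2 * n) (by omega) (by omega) (by omega)]
    omega
  all_goals
    rw [Finset.disjoint_left]
    rintro ⟨a, b⟩ h h'
    simp only [Finset.mem_union, Finset.mem_image, Finset.mem_range, Prod.mk.injEq,
      Finset.mem_product, Finset.mem_insert, Finset.mem_singleton, cycSucc] at h h'
  · obtain ⟨i, hi, rfl, rfl⟩ := h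
    by_cases hi' : i + 1 = 2 * n <;> simp only [hi', if_true, if_false, false_or] at h' <;> omega
  · rcases h with ⟨i, hi, rfl, rfl⟩ | h
    · by_cases hi' : i + 1 = 2 * n <;> simp only [hi', if_true, if_false] at h' <;> omega
    · omega
  · rcases h with (⟨i, hi, rfl, rfl⟩ | h) | h
    · by_cases hi' : i + 1 = 2 * n <;> simp only [hi', if_true, if_false] at h' <;> omega
    · omega
    · omega
  · rcases h with ((⟨i, hi, rfl, rfl⟩ | h) | h) | h
    · by_cases hi' : i + 1 = 2 * n <;> simp only [hi', if_true, if_false] at h' <;> omega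
    · omega
    · omega
    · omega

theorem card_edgeSet_T {n : ℕ} (hn : 3 < n) : Nat.card (T n).edgeSet = 6 * n + 9 := by
  rw [← card_relPairs hn, ← Nat.card_eq_finsetCard]
  symm
  have hrel : ∀ p : relPairs n, RelNum n p.1.1 p.1.2 := fun p => mem_relPairs.1 p.2
  refine Nat.card_eq_of_bijective
    (fun p => ⟨s(⟨p.1.1, AdjNum.lt (Or.inl (hrel p))⟩, ⟨p.1.2, AdjNum.lt (Or.inr (hrel p))⟩),
      (T_adj_iff hn).2 (Or.inl (hrel p))⟩) ⟨?_, ?_⟩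
  · intro p q h
    have h := congrArg Subtype.val h
    simp only [Sym2.eq_iff, Fin.mk.injEq] at h
    rcases h with h | h
    · exact Subtype.ext (Prod.ext h.1 h.2)
    · have hp := hrel p
      rw [h.1, h.2] at hp
      exact absurd hp ((hrel q).asymm hn)
  · rintro ⟨e, he⟩
    induction e using Sym2.ind with
    | _ u v =>
      rcases (T_adj_iff hn).1 he with h | h
      · exact ⟨⟨(u, v), mem_relPairs.2 h⟩, Subtype.ext rfl⟩
      · exact ⟨⟨(v, u), mem_relPairs.2 h⟩, Subtype.ext Sym2.eq_swap⟩

theorem adjNum_succ {n i : ℕ} (h : i + 1 < 2 * n) : AdjNum n i (i + 1) :=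
  Or.inl (Or.inl ⟨rfl, h⟩)

theorem adjNum_hub {n i : ℕ} (h : i < 2 * n) : AdjNum n i (2 * n) :=
  Or.inl (Or.inr (Or.inr (Or.inl ⟨h, Or.inl rfl⟩)))

theorem adjNum_rim {n i : ℕ} (h : i < 2 * n) : AdjNum n i (2 * n + 1) :=
  Or.inl (Or.inr (Or.inr (Or.inl ⟨h, Or.inr rfl⟩)))

theorem adjNum_add_two {n i : ℕ} (h : i = 0 ∨ i = 1 ∨ i = 2 * n) : AdjNum n i (2 * n + 2) :=
  Or.inl (Or.inr (Or.inr (Or.inr (Or.inl ⟨h, rfl⟩))))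

theorem adjNum_add_three {n i : ℕ} (h : i = 0 ∨ i = 1 ∨ i = 2 * n + 2) :
    AdjNum n i (2 * n + 3) :=
  Or.inl (Or.inr (Or.inr (Or.inr (Or.inr (Or.inl ⟨h, rfl⟩)))))

theorem adjNum_add_four {n i : ℕ} (h : i = 1 ∨ i = 2 ∨ i = 2 * n) : AdjNum n i (2 * n + 4) :=
  Or.inl (Or.inr (Or.inr (Or.inr (Or.inr (Or.inr ⟨h, rfl⟩)))))

/-- `T n` stays connected when at most two pairwise adjacent vertices are deleted. -/
theorem T_induce_preconnected {n : ℕ} (hn : 3 < n) (P : Fin (2 * n + 5) → Prop)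
    (hadj : ∀ u v, P u → P v → u ≠ v → (T n).Adj u v)
    (hcard : ∀ u v w, P u → P v → P w → u = v ∨ u = w ∨ v = w) :
    ((T n).induce {v | ¬ P v}).Preconnected := by
  let Q : ℕ → Prop := fun a => ∃ h : a < 2 * n + 5, ¬ P ⟨a, h⟩
  have hQ : ∀ a b c, a < 2 * n + 5 → b < 2 * n + 5 → c < 2 * n + 5 → a ≠ b → a ≠ c → b ≠ c →
      Q a ∨ Q b ∨ Q c := by
    intro a b c ha hb hc h1 h2 h3
    by_contra! h
    simp only [Q, not_exists, not_not] at h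
    rcases hcard _ _ _ (h.1 ha) (h.2.1 hb) (h.2.2 hc) with h | h | h <;>
      simp only [Fin.mk.injEq] at h <;> contradiction
  obtain ⟨c, hc, hreach⟩ : ∃ c, ∃ hc : Q c, ∀ a, ∀ ha : Q a,
      ((T n).induce {v | ¬ P v}).Reachable ⟨⟨a, ha.1⟩, ha.2⟩ ⟨⟨c, hc.1⟩, hc.2⟩ := by
    have hstep : ∀ {a b c} (ha : Q a) (hb : Q b) (hc : Q c), AdjNum n a b →
        ((T n).induce {v | ¬ P v}).Reachable ⟨⟨b, hb.1⟩, hb.2⟩ ⟨⟨c, hc.1⟩, hc.2⟩ →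
        ((T n).induce {v | ¬ P v}).Reachable ⟨⟨a, ha.1⟩, ha.2⟩ ⟨⟨c, hc.1⟩, hc.2⟩ := by
      intro a b c ha hb hc h h'
      refine Reachable.trans (Adj.reachable ?_) h'
      exact (T_adj_iff hn).2 h
    by_cases hA : Q (2 * n)
    · refine ⟨2 * n, hA, ?_⟩
      have h1 : ∀ a (ha : Q a), AdjNum n a (2 * n) →
          ((T n).induce {v | ¬ P v}).Reachable ⟨⟨a, ha.1⟩, ha.2⟩ ⟨⟨2 * n, hA.1⟩, hA.2⟩ :=
        fun a ha h => hstep ha hA hA h (Reachable.refl _)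
      intro a ha
      have halt := ha.1
      rcases (by omega : a = 2 * n ∨ a < 2 * n ∨ a = 2 * n + 1 ∨ a = 2 * n + 2 ∨
        a = 2 * n + 3 ∨ a = 2 * n + 4) with rfl | h | rfl | rfl | rfl | rfl
      · exact Reachable.refl _
      · exact h1 a ha (adjNum_hub h)
      · rcases hQ 0 1 2 (by omega) (by omega) (by omega) (by omega) (by omega) (by omega) with
          h | h | h <;>
        exact hstep ha h hA (adjNum_rim (by omega)).symm (h1 _ h (adjNum_hub (by omega)))
      · exact h1 _ ha (adjNum_add_two (by omega)).symm
      · rcases hQ 0 1 (2 * n + 2) (by omega) (by omega) (by omega) (by omega) (by omega)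
          (by omega) with h | h | h
        · exact hstep ha h hA (adjNum_add_three (by omega)).symm (h1 _ h (adjNum_hub (by omega)))
        · exact hstep ha h hA (adjNum_add_three (by omega)).symm (h1 _ h (adjNum_hub (by omega)))
        · exact hstep ha h hA (adjNum_add_three (by omega)).symm
            (h1 _ h (adjNum_add_two (by omega)).symm)
      · exact h1 _ ha (adjNum_add_four (by omega)).symm
    · have hQ' : ∀ a b, a < 2 * n → b < 2 * n → a ≠ b → Q a ∨ Q b := by
        intro a b ha hb h
        rcases hQ (2 * n) a b (by omega) (by omega) (by omega) (by omega) (by omega) h with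
          h | h | h
        · exact absurd h hA
        · exact Or.inl h
        · exact Or.inr h
      -- The deleted vertices are pairwise adjacent and the hubs are not, so one hub survives and
      -- can serve as the centre.
      have hB : Q (2 * n + 1) := by
        by_contra hB
        simp only [Q, not_exists, not_not] at hA hB
        have h := (T_adj_iff hn).1 (hadj _ _ (hA (by omega)) (hB (by omega)) (by simp))
        unfold AdjNum RelNum at h
        dsimp only at h
        omega
      refine ⟨2 * n + 1, hB, ?_⟩
      have h1 : ∀ a (ha : Q a), a < 2 * n →
          ((T n).induce {v | ¬ P v}).Reachable ⟨⟨a, ha.1⟩, ha.2⟩ ⟨⟨2 * n + 1, hB.1⟩, hB.2⟩ :=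
        fun a ha h => hstep ha hB hB (adjNum_rim h) (Reachable.refl _)
      intro a ha
      have halt := ha.1
      rcases (by omega : a = 2 * n ∨ a < 2 * n ∨ a = 2 * n + 1 ∨ a = 2 * n + 2 ∨
        a = 2 * n + 3 ∨ a = 2 * n + 4) with rfl | h | rfl | rfl | rfl | rfl
      · exact absurd ha hA
      · exact h1 a ha h
      · exact Reachable.refl _
      · rcases hQ' 0 1 (by omega) (by omega) (by omega) with h | h <;>
        exact hstep ha h hB (adjNum_add_two (by omega)).symm (h1 _ h (by omega))
      · rcases hQ' 0 1 (by omega) (by omega) (by omega) with h | h <;>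
        exact hstep ha h hB (adjNum_add_three (by omega)).symm (h1 _ h (by omega))
      · rcases hQ' 1 2 (by omega) (by omega) (by omega) with h | h <;>
        exact hstep ha h hB (adjNum_add_four (by omega)).symm (h1 _ h (by omega))
  rintro ⟨a, ha⟩ ⟨b, hb⟩
  exact (hreach a ⟨a.2, ha⟩).trans (hreach b ⟨b.2, hb⟩).symm

theorem T_connected {n : ℕ} (hn : 3 < n) : (T n).Connected := by
  have h := T_induce_preconnected hn (fun _ => False) (fun _ _ h => h.elim) (fun _ _ _ h => h.elim)
  have e : (T n).induce {v | ¬ False} ≃g T n := ⟨Equiv.subtypeUnivEquiv (by simp), by simp⟩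
  have : Nonempty (Fin (2 * n + 5)) := ⟨0⟩
  refine ⟨fun u v => ?_⟩
  exact (e.symm.reachable_iff).1 (h _ _)

/-! ### Automorphisms of `T n` -/

/-- The only vertices of degree three are `2 * n + 3` and `2 * n + 4`, and vertex 1 is their only
common neighbour. They cannot be interchanged because the former has the neighbour `2 * n + 2` of
degree four, while the neighbours of the latter all have larger degree. The rest is then forced
vertex by vertex, ending with a run along the cycle. -/
theorem T_automorphism_trivial {n : ℕ} (hn : 3 < n) (φ : T n ≃g T n) (v : Fin (2 * n + 5)) :
    φ v = v := by
  let f : ℕ → ℕ := fun a => if h : a < 2 * n + 5 then φ ⟨a, h⟩ else a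
  have hf : ∀ a (h : a < 2 * n + 5), f a = φ ⟨a, h⟩ := fun a h => dif_pos h
  have hlt : ∀ a, a < 2 * n + 5 → f a < 2 * n + 5 := fun a h => by rw [hf a h]; exact Fin.isLt _
  have hadj : ∀ a b, AdjNum n a b → AdjNum n (f a) (f b) := by
    intro a b h
    rw [hf a h.lt, hf b h.symm.lt, ← T_adj_iff hn, φ.map_adj_iff, T_adj_iff hn]
    exact h
  have hinj : ∀ a b, a < 2 * n + 5 → b < 2 * n + 5 → f a = f b → a = b := by
    intro a b ha hb h
    rw [hf a ha, hf b hb] at h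
    exact congrArg Fin.val (φ.injective (Fin.ext h))
  have hnbr : ∀ a b, a < 2 * n + 5 → AdjNum n (f a) b → ∃ c, AdjNum n a c ∧ f c = b := by
    intro a b ha h
    refine ⟨φ.symm ⟨b, h.symm.lt⟩, ?_, ?_⟩
    · rw [hf a ha] at h
      have h' : (T n).Adj (φ ⟨a, ha⟩) ⟨b, h.symm.lt⟩ := (T_adj_iff hn).2 h
      rw [← φ.apply_symm_apply ⟨b, h.symm.lt⟩, φ.map_adj_iff, T_adj_iff hn] at h'
      exact h'
    · rw [hf _ (Fin.isLt _)]
      simp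
  suffices h : ∀ a, a < 2 * n + 5 → f a = a from Fin.ext ((hf v v.2).symm.trans (h v v.2))
  -- Degree at most three is expressed by three names covering all neighbours, so that `omega` can
  -- refute it from four explicit neighbours.
  have hdeg3 : ∀ a, a < 2 * n + 5 → (∃ x y z, ∀ b, AdjNum n a b → b = x ∨ b = y ∨ b = z) →
      a = 2 * n + 3 ∨ a = 2 * n + 4 := by
    rintro a ha ⟨x, y, z, h⟩
    by_contra hne
    rcases (by omega : a < 2 * n ∨ a = 2 * n ∨ a = 2 * n + 1 ∨ a = 2 * n + 2) with
      h' | rfl | rfl | rfl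
    · have h1 := h _ (adjNum_hub h')
      have h2 := h _ (adjNum_rim h')
      rcases (by omega : a = 0 ∨ a + 1 = 2 * n ∨ (0 < a ∧ a + 1 < 2 * n)) with rfl | h3 | h3
      · have h4 := h _ (adjNum_succ (by omega))
        have h5 := h _ (adjNum_add_two (by omega))
        omega
      · have h4 := h _ (Or.inl (Or.inr (Or.inl ⟨h3, rfl⟩)))
        obtain ⟨i, rfl⟩ : ∃ i, a = i + 1 := ⟨a - 1, by omega⟩
        have h5 := h _ (adjNum_succ h').symm
        omega
      · have h4 := h _ (adjNum_succ h3.2)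
        obtain ⟨i, rfl⟩ : ∃ i, a = i + 1 := ⟨a - 1, by omega⟩
        have h5 := h _ (adjNum_succ h').symm
        omega
    · have h1 := h 0 (adjNum_hub (by omega)).symm
      have h2 := h 1 (adjNum_hub (by omega)).symm
      have h3 := h 2 (adjNum_hub (by omega)).symm
      have h4 := h 3 (adjNum_hub (by omega)).symm
      omega
    · have h1 := h 0 (adjNum_rim (by omega)).symm
      have h2 := h 1 (adjNum_rim (by omega)).symm
      have h3 := h 2 (adjNum_rim (by omega)).symm
      have h4 := h 3 (adjNum_rim (by omega)).symm
      omega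
    · have h1 := h 0 (adjNum_add_two (by omega)).symm
      have h2 := h 1 (adjNum_add_two (by omega)).symm
      have h3 := h (2 * n) (adjNum_add_two (by omega)).symm
      have h4 := h (2 * n + 3) (adjNum_add_three (by omega))
      omega
  have n3 : ∀ b, AdjNum n (2 * n + 3) b → b = 0 ∨ b = 1 ∨ b = 2 * n + 2 := by
    intro b h
    unfold AdjNum RelNum at h
    omega
  have n4 : ∀ b, AdjNum n (2 * n + 4) b → b = 1 ∨ b = 2 ∨ b = 2 * n := by
    intro b h
    unfold AdjNum RelNum at h
    omega
  have n2 : ∀ b, AdjNum n (2 * n + 2) b → b = 0 ∨ b = 1 ∨ b = 2 * n ∨ b = 2 * n + 3 := by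
    intro b h
    unfold AdjNum RelNum at h
    omega
  have f3 : f (2 * n + 3) = 2 * n + 3 ∨ f (2 * n + 3) = 2 * n + 4 := by
    have h : ∀ b, AdjNum n (f (2 * n + 3)) b → b = f 0 ∨ b = f 1 ∨ b = f (2 * n + 2) := by
      intro b hb
      obtain ⟨c, hc, rfl⟩ := hnbr _ b (by omega) hb
      rcases n3 c hc with rfl | rfl | rfl <;> simp
    exact hdeg3 _ (hadj _ _ (adjNum_add_three (i := 0) (by omega))).symm.lt ⟨_, _, _, h⟩
  have f4 : f (2 * n + 4) = 2 * n + 3 ∨ f (2 * n + 4) = 2 * n + 4 := by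
    have h : ∀ b, AdjNum n (f (2 * n + 4)) b → b = f 1 ∨ b = f 2 ∨ b = f (2 * n) := by
      intro b hb
      obtain ⟨c, hc, rfl⟩ := hnbr _ b (by omega) hb
      rcases n4 c hc with rfl | rfl | rfl <;> simp
    exact hdeg3 _ (hadj _ _ (adjNum_add_four (i := 1) (by omega))).symm.lt ⟨_, _, _, h⟩
  have f34 : f (2 * n + 3) ≠ f (2 * n + 4) := fun h => by
    have := hinj _ _ (by omega) (by omega) h
    omega
  have hf1 : f 1 = 1 := by
    have h3 := hadj _ _ (adjNum_add_three (i := 1) (by omega)).symm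
    have h4 := hadj _ _ (adjNum_add_four (i := 1) (by omega)).symm
    rcases f3 with e3 | e3 <;> rcases f4 with e4 | e4 <;> rw [e3] at h3 f34 <;>
      rw [e4] at h4 f34
    · exact absurd rfl f34
    · have := n3 _ h3
      have := n4 _ h4
      omega
    · have := n4 _ h3
      have := n3 _ h4
      omega
    · exact absurd rfl f34
  have hne : ∀ a b, a < 2 * n + 5 → b < 2 * n + 5 → a ≠ b → f a ≠ f b :=
    fun a b ha hb h h' => h (hinj a b ha hb h')
  have h2' : ∀ b, AdjNum n (f (2 * n + 2)) b →
      b = f 0 ∨ b = f 1 ∨ b = f (2 * n) ∨ b = f (2 * n + 3) := by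
    intro b hb
    obtain ⟨c, hc, rfl⟩ := hnbr _ b (by omega) hb
    rcases n2 c hc with rfl | rfl | rfl | rfl <;> simp
  have h21 := hne (2 * n + 2) 1 (by omega) (by omega) (by omega)
  have hadj2 := hadj _ _ (adjNum_add_three (i := 2 * n + 2) (by omega)).symm
  have hf3 : f (2 * n + 3) = 2 * n + 3 := by
    refine f3.resolve_right fun e3 => ?_
    rw [e3] at hadj2
    rcases n4 _ hadj2 with e | e | e
    · exact h21 (e.trans hf1.symm)
    · rw [e] at h2'
      have h1 := h2' _ (adjNum_succ (i := 1) (by omega)).symm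
      have h2 := h2' _ (adjNum_succ (i := 2) (by omega))
      have h3 := h2' _ (adjNum_hub (by omega))
      have h4 := h2' _ (adjNum_rim (by omega))
      have h5 := h2' _ (adjNum_add_four (by omega))
      omega
    · rw [e] at h2'
      have h1 := h2' 0 (adjNum_hub (by omega)).symm
      have h2 := h2' 1 (adjNum_hub (by omega)).symm
      have h3 := h2' 2 (adjNum_hub (by omega)).symm
      have h4 := h2' 3 (adjNum_hub (by omega)).symm
      have h5 := h2' 4 (adjNum_hub (by omega)).symm
      omega
  have hf4 : f (2 * n + 4) = 2 * n + 4 := f4.resolve_left fun h => f34 (hf3.trans h.symm)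
  have hf2 : f (2 * n + 2) = 2 * n + 2 := by
    rw [hf3] at hadj2
    rcases n3 _ hadj2 with e | e | e
    · rw [e] at h2'
      have h1 := h2' _ (adjNum_succ (i := 0) (by omega))
      have h2 := h2' _ (adjNum_hub (by omega))
      have h3 := h2' _ (adjNum_rim (by omega))
      have h4 := h2' _ (adjNum_add_two (by omega))
      have h5 := h2' _ (adjNum_add_three (by omega))
      omega
    · exact absurd (e.trans hf1.symm) h21
    · exact e
  have hf0 : f 0 = 0 := by
    have h := hadj _ _ (adjNum_add_three (i := 0) (by omega)).symm
    rw [hf3] at h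
    have h1 := n3 _ h
    have h2 := hne 0 1 (by omega) (by omega) (by omega)
    have h3 := hne 0 (2 * n + 2) (by omega) (by omega) (by omega)
    omega
  have hfA : f (2 * n) = 2 * n := by
    have h := hadj _ _ (adjNum_add_two (i := 2 * n) (by omega)).symm
    rw [hf2] at h
    have h1 := n2 _ h
    have h2 := hne (2 * n) 1 (by omega) (by omega) (by omega)
    have h3 := hne (2 * n) 0 (by omega) (by omega) (by omega)
    have h4 := hne (2 * n) (2 * n + 3) (by omega) (by omega) (by omega)
    omega
  have hftwo : f 2 = 2 := by
    have h := hadj _ _ (adjNum_add_four (i := 2) (by omega)).symm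
    rw [hf4] at h
    have h1 := n4 _ h
    have h2 := hne 2 1 (by omega) (by omega) (by omega)
    have h3 := hne 2 (2 * n) (by omega) (by omega) (by omega)
    omega
  have hfB : f (2 * n + 1) = 2 * n + 1 := by
    have h := hadj _ _ (adjNum_rim (i := 1) (by omega))
    have h' := hadj _ _ (adjNum_rim (i := 2) (by omega))
    rw [hf1] at h
    rw [hftwo] at h'
    have h2 := hne (2 * n + 1) (2 * n) (by omega) (by omega) (by omega)
    have h3 := hne (2 * n + 1) (2 * n + 4) (by omega) (by omega) (by omega)
    rw [hfA] at h2
    rw [hf4] at h3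
    unfold AdjNum RelNum at h h'
    omega
  -- The image of the next cycle vertex is adjacent to the fixed vertex `2 * n + 1`, hence on the
  -- cycle, and it differs from the previous vertex. Two consecutive fixed vertices therefore fix
  -- the following one.
  have hcyc : ∀ i, i + 1 < 2 * n → f i = i ∧ f (i + 1) = i + 1 := by
    intro i
    induction i with
    | zero => exact fun _ => ⟨hf0, hf1⟩
    | succ i ih =>
      intro hi
      obtain ⟨h1, h2⟩ := ih (by omega)
      refine ⟨h2, ?_⟩
      have h3 := hadj _ _ (adjNum_succ hi)
      have h4 := hadj _ _ (adjNum_rim hi)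
      have h5 := hne (i + 1 + 1) i (by omega) (by omega) (by omega)
      rw [h1] at h5
      rw [h2] at h3
      rw [hfB] at h4
      have h6 : f (i + 1 + 1) < 2 * n := by
        unfold AdjNum RelNum at h4
        omega
      unfold AdjNum RelNum at h3
      omega
  intro a ha
  rcases (by omega : a < 2 * n ∨ a = 2 * n ∨ a = 2 * n + 1 ∨ a = 2 * n + 2 ∨ a = 2 * n + 3 ∨
    a = 2 * n + 4) with h | rfl | rfl | rfl | rfl | rfl
  · rcases a with - | i
    · exact hf0
    · exact (hcyc i h).2
  all_goals assumption

/-! ### Complete bipartite subgraphs of `T n` -/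

/-- The copy of `K_{2,m}` in `T n` spanned by both hubs and `m` vertices of the cycle. -/
def hubCopy {n m : ℕ} (hn : 3 < n) (C : Finset ℕ) (hC : C ⊆ Finset.range (2 * n))
    (hm : C.card = m) : Copy (completeBipartiteGraph (Fin 2) (Fin m)) (T n) :=
  have hlt : ∀ j, C.orderEmbOfFin hm j < 2 * n := fun j =>
    Finset.mem_range.1 (hC (C.orderEmbOfFin_mem hm j))
  { toHom :=
      { toFun := Sum.elim (fun i => ⟨2 * n + i, by omega⟩)
          (fun j => ⟨C.orderEmbOfFin hm j, (hlt j).trans (by omega)⟩)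
        map_rel' := by
          have key : ∀ (i : Fin 2) (j : Fin m), AdjNum n (C.orderEmbOfFin hm j) (2 * n + i) := by
            intro i j
            fin_cases i
            · exact adjNum_hub (hlt j)
            · exact adjNum_rim (hlt j)
          rintro (i | i) (j | j) h
          · simp at h
          · exact (T_adj_iff hn).2 (key i j).symm
          · exact (T_adj_iff hn).2 (key j i)
          · simp at h }
    injective' := by
      rintro (i | i) (j | j) h
      · have h : (⟨2 * n + i, _⟩ : Fin (2 * n + 5)) = ⟨2 * n + j, _⟩ := h
        rw [Fin.mk.injEq] at h
        congr 1
        ext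
        omega
      · have h : (⟨2 * n + i, _⟩ : Fin (2 * n + 5)) = ⟨C.orderEmbOfFin hm j, _⟩ := h
        rw [Fin.mk.injEq] at h
        have := hlt j
        omega
      · have h : (⟨C.orderEmbOfFin hm i, _⟩ : Fin (2 * n + 5)) = ⟨2 * n + j, _⟩ := h
        rw [Fin.mk.injEq] at h
        have := hlt i
        omega
      · have h : (⟨C.orderEmbOfFin hm i, _⟩ : Fin (2 * n + 5)) = ⟨C.orderEmbOfFin hm j, _⟩ := h
        rw [Fin.mk.injEq] at h
        rw [(C.orderEmbOfFin hm).injective h] }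

theorem mem_verts_hubCopy {n m : ℕ} (hn : 3 < n) (C : Finset ℕ) (hC : C ⊆ Finset.range (2 * n))
    (hm : C.card = m) (a : ℕ) (ha : a < 2 * n) :
    (⟨a, by omega⟩ : Fin (2 * n + 5)) ∈ (hubCopy hn C hC hm).toSubgraph.verts ↔ a ∈ C := by
  have h : (⟨a, by omega⟩ : Fin (2 * n + 5)) ∈ (hubCopy hn C hC hm).toSubgraph.verts ↔
      ∃ x, hubCopy hn C hC hm x = ⟨a, by omega⟩ := by
    simp [Copy.toSubgraph]
  rw [h]
  constructor
  · rintro ⟨i | j, h⟩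
    · have h : (⟨2 * n + i, _⟩ : Fin (2 * n + 5)) = ⟨a, _⟩ := h
      rw [Fin.mk.injEq] at h
      omega
    · have h : (⟨C.orderEmbOfFin hm j, _⟩ : Fin (2 * n + 5)) = ⟨a, _⟩ := h
      rw [Fin.mk.injEq] at h
      exact h ▸ C.orderEmbOfFin_mem hm j
  · intro h
    have : a ∈ Set.range (C.orderEmbOfFin hm) := by rwa [Finset.range_orderEmbOfFin]
    obtain ⟨j, rfl⟩ := this
    exact ⟨Sum.inr j, rfl⟩

theorem choose_le_ncard_nonadjacentK2 {n : ℕ} (hn : 3 < n) (m : ℕ) :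
    (2 * n).choose m ≤ (nonadjacentK2 (T n) m).ncard := by
  have hC : ∀ C : (Finset.range (2 * n)).powersetCard m, C.1 ⊆ Finset.range (2 * n) :=
    fun C => (Finset.mem_powersetCard.1 C.2).1
  have hm : ∀ C : (Finset.range (2 * n)).powersetCard m, C.1.card = m :=
    fun C => (Finset.mem_powersetCard.1 C.2).2
  let F : (Finset.range (2 * n)).powersetCard m → (T n).Subgraph := fun C =>
    (hubCopy hn C.1 (hC C) (hm C)).toSubgraph
  -- `C` is recovered as the set of cycle vertices of the subgraph.
  have hF : Function.Injective F := by
    intro C D h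
    apply Subtype.ext
    ext a
    by_cases ha : a < 2 * n
    · rw [← mem_verts_hubCopy hn C.1 (hC C) (hm C) a ha,
        ← mem_verts_hubCopy hn D.1 (hC D) (hm D) a ha]
      exact iff_of_eq (congrArg (fun H : (T n).Subgraph => _ ∈ H.verts) h)
    · exact ⟨fun h => absurd (Finset.mem_range.1 (hC C h)) ha,
        fun h => absurd (Finset.mem_range.1 (hC D h)) ha⟩
  have hcard : (Set.range F).ncard = (2 * n).choose m := by
    rw [← Set.image_univ, Set.ncard_image_of_injective _ hF, Set.ncard_univ,
      Nat.card_eq_finsetCard, Finset.card_powersetCard, Finset.card_range]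
  rw [← hcard]
  refine Set.ncard_le_ncard ?_ (Set.toFinite _)
  rintro _ ⟨C, rfl⟩
  refine ⟨(hubCopy hn C.1 (hC C) (hm C)).isoToSubgraph, ?_⟩
  change ¬ (T n).Adj ⟨2 * n + 0, _⟩ ⟨2 * n + 1, _⟩
  rw [T_adj_iff hn]
  unfold AdjNum RelNum
  dsimp only
  omega

end StrongEmb

namespace StrongEmb

open SimpleGraph

/-! ### Sectors of the cycle -/

/-- The number of elements of `C` up to `i`. -/
def prefixCount (C : Finset ℕ) (i : ℕ) : ℕ := Nat.count (· ∈ C) (i + 1)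

theorem prefixCount_zero (C : Finset ℕ) : prefixCount C 0 = if 0 ∈ C then 1 else 0 := by
  rw [prefixCount, Nat.count_succ]
  simp

theorem prefixCount_succ (C : Finset ℕ) (i : ℕ) :
    prefixCount C (i + 1) = prefixCount C i + if i + 1 ∈ C then 1 else 0 := by
  rw [prefixCount, Nat.count_succ, prefixCount]

theorem prefixCount_mono (C : Finset ℕ) : Monotone (prefixCount C) := fun _ _ h =>
  Nat.count_monotone _ (Nat.succ_le_succ h)

theorem prefixCount_last {n : ℕ} (hn : 3 < n) {C : Finset ℕ} (hC : C ⊆ Finset.range (2 * n)) :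
    prefixCount C (2 * n - 1) = C.card := by
  rw [prefixCount, Nat.count_eq_card_filter_range, show 2 * n - 1 + 1 = 2 * n by omega,
    Finset.filter_mem_eq_inter, Finset.inter_eq_right.2 hC]

/-- The count grows by steps of at most one, and it takes a new positive value exactly at an element
of `C`. -/
theorem exists_mem_prefixCount_eq {C : Finset ℕ} {k i : ℕ} (h : 0 < k)
    (hk : k ≤ prefixCount C i) : ∃ c ∈ C, prefixCount C c = k := by
  induction i with
  | zero =>
    rw [prefixCount_zero] at hk
    split_ifs at hk with h0
    · exact ⟨0, h0, by rw [prefixCount_zero, if_pos h0]; omega⟩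
    · omega
  | succ i ih =>
    by_cases h' : k ≤ prefixCount C i
    · exact ih h'
    · rw [prefixCount_succ] at hk
      split_ifs at hk with h0
      · exact ⟨i + 1, h0, by rw [prefixCount_succ, if_pos h0]; omega⟩
      · omega

/-- The sector of the gap after `i`, when the cycle is cut at the elements of `C`. -/
def sector (C : Finset ℕ) (i : ℕ) : ZMod C.card := prefixCount C i

/-- Passing an element of `C` raises the sector by one. This persists across the end of the cycle
because the full count `C.card` vanishes in `ZMod C.card`. -/
theorem sector_cycPred {n : ℕ} (hn : 3 < n) {C : Finset ℕ} (hC : C ⊆ Finset.range (2 * n))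
    (i : ℕ) : sector C i = sector C (cycPred n i) + if i ∈ C then 1 else 0 := by
  unfold sector cycPred
  rcases i with - | i
  · rw [if_pos rfl, prefixCount_last hn hC, prefixCount_zero, ZMod.natCast_self]
    split_ifs <;> simp
  · rw [if_neg (by omega), Nat.add_sub_cancel, prefixCount_succ]
    split_ifs <;> simp

theorem exists_mem_sector_eq {n : ℕ} (hn : 3 < n) {C : Finset ℕ}
    (hC : C ⊆ Finset.range (2 * n)) (h0 : 0 < C.card) (k : ZMod C.card) :
    ∃ c ∈ C, sector C c = k := by
  have : NeZero C.card := ⟨h0.ne'⟩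
  -- This is the representative of `k` between 1 and `C.card`, since the lemma needs a positive
  -- count.
  obtain ⟨c, hc, h⟩ := exists_mem_prefixCount_eq (C := C) (k := (k - 1).val + 1)
    (i := 2 * n - 1) (by omega) (by
      rw [prefixCount_last hn hC]
      exact ZMod.val_lt _)
  refine ⟨c, hc, ?_⟩
  rw [sector, h]
  simp

/-- A function that changes only at elements of `C` factors through the sector. -/
theorem eq_of_sector_eq {n : ℕ} (hn : 3 < n) {C : Finset ℕ} (hC : C ⊆ Finset.range (2 * n))
    {Y : Type*} {f : ℕ → Y} (hf : ∀ i < 2 * n, i ∉ C → f i = f (cycPred n i)) {i j : ℕ}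
    (hi : i < 2 * n) (hj : j < 2 * n) (h : sector C i = sector C j) : f i = f j := by
  have h1 : ∀ i j, i ≤ j → j < 2 * n → prefixCount C i = prefixCount C j → f i = f j := by
    intro i j hij
    induction j, hij using Nat.le_induction with
    | base => exact fun _ _ => rfl
    | succ j hij ih =>
      intro hj h
      have h2 := prefixCount_mono C hij
      have h3 := prefixCount_succ C j
      split_ifs at h3 with h4
      · omega
      · rw [ih (by omega) (by omega), hf _ hj h4, cycPred, if_neg (by omega),
          Nat.add_sub_cancel]
  -- One sector may wrap around the end of the cycle. It consists of the gaps with count 0 and those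
  -- with the full count, and these are joined through vertex 0, which is not in `C` then.
  have h2 : ∀ i j, i < 2 * n → j < 2 * n → prefixCount C i = 0 → prefixCount C j = C.card →
      f i = f j := by
    intro i j hi hj h0 hm
    have h3 : prefixCount C 0 = 0 := by
      have := prefixCount_mono C (Nat.zero_le i)
      omega
    have h4 : 0 ∉ C := by
      intro h4
      rw [prefixCount_zero, if_pos h4] at h3
      omega
    rw [← h1 0 i (Nat.zero_le _) hi (h3.trans h0.symm), hf 0 (by omega) h4, cycPred, if_pos rfl]
    exact (h1 _ _ (by omega) (by omega) (by rw [prefixCount_last hn hC, hm])).symm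
  have h3 : ∀ i j, i < 2 * n → j < 2 * n → prefixCount C i ≤ prefixCount C j →
      sector C i = sector C j → f i = f j := by
    intro i j hi hj hle h
    rw [sector, sector, ZMod.natCast_eq_natCast_iff] at h
    have hjm : prefixCount C j ≤ C.card := by
      rw [← prefixCount_last hn hC]
      exact prefixCount_mono C (by omega)
    have hdvd := (Nat.modEq_iff_dvd' hle).1 h
    rcases Nat.eq_zero_or_pos (prefixCount C j - prefixCount C i) with h0 | h0
    · rcases le_total i j with hij | hij
      · exact h1 i j hij hj (by omega)
      · exact (h1 j i hij hi (by omega)).symm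
    · have := Nat.le_of_dvd h0 hdvd
      exact h2 i j hi hj (by omega) (by omega)
  rcases le_total (prefixCount C i) (prefixCount C j) with hle | hle
  · exact h3 i j hi hj hle h
  · exact (h3 j i hj hi hle h.symm).symm

/-! ### Gaps -/

theorem gapNum_hub {n i : ℕ} (h : i < 2 * n) : gapNum n (2 * n) i = i := by
  unfold gapNum
  repeat' first | rw [if_pos (by omega)] | rw [if_neg (by omega)]

theorem gapNum_to_hub {n i : ℕ} (h : i < 2 * n) : gapNum n i (2 * n) = cycPred n i := by
  unfold gapNum
  repeat' first | rw [if_pos (by omega)] | rw [if_neg (by omega)]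

theorem gapNum_rim {n i : ℕ} (h : i < 2 * n) : gapNum n (2 * n + 1) i = cycPred n i := by
  unfold gapNum
  repeat' first | rw [if_pos (by omega)] | rw [if_neg (by omega)]

theorem gapNum_to_rim {n i : ℕ} (h : i < 2 * n) : gapNum n i (2 * n + 1) = i := by
  unfold gapNum
  repeat' first | rw [if_pos (by omega)] | rw [if_neg (by omega)]

/-- Only the edges between a hub and the cycle separate different gaps. Both sides of any other edge
lie in the same gap. -/
theorem RelNum.gapNum_comm {n a b : ℕ} (hn : 3 < n) (h : RelNum n a b)
    (hs : ¬ (a < 2 * n ∧ (b = 2 * n ∨ b = 2 * n + 1))) : gapNum n a b = gapNum n b a := by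
  rcases h with ⟨rfl, h⟩ | ⟨h, rfl⟩ | h | ⟨h | h | h, rfl⟩ | ⟨h | h | h, rfl⟩ | ⟨h | h | h, rfl⟩
  pick_goal 3
  · exact absurd h hs
  all_goals
    unfold gapNum
    repeat' first | rw [if_pos (by omega)] | rw [if_neg (by omega)]

theorem AdjNum.gapNum_comm {n a b : ℕ} (hn : 3 < n) (h : AdjNum n a b)
    (hs : ¬ (a < 2 * n ∧ (b = 2 * n ∨ b = 2 * n + 1)))
    (hs' : ¬ (b < 2 * n ∧ (a = 2 * n ∨ a = 2 * n + 1))) : gapNum n a b = gapNum n b a := by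
  rcases h with h | h
  · exact h.gapNum_comm hn hs
  · exact (h.gapNum_comm hn hs').symm

theorem NumTri.gap_eq_or {n a b c g : ℕ} (hn : 3 < n) (h : NumTri n a b c g) (ha : a < 2 * n) :
    g = a ∨ g = cycPred n a := by
  unfold NumTri BaseTri at h
  unfold cycPred
  rcases h with h | h | h <;>
    rcases h with h | h | h | h | h | h | h | h | h | h | h | h <;>
    obtain ⟨h1, h2, h3, h4⟩ := h <;>
    first | (left; omega) | (right; rw [if_pos (by omega)]; omega) |
      (right; rw [if_neg (by omega)]; omega)

theorem cycPred_lt {n i : ℕ} (hn : 3 < n) (h : i < 2 * n) : cycPred n i < 2 * n := by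
  unfold cycPred
  split_ifs <;> omega

theorem cycPred_ne {n i : ℕ} (hn : 3 < n) : cycPred n i ≠ i := by
  unfold cycPred
  split_ifs <;> omega

theorem cycPred_inj {n i j : ℕ} (hi : i < 2 * n) (hj : j < 2 * n) (h : cycPred n i = cycPred n j) :
    i = j := by
  unfold cycPred at h
  split_ifs at h <;> omega

/-- The gap of the triangle to the left of a dart. -/
def gap {n : ℕ} (d : (T n).Dart) : ℕ := gapNum n d.fst d.snd

theorem dart_adjNum {n : ℕ} (hn : 3 < n) (d : (T n).Dart) : AdjNum n d.fst d.snd :=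
  (T_adj_iff hn).1 d.adj

theorem dart_numTri {n : ℕ} (hn : 3 < n) (d : (T n).Dart) :
    NumTri n d.fst d.snd ((triangulation hn).third d.fst d.snd) (gap d) := by
  change NumTri n d.fst d.snd (thirdVertex n d.fst d.snd) (gap d)
  rw [thirdVertex_val hn (dart_adjNum hn d)]
  exact (dart_adjNum hn d).numTri hn

theorem gap_turn {n : ℕ} (hn : 3 < n) (d : (T n).Dart) :
    gap ((triangulation hn).turn d) = gap d := (dart_numTri hn d).rotate.gap hn

theorem gap_rot {n : ℕ} (hn : 3 < n) (d : (T n).Dart) :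
    gap ((triangulation hn).rot d) = gap d.symm := gap_turn hn _

/-! ### Twisting along a complete bipartite subgraph -/

/-- The vertex with number `a` is a hub or belongs to `C`. -/
def IsSpecial (n : ℕ) (C : Finset ℕ) (a : ℕ) : Prop := a = 2 * n ∨ a = 2 * n + 1 ∨ a ∈ C

/-- The edges that join the two hubs to the elements of `C`. -/
def spokes (n : ℕ) (C : Finset ℕ) : Set (Sym2 (Fin (2 * n + 5))) :=
  {e | ∃ a b : Fin (2 * n + 5), e = s(a, b) ∧ a.val ∈ C ∧ (b.val = 2 * n ∨ b.val = 2 * n + 1)}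

theorem edge_mem_spokes_iff {n : ℕ} {C : Finset ℕ} {d : (T n).Dart} : d.edge ∈ spokes n C ↔
    d.fst.val ∈ C ∧ (d.snd.val = 2 * n ∨ d.snd.val = 2 * n + 1) ∨
      d.snd.val ∈ C ∧ (d.fst.val = 2 * n ∨ d.fst.val = 2 * n + 1) := by
  constructor
  · rintro ⟨a, b, h, ha, hb⟩
    rcases Sym2.eq_iff.1 (show s(d.fst, d.snd) = s(a, b) from h) with ⟨rfl, rfl⟩ | ⟨rfl, rfl⟩
    · exact Or.inl ⟨ha, hb⟩
    · exact Or.inr ⟨ha, hb⟩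
  · rintro (⟨h, h'⟩ | ⟨h, h'⟩)
    · exact ⟨d.fst, d.snd, rfl, h, h'⟩
    · exact ⟨d.snd, d.fst, Sym2.eq_swap, h, h'⟩

/-- The sector met at a corner in the gap `g` of the hub or element of `C` with number `a`. -/
def cornerSector (n : ℕ) (C : Finset ℕ) (a g : ℕ) : ZMod C.card :=
  if a < 2 * n then if g = a then sector C g - 1 else sector C g + 1 else sector C g

open Classical in
/-- The label of a corner for the embedding twisted along `spokes n C`. -/
noncomputable def cornerLabel {n : ℕ} (C : Finset ℕ) (d : (T n).Dart) :
    {v : Fin (2 * n + 5) // ¬ IsSpecial n C v} ⊕ ZMod C.card :=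
  if h : IsSpecial n C d.fst then Sum.inr (cornerSector n C d.fst (gap d)) else Sum.inl ⟨d.fst, h⟩

section

variable {n : ℕ} (hn : 3 < n) {C : Finset ℕ} (hC : C ⊆ Finset.range (2 * n))

theorem cornerLabel_of_special {d : (T n).Dart} (h : IsSpecial n C d.fst) :
    cornerLabel C d = Sum.inr (cornerSector n C d.fst (gap d)) := dif_pos h

theorem cornerLabel_of_not_special {d : (T n).Dart} (h : ¬ IsSpecial n C d.fst) :
    cornerLabel C d = Sum.inl ⟨d.fst, h⟩ := dif_neg h

theorem cornerSector_hub (g : ℕ) : cornerSector n C (2 * n) g = sector C g := if_neg (by omega)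

theorem cornerSector_rim (g : ℕ) : cornerSector n C (2 * n + 1) g = sector C g :=
  if_neg (by omega)

include hC in
theorem lt_of_mem {c : ℕ} (hc : c ∈ C) : c < 2 * n := Finset.mem_range.1 (hC hc)

include hn hC

/-- The shift by one in `cornerSector` gives a corner at `c` the sector on the opposite side of `c`,
here and in `cornerSector_cycPred`. This is the diagonal gluing across a twisted spoke. -/
theorem cornerSector_self {c : ℕ} (hc : c ∈ C) :
    cornerSector n C c c = sector C (cycPred n c) := by
  rw [cornerSector, if_pos (lt_of_mem hC hc), if_pos rfl, sector_cycPred hn hC, if_pos hc]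
  ring

theorem cornerSector_cycPred {c : ℕ} (hc : c ∈ C) :
    cornerSector n C c (cycPred n c) = sector C c := by
  rw [cornerSector, if_pos (lt_of_mem hC hc), if_neg (cycPred_ne hn), sector_cycPred hn hC c,
    if_pos hc]

/-- Across an untwisted edge neither the vertex nor the sector changes. Across a twisted spoke, a
corner at the hub on one side and the corner at the element of `C` on the other side have the same
sector; `key` states this for both diagonals. -/
theorem cornerLabel_isCornerLabel :
    (triangulation hn).CornerLabel (spokes n C) (cornerLabel (n := n) C) := by
  have key : ∀ d : (T n).Dart, d.snd.val ∈ C → (d.fst.val = 2 * n ∨ d.fst.val = 2 * n + 1) →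
      cornerSector n C d.snd (gap d.symm) = cornerSector n C d.fst (gap d) ∧
      cornerSector n C d.fst (gap d.symm) = cornerSector n C d.snd (gap d) := by
    intro d hc h
    change cornerSector n C d.snd (gapNum n d.snd d.fst) =
      cornerSector n C d.fst (gapNum n d.fst d.snd) ∧
      cornerSector n C d.fst (gapNum n d.snd d.fst) =
      cornerSector n C d.snd (gapNum n d.fst d.snd)
    have hlt := lt_of_mem hC hc
    rcases h with h | h <;> rw [h]
    · rw [gapNum_hub hlt, gapNum_to_hub hlt, cornerSector_self hn hC hc,
        cornerSector_cycPred hn hC hc, cornerSector_hub, cornerSector_hub]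
      exact ⟨rfl, rfl⟩
    · rw [gapNum_rim hlt, gapNum_to_rim hlt, cornerSector_self hn hC hc,
        cornerSector_cycPred hn hC hc, cornerSector_rim, cornerSector_rim]
      exact ⟨rfl, rfl⟩
  have hhub : ∀ a : ℕ, (a = 2 * n ∨ a = 2 * n + 1) → IsSpecial n C a := fun a h => by
    rcases h with h | h
    · exact Or.inl h
    · exact Or.inr (Or.inl h)
  refine ⟨?_, ?_, ?_⟩
  · intro d hd
    by_cases hs : IsSpecial n C d.fst
    · rw [cornerLabel_of_special (d := (triangulation hn).rot d) hs, cornerLabel_of_special hs,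
        gap_rot]
      congr 1
      change cornerSector n C d.fst _ = _
      rw [edge_mem_spokes_iff] at hd
      push Not at hd
      have hadj := dart_adjNum hn d
      by_cases hsp : d.snd.val < 2 * n ∧ (d.fst.val = 2 * n ∨ d.fst.val = 2 * n + 1)
      · obtain ⟨hlt, h⟩ := hsp
        have hsec := sector_cycPred hn hC d.snd
        rw [if_neg (fun hc => by have := hd.2 hc; omega), add_zero] at hsec
        change cornerSector n C d.fst (gapNum n d.snd d.fst) =
          cornerSector n C d.fst (gapNum n d.fst d.snd)
        rcases h with h | h <;> rw [h]
        · rw [gapNum_hub hlt, gapNum_to_hub hlt, cornerSector_hub, cornerSector_hub, hsec]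
        · rw [gapNum_rim hlt, gapNum_to_rim hlt, cornerSector_rim, cornerSector_rim, hsec]
      · congr 1
        refine (hadj.gapNum_comm hn ?_ hsp).symm
        rintro ⟨h1, h2⟩
        rcases hs with h | h | h
        · omega
        · omega
        · have := hd.1 h
          omega
    · rw [cornerLabel_of_not_special (d := (triangulation hn).rot d) hs,
        cornerLabel_of_not_special hs]
      rfl
  · intro d hd
    rcases edge_mem_spokes_iff.1 hd with ⟨h, h'⟩ | ⟨h, h'⟩
    · have := (key d.symm h h').1
      rw [Dart.symm_symm] at this
      rw [cornerLabel_of_special (hhub _ h' : IsSpecial n C d.symm.fst),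
        cornerLabel_of_special (Or.inr (Or.inr h))]
      exact congrArg Sum.inr this.symm
    · rw [cornerLabel_of_special (Or.inr (Or.inr h) : IsSpecial n C d.symm.fst),
        cornerLabel_of_special (hhub _ h')]
      exact congrArg Sum.inr (key d h h').1
  · intro d hd
    have h1 : IsSpecial n C d.fst ∧ IsSpecial n C d.snd := by
      rcases edge_mem_spokes_iff.1 hd with ⟨h, h'⟩ | ⟨h, h'⟩
      · exact ⟨Or.inr (Or.inr h), hhub _ h'⟩
      · exact ⟨hhub _ h', Or.inr (Or.inr h)⟩
    rw [cornerLabel_of_special (d := (triangulation hn).turn d.symm) h1.1,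
      cornerLabel_of_special (d := (triangulation hn).turn d) h1.2, gap_turn,
      gap_turn]
    rcases edge_mem_spokes_iff.1 hd with ⟨h, h'⟩ | ⟨h, h'⟩
    · have := (key d.symm h h').2
      rw [Dart.symm_symm] at this
      exact congrArg Sum.inr this.symm
    · exact congrArg Sum.inr (key d h h').2

/-- In a triangle in sector `k`, a hub has the label `k`, and two elements of `C`, lying on the two
sides of the gap, have `k - 1` and `k + 1`. So what is needed is that 1 and 2 are not zero modulo
`C.card`. -/
theorem cornerLabel_turn_ne (hcard : 3 ≤ C.card) (d : (T n).Dart) :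
    cornerLabel C ((triangulation hn).turn d) ≠ cornerLabel C d := by
  have hone : (1 : ZMod C.card) ≠ 0 := by
    have : Fact (1 < C.card) := ⟨by omega⟩
    exact one_ne_zero
  have htwo : (1 + 1 : ZMod C.card) ≠ 0 := by
    intro h
    have h : ((2 : ℕ) : ZMod C.card) = 0 := by
      rw [← h]
      norm_num
    rw [ZMod.natCast_eq_zero_iff] at h
    have := Nat.le_of_dvd (by norm_num) h
    omega
  have hadj := dart_adjNum hn d
  have hnum := dart_numTri hn d
  by_cases hs : IsSpecial n C d.fst <;> by_cases hs' : IsSpecial n C d.snd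
  · rw [cornerLabel_of_special hs,
      cornerLabel_of_special (hs' : IsSpecial n C ((triangulation hn).turn d).fst), gap_turn]
    intro h
    have h : cornerSector n C d.snd (gap d) = cornerSector n C d.fst (gap d) := Sum.inr.inj h
    have hne : d.fst.val ≠ d.snd.val := fun h => d.fst_ne_snd (Fin.ext h)
    unfold cornerSector at h
    split_ifs at h with h1 h2 h3 h4
    · omega
    · apply htwo
      linear_combination -h
    · apply hone
      linear_combination -h
    · apply htwo
      linear_combination h
    -- Both ends would be the later end of the same gap, contradicting injectivity of `cycPred`.
    · have hlt : d.fst.val < 2 * n := by assumption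
      have g1 := (hnum.gap_eq_or hn hlt).resolve_left (by assumption)
      have g2 := (hnum.rotate.gap_eq_or hn h1).resolve_left h2
      exact hne (cycPred_inj hlt h1 (g1.symm.trans g2))
    · apply hone
      linear_combination h
    · apply hone
      linear_combination h
    · apply hone
      linear_combination -h
    · have e1 : d.fst.val = 2 * n ∨ d.fst.val = 2 * n + 1 := by
        rcases hs with h | h | h
        · exact Or.inl h
        · exact Or.inr h
        · have := lt_of_mem hC h
          omega
      have e2 : d.snd.val = 2 * n ∨ d.snd.val = 2 * n + 1 := by
        rcases hs' with h | h | h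
        · exact Or.inl h
        · exact Or.inr h
        · have := lt_of_mem hC h
          omega
      unfold AdjNum RelNum at hadj
      omega
  · rw [cornerLabel_of_special hs,
      cornerLabel_of_not_special (hs' : ¬ IsSpecial n C ((triangulation hn).turn d).fst)]
    exact Sum.inl_ne_inr
  · rw [cornerLabel_of_not_special hs,
      cornerLabel_of_special (hs' : IsSpecial n C ((triangulation hn).turn d).fst)]
    exact Sum.inr_ne_inl
  · rw [cornerLabel_of_not_special hs,
      cornerLabel_of_not_special (hs' : ¬ IsSpecial n C ((triangulation hn).turn d).fst)]
    intro h
    have h := congrArg Subtype.val (Sum.inl.inj h)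
    exact d.snd_ne_fst h

end

end StrongEmb

/-! ### Completeness of the corner labels and the Euler characteristic. -/

namespace StrongEmb

open SimpleGraph

theorem cycSucc_cycPred {n i : ℕ} (h : i < 2 * n) :
    cycSucc n (cycPred n i) = i := by
  unfold cycSucc cycPred
  split_ifs <;> omega

theorem numTri_rim {n i : ℕ} (h : i < 2 * n) :
    NumTri n i (2 * n + 1) (cycSucc n i) i := by
  unfold cycSucc
  split_ifs with h'
  · exact (baseTri_rim_last h').three
  · exact (baseTri_rim (by omega)).three

theorem dart_ext {n : ℕ} {d e : (T n).Dart} (h : d.fst.val = e.fst.val)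
    (h' : d.snd.val = e.snd.val) : d = e := Dart.ext _ _ (Prod.ext (Fin.ext h) (Fin.ext h'))

/-- The dart of `T n` with the given numbers of its ends. -/
def numDart {n a b : ℕ} (hn : 3 < n) (h : AdjNum n a b) : (T n).Dart :=
  ⟨(⟨a, h.lt⟩, ⟨b, h.symm.lt⟩), (T_adj_iff hn).2 h⟩

theorem turn_numDart {n a b c g : ℕ} (hn : 3 < n) (h : NumTri n a b c g) :
    (triangulation hn).turn (numDart hn (h.adj hn)) = numDart hn (h.rotate.adj hn) := by
  refine dart_ext rfl ?_
  change (thirdVertex n ⟨a, _⟩ ⟨b, _⟩).val = c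
  rw [thirdVertex_val hn (h.adj hn)]
  exact h.third hn

section

variable {n : ℕ} (hn : 3 < n) (C : Finset ℕ)

open Classical in
/-- The face at the corner of a dart, in terms of the numbers of its ends. -/
noncomputable def faceNum (a b : ℕ) : Option ((triangulation hn).twist (spokes n C)).Face :=
  if h : AdjNum n a b then some ((triangulation hn).cornerFace (spokes n C) (numDart hn h)) else none

theorem faceNum_of_adj {a b : ℕ} (h : AdjNum n a b) : faceNum hn C a b =
    some ((triangulation hn).cornerFace (spokes n C) (numDart hn h)) := dif_pos h

theorem faceNum_dart (d : (T n).Dart) : faceNum hn C d.fst d.snd =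
    some ((triangulation hn).cornerFace (spokes n C) d) := dif_pos (dart_adjNum hn d)

variable {C}

theorem faceNum_rot {a b c g : ℕ} (h : NumTri n b a c g)
    (h1 : ¬ (a ∈ C ∧ (b = 2 * n ∨ b = 2 * n + 1))) (h2 : ¬ (b ∈ C ∧ (a = 2 * n ∨ a = 2 * n + 1))) :
    faceNum hn C a c = faceNum hn C a b := by
  rw [faceNum_of_adj hn C (h.rotate.adj hn), faceNum_of_adj hn C (h.adj hn).symm, ← turn_numDart hn h]
  congr 1
  refine Triangulation.cornerFace_rot (triangulation hn) (d := numDart hn (h.adj hn).symm) ?_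
  rw [edge_mem_spokes_iff]
  exact not_or.2 ⟨h1, h2⟩

theorem faceNum_symm {a c : ℕ} (hadj : AdjNum n c a) (hc : c ∈ C)
    (ha : a = 2 * n ∨ a = 2 * n + 1) : faceNum hn C c a = faceNum hn C a c := by
  rw [faceNum_of_adj hn C hadj, faceNum_of_adj hn C hadj.symm]
  congr 1
  refine Triangulation.cornerFace_symm (triangulation hn) (d := numDart hn hadj.symm) ?_
  rw [edge_mem_spokes_iff]
  exact Or.inr ⟨hc, ha⟩

theorem faceNum_turn {a c x y g g' : ℕ} (h : NumTri n c a x g) (h' : NumTri n a c y g')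
    (hc : c ∈ C) (ha : a = 2 * n ∨ a = 2 * n + 1) : faceNum hn C a x = faceNum hn C c y := by
  rw [faceNum_of_adj hn C (h.rotate.adj hn), faceNum_of_adj hn C (h'.rotate.adj hn),
    ← turn_numDart hn h, ← turn_numDart hn h']
  congr 1
  refine Triangulation.cornerFace_turn_symm (triangulation hn) (d := numDart hn (h'.adj hn)) ?_
  rw [edge_mem_spokes_iff]
  exact Or.inr ⟨hc, ha⟩

variable (hC : C ⊆ Finset.range (2 * n))

include hC

/-- All corners of the first hub in one gap lie in one face. Only the gaps 0 and 1 contain two such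
corners; they are separated by the untwisted edge to vertex `2 * n + 2` or `2 * n + 4`. -/
theorem faceNum_hub_cycPred {i : ℕ} (hi : i < 2 * n) :
    faceNum hn C (2 * n) (cycPred n i) = faceNum hn C (2 * n) (thirdNum n i (2 * n)) := by
  unfold cycPred
  rcases (by omega : i = 0 ∨ i = 1 ∨ i = 2 ∨ 3 ≤ i) with rfl | rfl | rfl | h
  · rw [if_pos rfl, (baseTri_hub_last (by omega : 2 * n - 1 + 1 = 2 * n)).three.third hn]
  · rw [if_neg (by omega), baseTri_one_hub.one.third hn]
    refine faceNum_rot hn baseTri_hub_zero.three ?_ ?_ <;> rintro ⟨h, -⟩ <;>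
      have := lt_of_mem hC h <;> omega
  · rw [if_neg (by omega), baseTri_two_hub.one.third hn]
    refine faceNum_rot hn baseTri_hub_one.three ?_ ?_ <;> rintro ⟨h, -⟩ <;>
      have := lt_of_mem hC h <;> omega
  · obtain ⟨j, rfl⟩ : ∃ j, i = j + 1 := ⟨i - 1, by omega⟩
    rw [if_neg (by omega), (baseTri_hub (by omega) hi).three.third hn]
    rfl

theorem faceNum_hub_eq_cycPred {i : ℕ} (hi : i < 2 * n) (h : i ∉ C) :
    faceNum hn C (2 * n) i = faceNum hn C (2 * n) (cycPred n i) := by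
  rw [faceNum_hub_cycPred hn hC hi]
  refine (faceNum_rot hn ((adjNum_hub hi).numTri hn) ?_ (fun h' => h h'.1)).symm
  rintro ⟨h, -⟩
  have := lt_of_mem hC h
  omega

/-- The second hub sees the cycle with opposite orientation. Hence its corner in gap `i` belongs to
the dart towards `cycSucc n i`. -/
theorem faceNum_rim_eq_cycPred {i : ℕ} (hi : i < 2 * n) (h : i ∉ C) :
    faceNum hn C (2 * n + 1) (cycSucc n i) =
      faceNum hn C (2 * n + 1) (cycSucc n (cycPred n i)) := by
  rw [cycSucc_cycPred hi]
  refine faceNum_rot hn (numTri_rim hi) ?_ (fun h' => h h'.1)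
  rintro ⟨h, -⟩
  have := lt_of_mem hC h
  omega

omit hC in
/-- The corners at a vertex of the cycle fall into the two gaps next to it. -/
theorem faceNum_cycle {c b : ℕ} (hc : c < 2 * n) (hb : AdjNum n c b) :
    faceNum hn C c b = faceNum hn C c (2 * n) ∧ gapNum n c b = cycPred n c ∨
      faceNum hn C c b = faceNum hn C c (2 * n + 1) ∧ gapNum n c b = c := by
  have key : ∀ k : ℕ, ∀ d : (T n).Dart, d.fst.val = c →
      (((triangulation hn).rot ^ k) d).snd.val = 2 * n →
      faceNum hn C c d.snd = faceNum hn C c (2 * n) ∧ gapNum n c d.snd = cycPred n c ∨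
      faceNum hn C c d.snd = faceNum hn C c (2 * n + 1) ∧ gapNum n c d.snd = c := by
    intro k
    induction k with
    | zero =>
      intro d hd h
      have h : d.snd.val = 2 * n := h
      rw [h]
      exact Or.inl ⟨rfl, gapNum_to_hub hc⟩
    | succ k ih =>
      intro d hd h
      by_cases h1 : d.snd.val = 2 * n
      · rw [h1]
        exact Or.inl ⟨rfl, gapNum_to_hub hc⟩
      by_cases h2 : d.snd.val = 2 * n + 1
      · rw [h2]
        exact Or.inr ⟨rfl, gapNum_to_rim hc⟩
      have h3 : faceNum hn C c ((triangulation hn).rot d).snd = faceNum hn C c d.snd := by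
        have h4 := Triangulation.cornerFace_rot (triangulation hn) (H := spokes n C) (d := d) (by
          rw [edge_mem_spokes_iff]
          omega)
        have h5 := faceNum_dart hn C d
        have h6 := faceNum_dart hn C ((triangulation hn).rot d)
        rw [h4, ← h5, hd] at h6
        rw [← h6, ← hd]
        rfl
      have h4 : gapNum n c ((triangulation hn).rot d).snd = gapNum n c d.snd := by
        have h5 := gap_rot hn d
        rw [gap, gap] at h5
        rw [← hd, (dart_adjNum hn d).gapNum_comm hn (by omega) (by omega)]
        exact h5
      have := ih ((triangulation hn).rot d) hd (by rwa [pow_succ, Equiv.Perm.mul_apply] at h)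
      rwa [h3, h4] at this
  obtain ⟨k, hk⟩ : ∃ k : ℕ, ((triangulation hn).rot ^ k) (numDart hn hb) =
      numDart hn (adjNum_hub hc) := by
    have := Triangulation.finite_dart (T := T n)
    obtain ⟨k, -, hk⟩ := (((triangulation hn).rot_sameCycle (numDart hn hb)
      (numDart hn (adjNum_hub hc)) rfl)).exists_pow_eq'
    exact ⟨k, hk⟩
  refine key k (numDart hn hb) rfl ?_
  rw [hk]
  rfl

/-- The twisted spokes at `c` glue the corners of both hubs in the gap after `c` to corners of `c`
before it, and those lie in a common face. -/
theorem faceNum_hub_eq_rim_of_mem {c : ℕ} (h : c ∈ C) :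
    faceNum hn C (2 * n) c = faceNum hn C (2 * n + 1) (cycSucc n c) := by
  have hc := lt_of_mem hC h
  have h1 := faceNum_turn hn ((adjNum_rim hc).numTri hn)
    ((adjNum_rim hc).symm.numTri hn) h (Or.inr rfl)
  rw [(numTri_rim hc).third hn] at h1
  rw [h1, ← faceNum_symm hn (adjNum_hub hc) h (Or.inl rfl)]
  have h2 := ((adjNum_rim hc).symm.numTri hn).rotate
  have h3 := h2.gap hn
  rw [gapNum_rim hc] at h3
  rcases faceNum_cycle hn hc (h2.adj hn) with h4 | h4
  · exact h4.1.symm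
  · exact absurd (h3.symm.trans h4.2) (cycPred_ne hn)

theorem faceNum_hub_eq_rim {i : ℕ} (hi : i < 2 * n) (h0 : 0 < C.card) :
    faceNum hn C (2 * n) i = faceNum hn C (2 * n + 1) (cycSucc n i) := by
  obtain ⟨c, hc, h⟩ := exists_mem_sector_eq hn hC h0 (sector C i)
  rw [eq_of_sector_eq hn hC (fun i => faceNum_hub_eq_cycPred hn hC) hi (lt_of_mem hC hc) h.symm,
    faceNum_hub_eq_rim_of_mem hn hC hc]
  exact eq_of_sector_eq hn hC (f := fun i => faceNum hn C (2 * n + 1) (cycSucc n i))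
    (fun i => faceNum_rim_eq_cycPred hn hC) (lt_of_mem hC hc) hi h

/-- Every corner at a hub or at an element of `C` lies in the face of a corner at the first hub. -/
theorem exists_faceNum_hub_eq (h0 : 0 < C.card) {a b : ℕ} (h : IsSpecial n C a)
    (hab : AdjNum n a b) : ∃ i < 2 * n, faceNum hn C a b = faceNum hn C (2 * n) i ∧
      cornerSector n C a (gapNum n a b) = sector C i := by
  rcases h with rfl | rfl | hc
  · rcases (by unfold AdjNum RelNum at hab; omega : b < 2 * n ∨ b = 2 * n + 2 ∨ b = 2 * n + 4)
      with hb | rfl | rfl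
    · exact ⟨b, hb, rfl, by rw [cornerSector_hub, gapNum_hub hb]⟩
    · refine ⟨0, by omega, ?_, ?_⟩
      · have := faceNum_hub_cycPred hn hC (i := 1) (by omega)
        rw [baseTri_one_hub.one.third hn] at this
        exact this.symm
      · rw [cornerSector_hub, baseTri_one_hub.two.gap hn]
    · refine ⟨1, by omega, ?_, ?_⟩
      · have := faceNum_hub_cycPred hn hC (i := 2) (by omega)
        rw [baseTri_two_hub.one.third hn] at this
        exact this.symm
      · rw [cornerSector_hub, baseTri_two_hub.two.gap hn]
  · have hb : b < 2 * n := by unfold AdjNum RelNum at hab; omega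
    refine ⟨cycPred n b, cycPred_lt hn hb, ?_, ?_⟩
    · rw [faceNum_hub_eq_rim hn hC (cycPred_lt hn hb) h0, cycSucc_cycPred hb]
    · rw [cornerSector_rim, gapNum_rim hb]
  · have ha := lt_of_mem hC hc
    rcases faceNum_cycle hn ha hab with ⟨h1, h2⟩ | ⟨h1, h2⟩
    · refine ⟨a, ha, ?_, ?_⟩
      · rw [h1, faceNum_symm hn (adjNum_hub ha) hc (Or.inl rfl)]
      · rw [h2, cornerSector_cycPred hn hC hc]
    · refine ⟨cycPred n a, cycPred_lt hn ha, ?_, ?_⟩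
      · rw [h1, faceNum_symm hn (adjNum_rim ha) hc (Or.inr rfl),
          faceNum_hub_eq_rim hn hC (cycPred_lt hn ha) h0, cycSucc_cycPred ha]
      · rw [h2, cornerSector_self hn hC hc]

/-- Each corner at a vertex of the `K_{2,m}` can be moved, within its face and keeping its sector,
to a corner of the first hub. There, corners in the same sector are joined across untwisted spokes.
-/
theorem cornerFace_eq_of_cornerLabel_eq (h0 : 0 < C.card) {d e : (T n).Dart}
    (h : cornerLabel C d = cornerLabel C e) : (triangulation hn).cornerFace (spokes n C) d =
      (triangulation hn).cornerFace (spokes n C) e := by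
  by_cases hd : IsSpecial n C d.fst <;> by_cases he : IsSpecial n C e.fst
  · rw [cornerLabel_of_special hd, cornerLabel_of_special he] at h
    have h := Sum.inr_injective h
    obtain ⟨i, hi, hi1, hi2⟩ := exists_faceNum_hub_eq hn hC h0 hd (dart_adjNum hn d)
    obtain ⟨j, hj, hj1, hj2⟩ := exists_faceNum_hub_eq hn hC h0 he (dart_adjNum hn e)
    have h1 := eq_of_sector_eq hn hC (fun i => faceNum_hub_eq_cycPred hn hC) hi hj
      (hi2.symm.trans (h.trans hj2))
    rw [← hi1, ← hj1, faceNum_dart, faceNum_dart] at h1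
    exact Option.some_injective _ h1
  · rw [cornerLabel_of_special hd, cornerLabel_of_not_special he] at h
    cases h
  · rw [cornerLabel_of_not_special hd, cornerLabel_of_special he] at h
    cases h
  · rw [cornerLabel_of_not_special hd, cornerLabel_of_not_special he] at h
    refine Triangulation.cornerFace_eq_of_fst_eq
      (congrArg Subtype.val (Sum.inl_injective h)) fun f hf hmem => ?_
    rw [edge_mem_spokes_iff, hf] at hmem
    rcases hmem with ⟨h', -⟩ | ⟨-, h' | h'⟩
    · exact hd (Or.inr (Or.inr h'))
    · exact hd (Or.inl h')
    · exact hd (Or.inr (Or.inl h'))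

include hn in
theorem cornerLabel_surjective (h0 : 0 < C.card) :
    Function.Surjective (cornerLabel (n := n) C) := by
  rintro (⟨v, hv⟩ | k)
  · obtain ⟨d, rfl⟩ := (triangulation hn).exists_dart_fst_eq v
    exact ⟨d, cornerLabel_of_not_special hv⟩
  · obtain ⟨c, hc, rfl⟩ := exists_mem_sector_eq hn hC h0 k
    have hlt := lt_of_mem hC hc
    refine ⟨numDart hn (adjNum_hub hlt).symm, ?_⟩
    rw [cornerLabel_of_special (Or.inl rfl)]
    change Sum.inr (cornerSector n C (2 * n) (gapNum n (2 * n) c)) = _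
    rw [cornerSector_hub, gapNum_hub hlt]

omit hn in
open Classical in
theorem card_not_isSpecial :
    Nat.card {v : Fin (2 * n + 5) // ¬ IsSpecial n C v} = 2 * n + 3 - C.card := by
  have h1 : Nat.card {v : Fin (2 * n + 5) // IsSpecial n C v} = C.card + 2 := by
    have h2 : Nat.card {v : Fin (2 * n + 5) // IsSpecial n C v} =
        Nat.card (insert (2 * n) (insert (2 * n + 1) C) : Finset ℕ) := by
      refine Nat.card_congr ⟨fun v => ⟨v.1.val, ?_⟩, fun a => ⟨⟨a.1, ?_⟩, ?_⟩, fun v => rfl,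
        fun a => rfl⟩
      · have := v.2
        unfold IsSpecial at this
        simpa using this
      · have := a.2
        simp only [Finset.mem_insert] at this
        rcases this with h | h | h
        · omega
        · omega
        · have := lt_of_mem hC h
          omega
      · have := a.2
        simp only [Finset.mem_insert] at this
        exact this
    rw [h2, Nat.card_eq_fintype_card, Fintype.card_coe, Finset.card_insert_of_notMem,
      Finset.card_insert_of_notMem]
    · intro h
      have := lt_of_mem hC h
      omega
    · intro h
      rcases Finset.mem_insert.1 h with h | h
      · omega
      · have := lt_of_mem hC h
        omega
  have h2 := Nat.card_congr (Equiv.sumCompl fun v : Fin (2 * n + 5) => IsSpecial n C v)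
  rw [Nat.card_sum, h1, Nat.card_fin] at h2
  omega

theorem twist_eulerChar (h0 : 0 < C.card) :
    ((triangulation hn).twist (spokes n C)).eulerChar = 0 := by
  have : NeZero C.card := ⟨h0.ne'⟩
  -- With `m = C.card` the sum is `(4n + 6) - (6n + 9) + (2n + 3 - m) + m = 0`.
  rw [(cornerLabel_isCornerLabel hn hC).eulerChar (cornerLabel_surjective hn hC h0)
    fun d e => cornerFace_eq_of_cornerLabel_eq hn hC h0, Nat.card_sum, card_not_isSpecial hC,
    Nat.card_zmod, card_edgeSet_T hn]
  have h1 := (triangulation hn).three_mul_card_tri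
  rw [card_edgeSet_T hn] at h1
  have h2 := Finset.card_le_card hC
  rw [Finset.card_range] at h2
  omega

theorem twist_isStrong (hcard : 3 ≤ C.card) :
    ((triangulation hn).twist (spokes n C)).IsStrong :=
  (cornerLabel_isCornerLabel hn hC).isStrong (cornerLabel_turn_ne hn hC hcard)

end

end StrongEmb

/-! ### Recovering `C` from the facial cycles; orientability. -/

namespace StrongEmb

open SimpleGraph

namespace Triangulation

variable {V : Type*} {T : SimpleGraph V} {M : Triangulation T} {H : Set (Sym2 V)}

/-- The facial cycle at a corner only crosses edges with the label of that corner. -/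
theorem CornerLabel.exists_facialCycle [Finite V] {X : Type*} {l : T.Dart → X}
    (hl : M.CornerLabel H l) (d : T.Dart) : ∃ S ∈ (M.twist H).facialCycles,
      (M.dualDart d).edge ∈ S.edgeSet ∧ ∀ e : T.Dart, (M.dualDart e).edge ∈ S.edgeSet →
        ∃ f : T.Dart, f.edge = e.edge ∧ (l f = l d ∨ l (M.turn f) = l d) := by
  obtain ⟨w, hw, hw'⟩ := (M.twist H).exists_isFacialWalk (M.dualDart d, 1)
  refine ⟨w.toSubgraph, ⟨_, w, hw, rfl⟩, ?_, fun e he => ?_⟩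
  · exact ((M.twist H).mem_edgeSet_toSubgraph_iff hw' _).2 ⟨0, rfl⟩
  · obtain ⟨i, hi⟩ := ((M.twist H).mem_edgeSet_toSubgraph_iff hw' _).1 he
    have h := hl.stateLabel_iterate (M.dualDart d, 1) i
    rw [stateLabel_one] at h
    revert hi h
    generalize (M.twist H).next^[i] (M.dualDart d, 1) = y
    obtain ⟨D, s⟩ := y
    obtain ⟨f, rfl⟩ := M.dualDart.surjective D
    intro hi h
    refine ⟨f, M.dualDart_edge_eq_iff.1 hi, ?_⟩
    rcases Int.units_eq_one_or s with rfl | rfl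
    · rw [stateLabel_one] at h
      exact Or.inl h
    · rw [stateLabel_neg_one] at h
      exact Or.inr h

/-- A facial cycle that crosses a twisted edge turns at both ends of that edge. -/
theorem turn_mem_facialCycle [Finite V] {d : T.Dart} (hd : d.edge ∈ H) {S : M.dual.Subgraph}
    (hS : S ∈ (M.twist H).facialCycles) (h : (M.dualDart d).edge ∈ S.edgeSet) :
    (M.dualDart (M.turn d)).edge ∈ S.edgeSet ∨
      (M.dualDart (M.turn.symm d.symm)).edge ∈ S.edgeSet := by
  obtain ⟨v, w, ⟨x, hw⟩, rfl⟩ := hS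
  have hiff := (M.twist H).mem_edgeSet_toSubgraph_iff hw
  obtain ⟨i, hi⟩ := (hiff _).1 h
  have hnext : ((M.twist H).next ((M.twist H).next^[i] x)).1.edge ∈ w.toSubgraph.edgeSet :=
    (hiff _).2 ⟨i + 1, by rw [Function.iterate_succ_apply']⟩
  have hprev : ((M.twist H).next ((M.twist H).rev ((M.twist H).next^[i] x))).1.edge ∈
      w.toSubgraph.edgeSet := by
    -- The predecessor of a state on its cycle, written as a forward iterate: one step less than a
    -- full period.
    obtain ⟨p, hp⟩ := Nat.exists_eq_add_one.2 ((M.twist H).minimalPeriod_next_pos x)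
    have h1 : (M.twist H).next^[i] x =
        (M.twist H).next ((M.twist H).next^[i + p] x) := by
      rw [← Function.iterate_succ_apply' (f := (M.twist H).next), Nat.succ_eq_add_one, add_assoc,
        ← hp, Function.iterate_add_apply, Function.iterate_minimalPeriod]
    rw [h1, CellularEmbedding.next_rev_next]
    refine (hiff _).2 ⟨i + p, ?_⟩
    rw [CellularEmbedding.rev_apply]
    exact (Dart.edge_symm _).symm
  revert hi hnext hprev
  generalize (M.twist H).next^[i] x = y
  obtain ⟨D, s⟩ := y
  obtain ⟨f, rfl⟩ := M.dualDart.surjective D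
  intro hi hnext hprev
  have hf := M.dualDart_edge_eq_iff.1 hi
  have hfH : twistSign H f = -1 := twistSign_of_mem (by rwa [hf])
  rcases (dart_edge_eq_iff f d).1 hf with rfl | rfl
  · rcases Int.units_eq_one_or s with rfl | rfl
    · rw [twist_next_of_eq_neg_one _ _ (by rw [hfH, one_mul])] at hnext
      exact Or.inr hnext
    · rw [twist_next_rev_neg_one] at hprev
      exact Or.inl hprev
  · rcases Int.units_eq_one_or s with rfl | rfl
    · rw [twist_next_rev_one] at hprev
      exact Or.inr hprev
    · rw [twist_next_of_eq_one _ _ (by rw [hfH, neg_one_mul, neg_neg]), Dart.symm_symm] at hnext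
      exact Or.inl hnext

end Triangulation

section

variable {n : ℕ} (hn : 3 < n) {C : Finset ℕ} (hC : C ⊆ Finset.range (2 * n))

include hC in
/-- The facial cycles of the twisted embedding determine the set `C`. -/
theorem facialCycles_ne {C' : Finset ℕ} {i : ℕ} (hi : i < 2 * n) (h : i ∉ C) (h' : i ∈ C') :
    ((triangulation hn).twist (spokes n C)).facialCycles ≠
      ((triangulation hn).twist (spokes n C')).facialCycles := by
  intro heq
  set d := numDart hn (adjNum_hub hi) with hd
  have hns : ¬ IsSpecial n C d.fst := by
    rintro (h1 | h1 | h1)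
    · exact absurd (show i = 2 * n from h1) (by omega)
    · exact absurd (show i = 2 * n + 1 from h1) (by omega)
    · exact h h1
  obtain ⟨S, hS, hdS, hall⟩ := (cornerLabel_isCornerLabel hn hC).exists_facialCycle d
  rw [heq] at hS
  have hlab : ∀ f : (T n).Dart, cornerLabel C f = cornerLabel C d → f.fst = d.fst := by
    intro f hf
    rw [cornerLabel_of_not_special hns] at hf
    by_cases hs : IsSpecial n C f.fst
    · rw [cornerLabel_of_special hs] at hf
      cases hf
    · rw [cornerLabel_of_not_special hs] at hf
      exact congrArg Subtype.val (Sum.inl_injective hf)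
  have hmem : ∀ e : (T n).Dart, ((triangulation hn).dualDart e).edge ∈ S.edgeSet →
      d.fst ∈ e.edge := by
    intro e he
    obtain ⟨f, hf, h1 | h1⟩ := hall e he
    · rw [← hf, ← hlab f h1]
      exact Sym2.mem_mk_left _ _
    · rw [← hf, ← hlab _ h1]
      exact Sym2.mem_mk_right _ _
  -- The cycle around `i` crosses only edges at `i`. For `C'` the spoke is twisted, so a facial
  -- cycle through it also crosses an edge at the hub that avoids `i`.
  rcases Triangulation.turn_mem_facialCycle (edge_mem_spokes_iff.2 (Or.inl ⟨h', Or.inl rfl⟩)) hS hdS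
    with h1 | h1
  · rcases Sym2.mem_iff.1 (hmem _ h1) with h2 | h2
    · exact d.fst_ne_snd h2
    · exact (triangulation hn).third_ne_left d.adj h2.symm
  · rcases Sym2.mem_iff.1 (hmem _ h1) with h2 | h2
    · exact ((triangulation hn).adj_third d.adj.symm).ne h2
    · exact d.fst_ne_snd h2

theorem gap_eq_of_tri_eq {d e : (T n).Dart}
    (h : (triangulation hn).tri d = (triangulation hn).tri e) : gap e = gap d := by
  rcases (triangulation hn).tri_eq_iff.1 h with rfl | rfl | rfl
  · rfl
  · rw [gap_turn]
  · rw [gap_turn, gap_turn]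

theorem neg_one_pow_prefixCount {n i : ℕ} (hn : 3 < n) {C : Finset ℕ} (hC : C ⊆ Finset.range (2 * n)) (hev : Even C.card) : (-1 : ℤˣ) ^ prefixCount C (cycPred n i) * (-1) ^ prefixCount C i =
      if i ∈ C then -1 else 1 := by
  unfold cycPred
  rcases i with - | i
  · rw [if_pos rfl, prefixCount_last hn hC, hev.neg_one_pow, prefixCount_zero]
    split_ifs <;> simp
  · rw [if_neg (by omega), Nat.add_sub_cancel, prefixCount_succ, pow_add, ← mul_assoc,
      ← pow_add, ← two_mul, pow_mul]
    split_ifs <;> simp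

include hC

/-- Reverse the triangles in the gaps with odd count. The sign changes exactly at the spokes of `C`,
and it closes up around the cycle because `C.card` is even. -/
theorem twist_isOrientable (hev : Even C.card) :
    ((triangulation hn).twist (spokes n C)).IsOrientable := by
  rw [Triangulation.twist_isOrientable_iff]
  choose f hf using (triangulation hn).tri_surjective
  refine ⟨fun t => (-1) ^ prefixCount C (gap (f t)), fun d => ?_⟩
  beta_reduce
  rw [gap_eq_of_tri_eq hn (hf _).symm, gap_eq_of_tri_eq hn (hf _).symm]
  have key : ∀ d : (T n).Dart, d.fst.val < 2 * n → (d.snd.val = 2 * n ∨ d.snd.val = 2 * n + 1) →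
      Triangulation.twistSign (spokes n C) d =
        (-1) ^ prefixCount C (gap d) * (-1) ^ prefixCount C (gap d.symm) := by
    intro d h1 h2
    have h3 : Triangulation.twistSign (spokes n C) d = if d.fst.val ∈ C then -1 else 1 := by
      by_cases h : d.fst.val ∈ C
      · rw [if_pos h, Triangulation.twistSign_of_mem (edge_mem_spokes_iff.2 (Or.inl ⟨h, h2⟩))]
      · rw [if_neg h, Triangulation.twistSign_of_notMem]
        rw [edge_mem_spokes_iff]
        rintro (h' | h')
        · exact h h'.1
        · omega
    rw [h3, ← neg_one_pow_prefixCount hn hC hev]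
    change _ = (-1) ^ prefixCount C (gapNum n d.fst d.snd) *
      (-1) ^ prefixCount C (gapNum n d.snd d.fst)
    rcases h2 with h2 | h2 <;> rw [h2]
    · rw [gapNum_to_hub h1, gapNum_hub h1]
    · rw [gapNum_to_rim h1, gapNum_rim h1, mul_comm]
  by_cases h1 : d.fst.val < 2 * n ∧ (d.snd.val = 2 * n ∨ d.snd.val = 2 * n + 1)
  · exact key d h1.1 h1.2
  by_cases h2 : d.snd.val < 2 * n ∧ (d.fst.val = 2 * n ∨ d.fst.val = 2 * n + 1)
  · have := key d.symm h2.1 h2.2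
    rw [Dart.symm_symm] at this
    rw [mul_comm ((-1) ^ _), ← this, Triangulation.twistSign, Triangulation.twistSign, Dart.edge_symm]
  · have hg : gap d = gap d.symm := (dart_adjNum hn d).gapNum_comm hn h1 h2
    rw [hg, Int.units_mul_self, Triangulation.twistSign_of_notMem]
    · rw [edge_mem_spokes_iff]
      rintro (h | h)
      · exact h1 ⟨lt_of_mem hC h.1, h.2⟩
      · exact h2 ⟨lt_of_mem hC h.1, h.2⟩

/-- The circuit of triangles around the second hub crosses `C.card` twisted edges, so a compatible
orientation would change sign after one full turn. Here `τ i` is the orientation of its triangle in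
gap `i`. -/
theorem twist_not_isOrientable (hodd : Odd C.card) :
    ¬ ((triangulation hn).twist (spokes n C)).IsOrientable := by
  rw [Triangulation.twist_isOrientable_iff]
  rintro ⟨o, ho⟩
  obtain ⟨τ, hτ⟩ : ∃ τ : ℕ → ℤˣ, ∀ (i : ℕ) (hi : i < 2 * n),
      τ i = o ((triangulation hn).tri (numDart hn (adjNum_rim hi))) :=
    ⟨fun i => if hi : i < 2 * n then
      o ((triangulation hn).tri (numDart hn (adjNum_rim hi))) else 1, fun i hi => dif_pos hi⟩
  have hstep : ∀ i < 2 * n, τ i = τ (cycPred n i) * if i ∈ C then -1 else 1 := by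
    intro i hi
    have h1 : Triangulation.twistSign (spokes n C) (numDart hn (adjNum_rim hi)) =
        if i ∈ C then -1 else 1 := by
      by_cases h : i ∈ C
      · rw [if_pos h, Triangulation.twistSign_of_mem
          (edge_mem_spokes_iff.2 (Or.inl ⟨h, Or.inr rfl⟩))]
      · rw [if_neg h, Triangulation.twistSign_of_notMem]
        rw [edge_mem_spokes_iff]
        change ¬ (i ∈ C ∧ _ ∨ 2 * n + 1 ∈ C ∧ _)
        rintro (h' | h')
        · exact h h'.1
        · have := lt_of_mem hC h'.1
          omega
    have h2 : τ (cycPred n i) =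
        o ((triangulation hn).tri (numDart hn (adjNum_rim hi)).symm) := by
      rw [hτ _ (cycPred_lt hn hi), ← Triangulation.tri_turn]
      congr 2
      have h3 := numTri_rim (cycPred_lt hn hi)
      rw [cycSucc_cycPred hi] at h3
      exact turn_numDart hn h3
    rw [← h1, ho, h2, hτ i hi, mul_left_comm, Int.units_mul_self, mul_one]
  have hall : ∀ i < 2 * n, τ i = τ (2 * n - 1) * (-1) ^ prefixCount C i := by
    intro i
    induction i with
    | zero =>
      intro hi
      rw [hstep 0 hi, cycPred, if_pos rfl, prefixCount_zero]
      split_ifs <;> simp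
    | succ i ih =>
      intro hi
      rw [hstep _ hi, cycPred, if_neg (by omega), Nat.add_sub_cancel, ih (by omega),
        prefixCount_succ, pow_add, mul_assoc]
      split_ifs <;> simp
  have h := hall (2 * n - 1) (by omega)
  rw [prefixCount_last hn hC, hodd.neg_one_pow] at h
  have h1 := mul_eq_left.1 h.symm
  exact absurd h1 (by decide)

end

end StrongEmb

namespace StrongEmb

open SimpleGraph

/-! ### Automorphisms of the dual graph -/

/-- The vertex `t` lies in a triangle of the graph. -/
def InTriangle {W : Type*} (G : SimpleGraph W) (t : W) : Prop :=
  ∃ s r, G.Adj t s ∧ G.Adj s r ∧ G.Adj r t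

theorem InTriangle.map {W : Type*} {G : SimpleGraph W} (φ : G ≃g G) {t : W}
    (h : InTriangle G t) : InTriangle G (φ t) := by
  obtain ⟨s, r, h1, h2, h3⟩ := h
  exact ⟨φ s, φ r, φ.map_adj_iff.2 h1, φ.map_adj_iff.2 h2, φ.map_adj_iff.2 h3⟩

theorem inTriangle_apply_iff {W : Type*} {G : SimpleGraph W} (φ : G ≃g G) {t : W} :
    InTriangle G (φ t) ↔ InTriangle G t :=
  ⟨fun h => by simpa using h.map φ.symm, fun h => h.map φ⟩

theorem fixed_of_adj {W : Type*} {G : SimpleGraph W} (φ : G ≃g G) {t r : W} (ht : φ t = t)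
    (hr : G.Adj t r) (h : ∀ s, G.Adj t s → s = r ∨ φ s = s) : φ r = r := by
  have h1 := φ.map_adj_iff.2 hr
  rw [ht] at h1
  rcases h _ h1 with h2 | h2
  · exact h2
  · exact φ.injective h2

namespace Triangulation

variable {V : Type*} {T : SimpleGraph V} (M : Triangulation T)

/-- The triangles across two sides of `tri d` meeting at `d.fst` share an edge. Comparing the
possible edges leaves only one from `d.fst` to a common third vertex. -/
theorem third_eq_of_dual_adj {d : T.Dart} (h : M.dual.Adj (M.tri d.symm)
    (M.tri (M.turn.symm d).symm)) :
    M.third d.snd d.fst = M.third d.fst (M.third d.fst d.snd) := by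
  obtain ⟨⟨a, b⟩, hab⟩ := d
  replace hab : T.Adj a b := hab
  have hbc := M.adj_third hab
  have hac : T.Adj a (M.third a b) := (M.turn.symm ⟨(a, b), hab⟩).symm.adj
  have hax := M.adj_third hab.symm
  have hz := M.third_ne_left hac
  rw [dual_adj_iff] at h
  simp only [tri_eq_iff, Dart.ext_iff, Prod.ext_iff] at h
  change M.third b a = M.third a (M.third a b)
  have hw := M.third_third hac
  generalize hc : M.third a b = c at *
  change (a = a ∧ b = M.third a b ∨ a = M.third a b ∧ b = M.third a (M.third a b) ∨
      a = M.third a (M.third a b) ∧ b = M.third (M.third a b) (M.third a (M.third a b))) ∨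
    (M.third b a = a ∧ a = M.third a b ∨
      M.third b a = M.third a b ∧ a = M.third a (M.third a b) ∨
      M.third b a = M.third a (M.third a b) ∧
        a = M.third (M.third a b) (M.third a (M.third a b))) ∨
    (b = a ∧ M.third b a = M.third a b ∨
      b = M.third a b ∧ M.third b a = M.third a (M.third a b) ∨
      b = M.third a (M.third a b) ∧
        M.third b a = M.third (M.third a b) (M.third a (M.third a b))) at h
  rw [hc, hw] at h
  rcases h with (h | h | h) | (h | h | h) | (h | h | h)
  · exact absurd h.2 hbc.ne
  · exact absurd h.1 hac.ne
  · exact absurd h.1.symm hz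
  · exact absurd h.2 hac.ne
  · exact absurd h.2.symm hz
  · exact h.1
  · exact absurd h.1.symm hab.ne
  · exact h.2
  · exact absurd h.2.symm hax.ne

/-- A triangle in the dual graph surrounds a vertex of degree three of `T`: by
`third_eq_of_dual_adj` the rotation at that vertex closes up after three neighbours. -/
theorem exists_dart_of_inTriangle [Finite V] {t : M.Tri} (h : InTriangle M.dual t) :
    ∃ d, M.tri d = t ∧ ∀ w, T.Adj d.fst w →
      w = d.snd ∨ w = M.third d.fst d.snd ∨ w = M.third d.snd d.fst := by
  obtain ⟨s, r, hs, hsr, hr⟩ := h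
  obtain ⟨d₀, rfl⟩ := M.tri_surjective t
  obtain ⟨d, hd, hadj⟩ : ∃ d, M.tri d = M.tri d₀ ∧
      M.dual.Adj (M.tri d.symm) (M.tri (M.turn.symm d).symm) := by
    rcases M.dual_adj_iff.1 hs with rfl | rfl | rfl <;>
      rcases M.dual_adj_iff.1 hr.symm with rfl | rfl | rfl
    · exact (hsr.ne rfl).elim
    · exact ⟨M.turn d₀, M.tri_turn _, by rw [Equiv.symm_apply_apply]; exact hsr.symm⟩
    · exact ⟨d₀, rfl, hsr⟩
    · exact ⟨M.turn d₀, M.tri_turn _, by rw [Equiv.symm_apply_apply]; exact hsr⟩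
    · exact (hsr.ne rfl).elim
    · exact ⟨M.turn.symm d₀, M.tri_turn_symm _, by
        rw [← M.turn_turn (M.turn.symm d₀), Equiv.apply_symm_apply]; exact hsr.symm⟩
    · exact ⟨d₀, rfl, hsr.symm⟩
    · exact ⟨M.turn.symm d₀, M.tri_turn_symm _, by
        rw [← M.turn_turn (M.turn.symm d₀), Equiv.apply_symm_apply]; exact hsr⟩
    · exact (hsr.ne rfl).elim
  have hx := M.third_eq_of_dual_adj hadj
  refine ⟨d, hd, fun w hw => ?_⟩
  have := finite_dart (T := T)
  obtain ⟨k, -, hk⟩ := (M.rot_sameCycle d ⟨(d.fst, w), hw⟩ rfl).exists_pow_eq'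
  have key : ∀ k : ℕ, ((M.rot ^ k) d).fst = d.fst ∧ (((M.rot ^ k) d).snd = d.snd ∨
      ((M.rot ^ k) d).snd = M.third d.fst d.snd ∨
      ((M.rot ^ k) d).snd = M.third d.snd d.fst) := by
    intro k
    induction k with
    | zero => exact ⟨rfl, Or.inl rfl⟩
    | succ k ih =>
      rw [pow_succ', Equiv.Perm.mul_apply]
      refine ⟨ih.1, ?_⟩
      have h0 : (M.rot ((M.rot ^ k) d)).snd =
        M.third ((M.rot ^ k) d).snd ((M.rot ^ k) d).fst := rfl
      rw [h0, ih.1]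
      have hac : T.Adj d.fst (M.third d.fst d.snd) := (M.turn.symm d).symm.adj
      rcases ih.2 with h1 | h1 | h1 <;> rw [h1]
      · exact Or.inr (Or.inr rfl)
      · have h2 := M.third_third (M.adj_third d.adj)
        rw [M.third_third d.adj] at h2
        exact Or.inl h2
      · have h2 := M.third_third (M.adj_third hac)
        rw [M.third_third hac, ← hx] at h2
        exact Or.inr (Or.inl h2)
  have := (key k).2
  rwa [hk] at this

end Triangulation

/-- Rigidity of a neighbourhood of two disjoint triangles in a cubic graph. -/
theorem fixed_of_neighbors {W : Type*} {G : SimpleGraph W} (φ : G ≃g G)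
    {x₁ x₂ x₃ y₁ y₂ y₃ z₁ z₂ a a₂ b₀ b₁ b₂ b : W}
    (Nx₁ : ∀ s, G.Adj x₁ s ↔ s = x₂ ∨ s = x₃ ∨ s = b₀)
    (Nx₂ : ∀ s, G.Adj x₂ s ↔ s = x₃ ∨ s = x₁ ∨ s = z₁)
    (Nx₃ : ∀ s, G.Adj x₃ s ↔ s = x₁ ∨ s = x₂ ∨ s = z₂)
    (Ny₁ : ∀ s, G.Adj y₁ s ↔ s = y₂ ∨ s = y₃ ∨ s = b₁)
    (Ny₂ : ∀ s, G.Adj y₂ s ↔ s = y₃ ∨ s = y₁ ∨ s = z₂)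
    (Ny₃ : ∀ s, G.Adj y₃ s ↔ s = y₁ ∨ s = y₂ ∨ s = a₂)
    (Nz₁ : ∀ s, G.Adj z₁ s ↔ s = x₂ ∨ s = z₂ ∨ s = a)
    (Nz₂ : ∀ s, G.Adj z₂ s ↔ s = x₃ ∨ s = y₂ ∨ s = z₁)
    (Nb₀ : ∀ s, G.Adj b₀ s ↔ s = x₁ ∨ s = b₁ ∨ s = b)
    (Nb₁ : ∀ s, G.Adj b₁ s ↔ s = y₁ ∨ s = b₂ ∨ s = b₀)
    (Nb : ∀ s, G.Adj b s → ¬ InTriangle G s)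
    (hP : ∀ s, InTriangle G s → s = x₁ ∨ s = x₂ ∨ s = x₃ ∨ s = y₁ ∨ s = y₂ ∨ s = y₃)
    (hz₁ : ¬ InTriangle G z₁) (hz₂ : ¬ InTriangle G z₂) (ha : ¬ InTriangle G a)
    (hb₀ : ¬ InTriangle G b₀) (hb₂ : ¬ InTriangle G b₂)
    (hbz : b₀ ≠ z₁) (hbb : b₀ ≠ b₁) (hba : b₀ ≠ a₂) (hzb : z₁ ≠ b₁) (hza : z₁ ≠ a₂)
    (hba' : b₁ ≠ a₂) (hxy : x₁ ≠ y₂) (hxy' : x₃ ≠ y₂) :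
    φ x₁ = x₁ ∧ φ x₂ = x₂ ∧ φ x₃ = x₃ ∧ φ y₁ = y₁ ∧ φ y₂ = y₂ ∧ φ y₃ = y₃ ∧ φ z₁ = z₁ ∧
      φ z₂ = z₂ ∧ φ a₂ = a₂ ∧ φ b₀ = b₀ ∧ φ b₁ = b₁ ∧ φ b₂ = b₂ := by
  have hφ : ∀ {s t}, G.Adj s t → G.Adj (φ s) (φ t) := φ.map_adj_iff.2
  have hx₁ : InTriangle G x₁ := ⟨x₂, x₃, (Nx₁ _).2 (by simp), (Nx₂ _).2 (by simp), (Nx₃ _).2 (by simp)⟩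
  have hx₂ : InTriangle G x₂ := ⟨x₃, x₁, (Nx₂ _).2 (by simp), (Nx₃ _).2 (by simp), (Nx₁ _).2 (by simp)⟩
  have hx₃ : InTriangle G x₃ := ⟨x₁, x₂, (Nx₃ _).2 (by simp), (Nx₁ _).2 (by simp), (Nx₂ _).2 (by simp)⟩
  have hy₁ : InTriangle G y₁ := ⟨y₂, y₃, (Ny₁ _).2 (by simp), (Ny₂ _).2 (by simp), (Ny₃ _).2 (by simp)⟩
  have hy₂ : InTriangle G y₂ := ⟨y₃, y₁, (Ny₂ _).2 (by simp), (Ny₃ _).2 (by simp), (Ny₁ _).2 (by simp)⟩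
  have hy₃ : InTriangle G y₃ := ⟨y₁, y₂, (Ny₃ _).2 (by simp), (Ny₁ _).2 (by simp), (Ny₂ _).2 (by simp)⟩
  have hout : ∀ s t, InTriangle G s → ¬ InTriangle G t → G.Adj s t →
      s = x₁ ∧ t = b₀ ∨ s = x₂ ∧ t = z₁ ∨ s = y₁ ∧ t = b₁ ∨ s = y₃ ∧ t = a₂ ∨
        (s = x₃ ∨ s = y₂) ∧ t = z₂ := by
    intro s t hs ht hst
    rcases hP s hs with rfl | rfl | rfl | rfl | rfl | rfl
    · rcases (Nx₁ t).1 hst with rfl | rfl | rfl <;> first | contradiction | simp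
    · rcases (Nx₂ t).1 hst with rfl | rfl | rfl <;> first | contradiction | simp
    · rcases (Nx₃ t).1 hst with rfl | rfl | rfl <;> first | contradiction | simp
    · rcases (Ny₁ t).1 hst with rfl | rfl | rfl <;> first | contradiction | simp
    · rcases (Ny₂ t).1 hst with rfl | rfl | rfl <;> first | contradiction | simp
    · rcases (Ny₃ t).1 hst with rfl | rfl | rfl <;> first | contradiction | simp
  -- Among the edges leaving the two triangles, only those from `x₃` and `y₂` end at the same
  -- vertex.
  have f_z₂ : φ z₂ = z₂ := by
    have h1 := hout (φ x₃) (φ z₂) (hx₃.map φ) (by rwa [inTriangle_apply_iff])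
      (hφ ((Nx₃ _).2 (by simp)))
    have h2 := hout (φ y₂) (φ z₂) (hy₂.map φ) (by rwa [inTriangle_apply_iff])
      (hφ ((Ny₂ _).2 (by simp)))
    have h3 : φ x₃ ≠ φ y₂ := fun h => hxy' (φ.injective h)
    rcases h1 with ⟨h1, h1'⟩ | ⟨h1, h1'⟩ | ⟨h1, h1'⟩ | ⟨h1, h1'⟩ | ⟨-, h1⟩
    case inr.inr.inr.inr => exact h1
    all_goals
      rcases h2 with ⟨h2, h2'⟩ | ⟨h2, h2'⟩ | ⟨h2, h2'⟩ | ⟨h2, h2'⟩ | ⟨-, h2⟩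
      case inr.inr.inr.inr => exact h2
      all_goals
        first
        | exact absurd (h1.trans h2.symm) h3
        | (rw [h1'] at h2'; first | contradiction | exact absurd h2'.symm (by assumption))
  have f_z₁ : φ z₁ = z₁ := by
    have h := hφ ((Nz₂ z₁).2 (by simp))
    rw [f_z₂, Nz₂] at h
    rcases h with h | h | h
    · exact absurd ((inTriangle_apply_iff φ).1 (h ▸ hx₃)) hz₁
    · exact absurd ((inTriangle_apply_iff φ).1 (h ▸ hy₂)) hz₁
    · exact h
  have f_x₂ : φ x₂ = x₂ := by
    have h := hφ ((Nz₁ x₂).2 (by simp))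
    rw [f_z₁, Nz₁] at h
    have h' := hx₂.map φ
    rcases h with h | h | h
    · exact h
    · exact absurd (h ▸ h') hz₂
    · exact absurd (h ▸ h') ha
  have f_x₃ : φ x₃ = x₃ := by
    have h := hφ ((Nz₂ x₃).2 (by simp))
    rw [f_z₂, Nz₂] at h
    rcases h with h | h | h
    · exact h
    -- The two triangles cannot be interchanged, because `φ x₃` is adjacent to the fixed vertex `x₂`
    -- and `y₂` is not.
    · have h' := hφ ((Nx₂ x₃).2 (by simp))
      rw [f_x₂, Nx₂, h] at h'
      rcases h' with h' | h' | h'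
      · exact absurd h'.symm hxy'
      · exact absurd h'.symm hxy
      · exact absurd (h' ▸ hy₂) hz₁
    · exact absurd (h ▸ hx₃.map φ) hz₁
  have f_y₂ : φ y₂ = y₂ := fixed_of_adj φ f_z₂ ((Nz₂ _).2 (by simp)) fun s hs => by
    rcases (Nz₂ s).1 hs with rfl | rfl | rfl <;> simp [*]
  have f_x₁ : φ x₁ = x₁ := fixed_of_adj φ f_x₂ ((Nx₂ _).2 (by simp)) fun s hs => by
    rcases (Nx₂ s).1 hs with rfl | rfl | rfl <;> simp [*]
  have f_b₀ : φ b₀ = b₀ := fixed_of_adj φ f_x₁ ((Nx₁ _).2 (by simp)) fun s hs => by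
    rcases (Nx₁ s).1 hs with rfl | rfl | rfl <;> simp [*]
  have f_b₁ : φ b₁ = b₁ := by
    have h := hφ ((Nb₀ b₁).2 (by simp))
    rw [f_b₀, Nb₀] at h
    rcases h with h | h | h
    · rw [← f_x₁] at h
      rw [φ.injective h, f_x₁]
    · exact h
    -- `b₁` has a neighbour in a triangle of the graph and `b` has none, so `b₁` is not sent to `b`.
    · have h' := hφ ((Nb₁ y₁).2 (by simp))
      rw [h] at h'
      exact absurd (hy₁.map φ) (Nb _ h')
  have f_y₁ : φ y₁ = y₁ := by
    have h := hφ ((Nb₁ y₁).2 (by simp))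
    rw [f_b₁, Nb₁] at h
    have h' := hy₁.map φ
    rcases h with h | h | h
    · exact h
    · exact absurd (h ▸ h') hb₂
    · exact absurd (h ▸ h') hb₀
  have f_b₂ : φ b₂ = b₂ := fixed_of_adj φ f_b₁ ((Nb₁ _).2 (by simp)) fun s hs => by
    rcases (Nb₁ s).1 hs with rfl | rfl | rfl <;> simp [*]
  have f_y₃ : φ y₃ = y₃ := fixed_of_adj φ f_y₂ ((Ny₂ _).2 (by simp)) fun s hs => by
    rcases (Ny₂ s).1 hs with rfl | rfl | rfl <;> simp [*]
  have f_a₂ : φ a₂ = a₂ := fixed_of_adj φ f_y₃ ((Ny₃ _).2 (by simp)) fun s hs => by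
    rcases (Ny₃ s).1 hs with rfl | rfl | rfl <;> simp [*]
  exact ⟨f_x₁, f_x₂, f_x₃, f_y₁, f_y₂, f_y₃, f_z₁, f_z₂, f_a₂, f_b₀, f_b₁, f_b₂⟩

section

variable {n : ℕ} (hn : 3 < n)

open Classical in
/-- The triangle to the left of a dart with the given numbers of its ends. -/
noncomputable def triNum (a b : ℕ) : (triangulation hn).Tri :=
  if h : AdjNum n a b then (triangulation hn).tri (numDart hn h)
  else (triangulation hn).tri (numDart hn (adjNum_hub (by omega : 0 < 2 * n)))

theorem triNum_of_adj {a b : ℕ} (h : AdjNum n a b) :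
    triNum hn a b = (triangulation hn).tri (numDart hn h) := dif_pos h

theorem triNum_dart (d : (T n).Dart) : triNum hn d.fst d.snd = (triangulation hn).tri d :=
  dif_pos (dart_adjNum hn d)

theorem triNum_rotate {a b c g : ℕ} (h : NumTri n a b c g) : triNum hn b c = triNum hn a b := by
  rw [triNum_of_adj hn (h.adj hn), triNum_of_adj hn (h.rotate.adj hn), ← turn_numDart hn h,
    Triangulation.tri_turn]

theorem triNum_rotate_rotate {a b c g : ℕ} (h : NumTri n a b c g) :
    triNum hn c a = triNum hn a b := by
  rw [triNum_rotate hn h.rotate, triNum_rotate hn h]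

theorem turn_symm_numDart {a b c g : ℕ} (h : NumTri n a b c g) :
    (triangulation hn).turn.symm (numDart hn (h.adj hn)) =
      numDart hn (h.rotate.rotate.adj hn) := by
  rw [← Triangulation.turn_turn, turn_numDart hn h, turn_numDart hn h.rotate]

theorem dual_adj_triNum_iff {a b c g : ℕ} (h : NumTri n a b c g) {s₁ s₂ s₃ : (triangulation hn).Tri}
    (h₁ : triNum hn b a = s₁) (h₂ : triNum hn c b = s₂) (h₃ : triNum hn a c = s₃)
    (t : (triangulation hn).Tri) :
    (triangulation hn).dual.Adj (triNum hn a b) t ↔ t = s₁ ∨ t = s₂ ∨ t = s₃ := by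
  subst h₁ h₂ h₃
  rw [triNum_of_adj hn (h.adj hn), Triangulation.dual_adj_iff, turn_numDart hn h,
    turn_symm_numDart hn h, triNum_of_adj hn (h.adj hn).symm,
    triNum_of_adj hn (h.rotate.adj hn).symm, triNum_of_adj hn (h.rotate.rotate.adj hn).symm]
  rfl

theorem mem_of_triNum_eq {a b c g a' b' : ℕ} (h : NumTri n a b c g) (h' : AdjNum n a' b')
    (heq : triNum hn a b = triNum hn a' b') :
    a' = a ∧ b' = b ∨ a' = b ∧ b' = c ∨ a' = c ∧ b' = a := by
  rw [triNum_of_adj hn (h.adj hn), triNum_of_adj hn h', Triangulation.tri_eq_iff,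
    turn_numDart hn h, turn_numDart hn h.rotate] at heq
  have key : ∀ {a b a' b'} (h : AdjNum n a b) (h' : AdjNum n a' b'),
      numDart hn h' = numDart hn h → a' = a ∧ b' = b := fun h h' he =>
    ⟨congrArg (fun d : (T n).Dart => d.fst.val) he, congrArg (fun d : (T n).Dart => d.snd.val) he⟩
  rcases heq with h1 | h1 | h1
  · exact Or.inl (key _ _ h1)
  · exact Or.inr (Or.inl (key _ _ h1))
  · exact Or.inr (Or.inr (key _ _ h1))

/-- Triangles of the dual come from vertices of degree three in `T n`, and all vertices other than
these two have four distinct neighbours. -/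
theorem exists_of_inTriangle {t : (triangulation hn).Tri}
    (h : InTriangle (triangulation hn).dual t) :
    ∃ a b, (a = 2 * n + 3 ∨ a = 2 * n + 4) ∧ AdjNum n a b ∧ t = triNum hn a b := by
  obtain ⟨d, rfl, hd⟩ := (triangulation hn).exists_dart_of_inTriangle h
  refine ⟨d.fst, d.snd, ?_, dart_adjNum hn d, (triNum_dart hn d).symm⟩
  have hd' : ∃ x y z : ℕ, ∀ w, AdjNum n d.fst w → w = x ∨ w = y ∨ w = z := by
    refine ⟨d.snd, (triangulation hn).third d.fst d.snd, (triangulation hn).third d.snd d.fst,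
      fun w hw => ?_⟩
    have := hd ⟨w, hw.symm.lt⟩ ((T_adj_iff hn).2 hw)
    simpa only [Fin.ext_iff] using this
  obtain ⟨x, y, z, hxyz⟩ := hd'
  have hlt := (dart_adjNum hn d).lt
  revert hxyz hlt
  generalize d.fst.val = a
  intro hxyz hlt
  by_contra hne
  have four : ∀ p q r s : ℕ, AdjNum n a p → AdjNum n a q → AdjNum n a r → AdjNum n a s →
      p ≠ q → p ≠ r → p ≠ s → q ≠ r → q ≠ s → r ≠ s → False := by
    intro p q r s hp hq hr hs
    have := hxyz p hp
    have := hxyz q hq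
    have := hxyz r hr
    have := hxyz s hs
    omega
  rcases (by omega : a < 2 * n ∨ a = 2 * n ∨ a = 2 * n + 1 ∨ a = 2 * n + 2)
    with ha | rfl | rfl | rfl
  · have h1 : AdjNum n a (cycSucc n a) := (numTri_rim ha).rotate.rotate.adj hn |>.symm
    have h2 : AdjNum n a (cycPred n a) := by
      have := (numTri_rim (cycPred_lt hn ha)).rotate.rotate.adj hn
      rwa [cycSucc_cycPred ha] at this
    refine four _ _ _ _ (adjNum_hub ha) (adjNum_rim ha) h1 h2 ?_ ?_ ?_ ?_ ?_ ?_ <;>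
      (try simp only [cycSucc, cycPred]) <;> (try split_ifs) <;> omega
  · exact four 0 1 2 3 (adjNum_hub (by omega)).symm (adjNum_hub (by omega)).symm
      (adjNum_hub (by omega)).symm (adjNum_hub (by omega)).symm (by omega) (by omega) (by omega)
      (by omega) (by omega) (by omega)
  · exact four 0 1 2 3 (adjNum_rim (by omega)).symm (adjNum_rim (by omega)).symm
      (adjNum_rim (by omega)).symm (adjNum_rim (by omega)).symm (by omega) (by omega) (by omega)
      (by omega) (by omega) (by omega)
  · exact four 0 1 (2 * n) (2 * n + 3) (baseTri_w_zero.one.adj hn) (baseTri_one_w.one.adj hn).symm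
      (baseTri_hub_zero.three.adj hn) (baseTri_one_w.two.adj hn) (by omega) (by omega) (by omega)
      (by omega) (by omega) (by omega)

theorem not_inTriangle_triNum {a b c g : ℕ} (h : NumTri n a b c g) (ha : a < 2 * n + 3)
    (hb : b < 2 * n + 3) (hc : c < 2 * n + 3) :
    ¬ InTriangle (triangulation hn).dual (triNum hn a b) := by
  intro hP
  obtain ⟨a', b', h1, h2, h3⟩ := exists_of_inTriangle hn hP
  have := mem_of_triNum_eq hn h h2 h3
  omega

theorem exists_baseTri_eq (t : (triangulation hn).Tri) :
    ∃ a b c g, BaseTri n a b c g ∧ t = triNum hn a b := by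
  obtain ⟨d, rfl⟩ := (triangulation hn).tri_surjective t
  have h := dart_numTri hn d
  rcases id h with h' | h' | h'
  · exact ⟨_, _, _, _, h', (triNum_dart hn d).symm⟩
  · refine ⟨_, _, _, _, h', ?_⟩
    rw [triNum_rotate hn h, triNum_dart]
  · refine ⟨_, _, _, _, h', ?_⟩
    rw [triNum_rotate_rotate hn h, triNum_dart]

variable (n) in
/-- The vertices of the dual graph around the vertices of degree three of `T n` are fixed. -/
theorem dual_fixed (φ : (triangulation hn).dual ≃g (triangulation hn).dual) :
    φ (triNum hn 0 1) = triNum hn 0 1 ∧ φ (triNum hn (2 * n + 2) 0) = triNum hn (2 * n + 2) 0 ∧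
    φ (triNum hn 1 (2 * n + 2)) = triNum hn 1 (2 * n + 2) ∧ φ (triNum hn 1 2) = triNum hn 1 2 ∧
    φ (triNum hn (2 * n) 1) = triNum hn (2 * n) 1 ∧
    φ (triNum hn 2 (2 * n)) = triNum hn 2 (2 * n) ∧
    φ (triNum hn (2 * n) 0) = triNum hn (2 * n) 0 ∧
    φ (triNum hn 1 (2 * n)) = triNum hn 1 (2 * n) ∧
    φ (triNum hn (2 * n) 2) = triNum hn (2 * n) 2 ∧
    φ (triNum hn (2 * n + 1) 1) = triNum hn (2 * n + 1) 1 ∧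
    φ (triNum hn (2 * n + 1) 2) = triNum hn (2 * n + 1) 2 ∧
    φ (triNum hn (2 * n + 1) 3) = triNum hn (2 * n + 1) 3 := by
  have tx₁ := (baseTri_zero_one (n := n)).one
  have tx₂ := (baseTri_w_zero (n := n)).one
  have tx₃ := (baseTri_one_w (n := n)).one
  have ty₁ := (baseTri_one_two (n := n)).one
  have ty₂ := (baseTri_hub_one (n := n)).one
  have ty₃ := (baseTri_two_hub (n := n)).one
  have tz₁ := (baseTri_hub_zero (n := n)).one
  have tz₂ := (baseTri_one_hub (n := n)).one
  have ta := (baseTri_hub_last (by omega : 2 * n - 1 + 1 = 2 * n)).one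
  have ta₂ := (baseTri_hub (by omega : 2 ≤ 2) (by omega : 2 + 1 < 2 * n)).one
  have tb := (baseTri_rim_last (by omega : 2 * n - 1 + 1 = 2 * n)).one
  have tb' := (baseTri_rim (by omega : 2 * n - 2 + 1 < 2 * n)).one
  rw [show 2 * n - 2 + 1 = 2 * n - 1 by omega] at tb'
  have tb₀ := (baseTri_rim (by omega : 0 + 1 < 2 * n)).one
  have tb₁ := (baseTri_rim (by omega : 1 + 1 < 2 * n)).one
  have tb₂ := (baseTri_rim (by omega : 2 + 1 < 2 * n)).one
  have r₁ := @triNum_rotate n hn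
  have r₂ := @triNum_rotate_rotate n hn
  have hne : ∀ {a b c g a' b' c' g'}, NumTri n a b c g → NumTri n a' b' c' g' →
      ¬ (a' = a ∧ b' = b ∨ a' = b ∧ b' = c ∨ a' = c ∧ b' = a) →
      triNum hn a b ≠ triNum hn a' b' :=
    fun h h' h'' heq => h'' (mem_of_triNum_eq hn h (h'.adj hn) heq)
  refine fixed_of_neighbors φ (a := triNum hn (2 * n) (2 * n - 1)) (b := triNum hn (2 * n + 1) 0)
    (fun s => (dual_adj_triNum_iff hn tx₁ (r₁ tb₀) (r₂ tx₃) (r₁ tx₂) s).trans (by tauto))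
    (fun s => (dual_adj_triNum_iff hn tx₂ (r₁ tz₁) (r₂ tx₁) (r₁ tx₃) s).trans (by tauto))
    (fun s => (dual_adj_triNum_iff hn tx₃ (r₂ tz₂) (r₂ tx₂) (r₁ tx₁) s).trans (by tauto))
    (fun s => (dual_adj_triNum_iff hn ty₁ (r₁ tb₁) (r₂ ty₃) (r₁ ty₂) s).trans (by tauto))
    (fun s => (dual_adj_triNum_iff hn ty₂ rfl (r₂ ty₁) (r₁ ty₃) s).trans (by tauto))
    (fun s => (dual_adj_triNum_iff hn ty₃ rfl (r₂ ty₂) (r₁ ty₁) s).trans (by tauto))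
    (fun s => (dual_adj_triNum_iff hn tz₁ (r₂ ta) rfl (r₁ tz₂) s).trans (by tauto))
    (fun s => (dual_adj_triNum_iff hn tz₂ rfl (r₂ tz₁) rfl s).trans (by tauto))
    (fun s => (dual_adj_triNum_iff hn tb₀ (r₂ tb₁) rfl rfl s).trans (by tauto))
    (fun s => (dual_adj_triNum_iff hn tb₁ (r₂ tb₂) rfl rfl s).trans (by tauto))
    ?_ ?_ (not_inTriangle_triNum hn tz₁ (by omega) (by omega) (by omega))
    (not_inTriangle_triNum hn tz₂ (by omega) (by omega) (by omega))
    (not_inTriangle_triNum hn ta (by omega) (by omega) (by omega))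
    (not_inTriangle_triNum hn tb₀ (by omega) (by omega) (by omega))
    (not_inTriangle_triNum hn tb₂ (by omega) (by omega) (by omega))
    (hne tb₀ tz₁ (by omega)) (hne tb₀ tb₁ (by omega)) (hne tb₀ ta₂ (by omega))
    (hne tz₁ tb₁ (by omega)) (hne tz₁ ta₂ (by omega)) (hne tb₁ ta₂ (by omega))
    (hne tx₁ ty₂ (by omega)) (hne tx₃ ty₂ (by omega))
  · intro s hs
    rcases (dual_adj_triNum_iff hn tb (r₂ tb₀) (r₁ ta) rfl s).1 hs with rfl | rfl | rfl
    · exact not_inTriangle_triNum hn tb₀ (by omega) (by omega) (by omega)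
    · exact not_inTriangle_triNum hn ta (by omega) (by omega) (by omega)
    · exact not_inTriangle_triNum hn tb' (by omega) (by omega) (by omega)
  · intro s hs
    obtain ⟨a, b, rfl | rfl, hab, rfl⟩ := exists_of_inTriangle hn hs
    · rcases (by unfold AdjNum RelNum at hab; omega : b = 0 ∨ b = 1 ∨ b = 2 * n + 2)
        with rfl | rfl | rfl
      · rw [r₂ tx₁]; tauto
      · rw [r₂ tx₃]; tauto
      · rw [r₂ tx₂]; tauto
    · rcases (by unfold AdjNum RelNum at hab; omega : b = 1 ∨ b = 2 ∨ b = 2 * n)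
        with rfl | rfl | rfl
      · rw [r₂ ty₁]; tauto
      · rw [r₂ ty₃]; tauto
      · rw [r₂ ty₂]; tauto

theorem dual_automorphism_trivial (φ : (triangulation hn).dual ≃g (triangulation hn).dual)
    (t : (triangulation hn).Tri) : φ t = t := by
  obtain ⟨fx₁, fx₂, fx₃, fy₁, fy₂, fy₃, fz₁, fz₂, fa₂, fb₀, fb₁, fb₂⟩ := dual_fixed n hn φ
  have r₁ := @triNum_rotate n hn
  have r₂ := @triNum_rotate_rotate n hn
  -- Away from the inserted vertices the dual is a ladder: the triangles at the first hub and those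
  -- at the second form its sides, and each cycle edge is crossed by a rung. Once a rung and the one
  -- before it are fixed, both ends of the next rung are fixed by `fixed_of_adj`.
  have ladder : ∀ i, 2 ≤ i → i < 2 * n → φ (triNum hn (2 * n) i) = triNum hn (2 * n) i ∧
      φ (triNum hn i (2 * n)) = triNum hn i (2 * n) ∧
      φ (triNum hn i (2 * n + 1)) = triNum hn i (2 * n + 1) ∧
      φ (triNum hn (2 * n + 1) i) = triNum hn (2 * n + 1) i := by
    intro i hi
    induction i, hi using Nat.le_induction with
    | base =>
      intro h
      refine ⟨fa₂, fy₃, ?_, fb₁⟩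
      rw [r₂ (baseTri_rim (by omega : 2 + 1 < 2 * n)).one, fb₂]
    | succ i hi ih =>
      intro h
      obtain ⟨h1, h2, h3, h4⟩ := ih (by omega)
      have ta := (baseTri_hub hi h).one
      have tb := (baseTri_rim h).one
      rw [r₂ tb] at h3
      have Na := dual_adj_triNum_iff hn ta rfl (r₁ tb) rfl
      have Nb := dual_adj_triNum_iff hn tb rfl (r₁ ta) rfl
      refine ⟨fixed_of_adj φ h1 ((Na _).2 (by tauto)) fun s hs => ?_, ?_,
        fixed_of_adj φ h3 ((Nb _).2 (by tauto)) fun s hs => ?_, h3⟩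
      · rcases (Na s).1 hs with rfl | rfl | rfl <;> tauto
      · rw [r₂ ta, h1]
      · rcases (Nb s).1 hs with rfl | rfl | rfl <;> tauto
  obtain ⟨a, b, c, g, h, rfl⟩ := exists_baseTri_eq hn t
  rcases id h with h | h | ⟨rfl, h⟩ | ⟨rfl, h1, rfl, -⟩ | ⟨rfl, rfl, -⟩ | ⟨rfl, rfl, -⟩ |
    ⟨rfl, rfl, -⟩ | ⟨rfl, rfl, -⟩ | ⟨rfl, rfl, -⟩ | ⟨rfl, rfl, -⟩ | ⟨rfl, rfl, -⟩ | ⟨rfl, rfl, -⟩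
  · rw [h.1]
    exact (ladder b (by omega) (by omega)).1
  · rw [h.1]
    exact (ladder b (by omega) (by omega)).1
  · rcases (by omega : b = 1 ∨ 2 ≤ b) with rfl | hb
    · exact fb₀
    · exact (ladder b hb (by omega)).2.2.2
  · rw [← r₂ h.one]
    exact (ladder c (by omega) (by omega)).2.2.1
  all_goals assumption

end

end StrongEmb

/-! ### Non-isomorphic embeddings and the main theorem. -/

namespace StrongEmb

open SimpleGraph

section

variable {n : ℕ} (hn : 3 < n)

theorem card_dual : Nat.card (triangulation hn).Tri = 4 * n + 6 := by
  have h := (triangulation hn).three_mul_card_tri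
  rw [card_edgeSet_T hn] at h
  omega

theorem T_eulerChar : (Nat.card (Fin (2 * n + 5)) : ℤ) - Nat.card (T n).edgeSet +
    Nat.card (triangulation hn).Tri = 2 := by
  rw [card_edgeSet_T hn, card_dual hn, Nat.card_fin]
  push_cast
  ring

theorem dual_isKConnected : IsKConnected 3 (triangulation hn).dual :=
  (triangulation hn).dual_isKConnected (by rw [card_dual hn]; omega)
    (T_induce_preconnected hn)

theorem eq_of_isomorphic {C C' : Finset ℕ} (hC : C ⊆ Finset.range (2 * n))
    (hC' : C' ⊆ Finset.range (2 * n))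
    (h : ((triangulation hn).twist (spokes n C)).Isomorphic
      ((triangulation hn).twist (spokes n C'))) : C = C' := by
  obtain ⟨φ, hφ⟩ := h
  -- The dual is rigid, so an isomorphism of embeddings is an equality of sets of facial cycles.
  have hid : ∀ S : (triangulation hn).dual.Subgraph, Subgraph.map φ.toHom S = S := by
    have : φ.toHom = Hom.id := by
      ext t
      exact dual_automorphism_trivial hn φ t
    intro S
    rw [this, Subgraph.map_id]
  rw [show (Subgraph.map φ.toHom) = id from funext hid, Set.image_id] at hφ
  ext i
  constructor
  · intro hi
    by_contra hi'
    exact facialCycles_ne hn hC' (lt_of_mem hC hi) hi' hi hφ.symm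
  · intro hi
    by_contra hi'
    exact facialCycles_ne hn hC (lt_of_mem hC' hi) hi' hi hφ

theorem hasNonIsomorphicStrongEmbeddings {m : ℕ} (hm : 3 ≤ m)
    {P : CellularEmbedding (triangulation hn).dual → Prop}
    (hP : ∀ C ⊆ Finset.range (2 * n), C.card = m → P ((triangulation hn).twist (spokes n C))) :
    HasNonIsomorphicStrongEmbeddings (triangulation hn).dual P ((2 * n).choose m) := by
  have hcard : (Finset.powersetCard m (Finset.range (2 * n))).card = (2 * n).choose m := by
    rw [Finset.card_powersetCard, Finset.card_range]
  let e := (Finset.equivFinOfCardEq hcard).symm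
  refine ⟨fun a => (triangulation hn).twist (spokes n (e a)), fun a => ?_, fun a b hab h => ?_⟩
  · obtain ⟨h1, h2⟩ := Finset.mem_powersetCard.1 (e a).2
    exact ⟨twist_isStrong hn h1 (by omega), hP _ h1 h2⟩
  · exact hab (e.injective (Subtype.ext (eq_of_isomorphic hn
      (Finset.mem_powersetCard.1 (e a).2).1 (Finset.mem_powersetCard.1 (e b).2).1 h)))

end

end StrongEmb

theorem mainTheorem5 (n : ℕ) (hn : 3 < n) :
    (StrongEmb.IsPlanarTriangulation (StrongEmb.T n) ∧
      (∀ φ : StrongEmb.T n ≃g StrongEmb.T n, ∀ v, φ v = v) ∧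
      (∀ j : ℕ, j ≤ 1 →
        (2 * n).choose (n - j) ≤ (StrongEmb.nonadjacentK2 (StrongEmb.T n) (n - j)).ncard)) ∧
    ∃ (W : Type) (_ : Finite W) (G : SimpleGraph W),
      StrongEmb.IsKConnected 3 G ∧ StrongEmb.IsCubic G ∧ StrongEmb.IsPlanar G ∧
      StrongEmb.IsDualOf G (StrongEmb.T n) ∧
      StrongEmb.HasNonIsomorphicStrongEmbeddings G
        StrongEmb.CellularEmbedding.OnTorus ((2 * n).choose (n - n % 2)) ∧
      StrongEmb.HasNonIsomorphicStrongEmbeddings G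
        StrongEmb.CellularEmbedding.OnKleinBottle ((2 * n).choose (n - 1 + n % 2)) := by
  have hT := StrongEmb.T_connected hn
  have hχ := StrongEmb.T_eulerChar hn
  have hk := StrongEmb.dual_isKConnected hn
  have hconn := StrongEmb.Triangulation.IsKConnected_connected (by omega) hk
  refine ⟨⟨(StrongEmb.triangulation hn).isPlanarTriangulation hT hχ,
    StrongEmb.T_automorphism_trivial hn, fun j _ => StrongEmb.choose_le_ncard_nonadjacentK2 hn _⟩,
    (StrongEmb.triangulation hn).Tri, inferInstance, (StrongEmb.triangulation hn).dual, hk,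
    (StrongEmb.triangulation hn).dual_isCubic,
    (StrongEmb.triangulation hn).dual_isPlanar hconn hχ,
    (StrongEmb.triangulation hn).dual_isDualOf hT hχ,
    StrongEmb.hasNonIsomorphicStrongEmbeddings hn (by omega) fun C hC hcard => ⟨?_, ?_⟩,
    StrongEmb.hasNonIsomorphicStrongEmbeddings hn (by omega) fun C hC hcard => ⟨?_, ?_⟩⟩
  -- `n - n % 2` is the even and `n - 1 + n % 2` the odd one of `n - 1`, `n`; both are at least 3
  -- because `n > 3`.
  · exact StrongEmb.twist_isOrientable hn hC (by rw [hcard, Nat.even_iff]; omega)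
  · exact StrongEmb.twist_eulerChar hn hC (by omega)
  · exact StrongEmb.twist_not_isOrientable hn hC (by rw [hcard, Nat.odd_iff]; omega)
  · exact StrongEmb.twist_eulerChar hn hC (by omega)
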